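/- **Model.** Let $n,m\ge 3$. In the oriented $n\times m$ torus every node has four links, consistently labelled North, East, South, West. Exactly one node is a black hole; it destroys every agent that enters it, without leaving a trace. A team of $k$ identical agents starts at distinct nodes other than the black hole; each agent carries $t$ identical movable tokens, and all agents run the same deterministic Moore automaton, synchronously and from the same initial state. In each time unit an agent (i) observes the direction through which it arrived (or that it did not move), the number of tokens at its node, the number of tokens it carries, and whether another agent is at its node, and updates its state; then, as determined by its new state, it (ii) releases tokens at its node or takes tokens from it, (iii) possibly marks one of the four incident links as dangerous, which is permanent and disables the link, and (iv) stays or moves along an incident link. The automaton *solves black hole search* (BHS) with $k$ agents and $t$ tokens per agent in the $n\times m$ torus if, for every position of the black hole and every initial placement of the agents, after finitely many time units and from then on exactly the four links incident to the black hole are marked and at least one agent survives. The agents have *constant memory* if the automaton has a finite set of states, which does not depend on $n,m$; they have *unlimited memory* if the set of states is arbitrary. **Theorem.** 1. Let $n,m\ge 3$. If some automaton, possibly with unlimited memory and possibly depending on $n$ and $m$, solves BHS in the oriented $n\times m$ torus with $k$ agents and $t$ movable tokens per agent, for some number $t$ of tokens, then $k\ge 3$. That is, at least three agents are necessary in an oriented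 torus of any size, for any number of movable tokens and even with unlimited memory. 2. If an automaton with constant memory solves BHS in all oriented $n\times m$ tori, $n,m\ge 3$, with three agents and $t$ movable tokens per agent, then $t\ge 2$. That is, one movable token per agent is not enough for three constant-memory agents. -/

import Mathlib

namespace BHS

/-- The four consistently oriented port labels of an oriented torus. -/
inductive Dir
  | north
  | east
  | south
  | west

/-- The nodes of the oriented `n × m` torus. -/
abbrev Node (n m : ℕ) : Type := ZMod n × ZMod m

/-- The neighbour of the node `u` in a given direction. -/
def Dir.next {n m : ℕ} : Dir → Node n m → Node n m
  | .north, u => (u.1, u.2 + 1)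
  | .east, u => (u.1 + 1, u.2)
  | .south, u => (u.1, u.2 - 1)
  | .west, u => (u.1 - 1, u.2)

/-- The (undirected) link leaving the node `u` in direction `d`. For `n, m ≥ 3` the torus is a
simple graph, so that a link is determined by its two endpoints. -/
def link {n m : ℕ} (u : Node n m) (d : Dir) : Sym2 (Node n m) := s(u, d.next u)

/-- The four links incident to the node `u`. -/
def linksAt {n m : ℕ} (u : Node n m) : Finset (Sym2 (Node n m)) :=
  {link u .north, link u .east, link u .south, link u .west}

/-- What an agent sees at a node: the direction in which it travelled to arrive there (`none` if it
did not move), the number of tokens lying at the node, the number of tokens that it carries, and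
whether there is at least one other agent at the node. -/
structure Obs where
  arrival : Option Dir
  tokensHere : ℕ
  tokensCarried : ℕ
  company : Bool

/-- Release `s` tokens at the current node, or take `s` tokens from it. If fewer than `s` tokens
are available, the available ones are released or taken. -/
inductive TokenAction
  | put (s : ℕ)
  | pick (s : ℕ)

/-- What an agent does in one time unit: a token action, then possibly marking one incident link
as dangerous, then possibly a move. -/
structure Output where
  action : TokenAction
  mark : Option Dir
  move : Option Dir

/-- A deterministic Moore automaton with state set `S`: the common program of the identical agents.
Constant memory means that `S` is finite; unlimited memory means that `S` is arbitrary. -/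
structure Automaton (S : Type*) where
  init : S
  trans : S → Obs → S
  out : S → Output

/-- A surviving agent. -/
structure Agent (S : Type*) (n m : ℕ) where
  state : S
  pos : Node n m
  arrival : Option Dir
  carried : ℕ

/-- A global configuration with `k` agents; `agent i = none` means that agent `i` was destroyed. -/
structure Config (S : Type*) (k n m : ℕ) where
  agent : Fin k → Option (Agent S n m)
  tokens : Node n m → ℕ
  marked : Finset (Sym2 (Node n m))

section Dynamics

variable {S : Type*} {k n m : ℕ}

/-- The number of tokens that the agent releases. -/
def Agent.puts (A : Automaton S) (a : Agent S n m) : ℕ :=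
  match (A.out a.state).action with
  | .put s => min s a.carried
  | .pick _ => 0

/-- The number of tokens that the agent asks to take. -/
def Agent.asks (A : Automaton S) (a : Agent S n m) : ℕ :=
  match (A.out a.state).action with
  | .put _ => 0
  | .pick s => s

/-- The observation of the agent `a` with index `i`. -/
def Config.obs (c : Config S k n m) (i : Fin k) (a : Agent S n m) : Obs where
  arrival := a.arrival
  tokensHere := c.tokens a.pos
  tokensCarried := a.carried
  company := decide (∃ j, j ≠ i ∧ (c.agent j).map Agent.pos = some a.pos)

/-- First phase of a time unit: all agents look at their nodes and change their states. -/
def Config.look (A : Automaton S) (c : Config S k n m) : Config S k n m where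
  agent i := (c.agent i).map fun a => { a with state := A.trans a.state (c.obs i a) }
  tokens := c.tokens
  marked := c.marked

/-- The number of tokens that agent `i` releases at the node `u`. -/
def Config.putsAt (A : Automaton S) (c : Config S k n m) (u : Node n m) (i : Fin k) : ℕ :=
  match c.agent i with
  | some a => if a.pos = u then a.puts A else 0
  | none => 0

/-- The number of tokens that agent `i` asks to take from the node `u`. -/
def Config.asksAt (A : Automaton S) (c : Config S k n m) (u : Node n m) (i : Fin k) : ℕ :=
  match c.agent i with
  | some a => if a.pos = u then a.asks A else 0
  | none => 0

/-- The number of tokens at the node `u` after all releases. -/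
def Config.available (A : Automaton S) (c : Config S k n m) (u : Node n m) : ℕ :=
  c.tokens u + ∑ i, c.putsAt A u i

/-- Second phase: tokens are released, and then tokens are taken. Agents that take tokens
from the same node at the same time are served one after the other, in the order of their
indices (which the agents do not know). -/
def Config.handleTokens (A : Automaton S) (c : Config S k n m) : Config S k n m where
  agent i := (c.agent i).map fun a =>
    { a with
      carried := a.carried - a.puts A +
        min (a.asks A)
          (c.available A a.pos - ∑ j ∈ Finset.univ.filter (fun j => j < i), c.asksAt A a.pos j) }
  tokens u := c.available A u - ∑ i, c.asksAt A u i
  marked := c.marked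

/-- The set of links (at most one) that agent `i` marks. -/
def Config.marksBy (A : Automaton S) (c : Config S k n m) (i : Fin k) : Finset (Sym2 (Node n m)) :=
  match c.agent i with
  | some a =>
    match (A.out a.state).mark with
    | some d => {link a.pos d}
    | none => ∅
  | none => ∅

/-- Third phase: agents mark links, permanently, as dangerous. -/
def Config.mark (A : Automaton S) (c : Config S k n m) : Config S k n m where
  agent := c.agent
  tokens := c.tokens
  marked := c.marked ∪ Finset.univ.biUnion fun i => c.marksBy A i

/-- Fourth phase for one agent: marked links are disabled, so that an agent that tries to use one
stays where it is; an agent that enters the black hole `bh` is destroyed with what it carries. -/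
def Agent.move (A : Automaton S) (marked : Finset (Sym2 (Node n m))) (bh : Node n m)
    (a : Agent S n m) : Option (Agent S n m) :=
  match (A.out a.state).move with
  | none => some { a with arrival := none }
  | some d =>
    if link a.pos d ∈ marked then some { a with arrival := none }
    else if d.next a.pos = bh then none
    else some { a with pos := d.next a.pos, arrival := some d }

/-- Fourth phase: all agents move. -/
def Config.move (A : Automaton S) (bh : Node n m) (c : Config S k n m) : Config S k n m where
  agent i := (c.agent i).bind fun a => a.move A c.marked bh
  tokens := c.tokens
  marked := c.marked

/-- One synchronous time unit. -/
def Config.step (A : Automaton S) (bh : Node n m) (c : Config S k n m) : Config S k n m :=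
  (((c.look A).handleTokens A).mark A).move A bh

/-- The initial configuration: agent `i` is at `start i` in the initial state and carries `t`
tokens; there are no tokens on the nodes, and no link is marked. -/
def initial (A : Automaton S) (t : ℕ) (start : Fin k → Node n m) : Config S k n m where
  agent i := some { state := A.init, pos := start i, arrival := none, carried := t }
  tokens _ := 0
  marked := ∅

/-- The configuration after `τ` time units. -/
def run (A : Automaton S) (t : ℕ) (bh : Node n m) (start : Fin k → Node n m) (τ : ℕ) :
    Config S k n m :=
  (Config.step A bh)^[τ] (initial A t start)

/-- The search is completed: exactly the links incident to the black hole are marked, and at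
least one agent survives. -/
def Config.Completed (bh : Node n m) (c : Config S k n m) : Prop :=
  c.marked = linksAt bh ∧ ∃ i, (c.agent i).isSome

end Dynamics

/-- The program `A` solves black hole search with `k` scattered agents, each having `t` movable
tokens, in the oriented `n × m` torus: for every position of the black hole and every placement of
the agents at distinct nodes other than the black hole, the search is completed within finite time
(and stays so). -/
def SolvesOn {S : Type*} (A : Automaton S) (k t n m : ℕ) : Prop :=
  ∀ (bh : Node n m) (start : Fin k → Node n m),
    Function.Injective start → (∀ i, start i ≠ bh) →
      ∃ T, ∀ τ ≥ T, (run A t bh start τ).Completed bh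

/-- The program `A` solves black hole search with `k` scattered agents, each having `t` movable
tokens, in all oriented tori. -/
def Solves {S : Type*} (A : Automaton S) (k t : ℕ) : Prop :=
  ∀ n m : ℕ, 3 ≤ n → 3 ≤ m → SolvesOn A k t n m

end BHS

/-! Identical agents run in lockstep. As long as none of them sees another agent or a foreign token,
or is stopped by a foreign mark, each performs a translate of one and the same lone run, and the
configuration is a superposition of lone runs (`run_eq_combine`). Both bounds come from placements
in which this persists until it is too late.

Two agents (`three_le_of_solvesOn`). Let `d` be the direction of the first move of the lone run. One
agent waits just before the black hole, which lies in direction `d`, so that its first move kills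
it. The other starts on a different line parallel to `d`. If the lone run ever leaves its line, the
black hole is put at the node where this happens, and both agents die. If not, the link behind the
black hole in direction `d` is never incident to an agent and stays unmarked.

One token per agent (`two_le_of_solves`). An agent that has met nothing cannot mark, for the mark
would be wrong for another position of the black hole (`Apart.quiet`). Unrolled to the plane, the
lone run of a finite automaton is eventually periodic up to a translation (`exists_spec`): either
the agent stays with its token, or it leaves the token for good on a trip with nonzero displacement
per period. On the `N × N` torus such a trip may wind around until the agent comes upon its token
again; then a new stage begins. By pigeonhole, the stages lifted to the plane are the same for
arbitrarily large `N` (`exists_model`).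

The main weapon is `false_of_two_deaths`: if two agents die for each of two positions of the black
hole, leaving their tokens at the same nodes, then the third agent cannot tell these positions
apart. Applied to two copies on one trip (`Model.det_mem`) and to copies on two parallel trips
(`Model.co_eq`), it forces all trips into at most one line parallel to each axis
(`Model.exists_lines`). Hence a lone agent visits only `O(N)` of the `N²` nodes, and three agents
and the black hole can be placed so that nobody ever meets anything (`exists_apart`). Then nothing
is ever marked, a contradiction. -/

namespace BHS

/-! ### Lone agents and superpositions of agents that do not interact. -/

/-- A single agent on the torus, together with the tokens and the marks that are its own,
in the absence of a black hole. -/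
@[ext]
structure Solo (S : Type*) (n m : ℕ) where
  agent : Agent S n m
  tokens : Node n m → ℕ
  marked : Finset (Sym2 (Node n m))

section Solo

variable {S : Type*} {k n m : ℕ}

/-- The links that an agent marks. -/
def Agent.marks (A : Automaton S) (a : Agent S n m) : Finset (Sym2 (Node n m)) :=
  match (A.out a.state).mark with
  | some d => {link a.pos d}
  | none => ∅

/-- The move of an agent in the absence of a black hole. -/
def Agent.walk (A : Automaton S) (M : Finset (Sym2 (Node n m))) (a : Agent S n m) :
    Agent S n m :=
  match (A.out a.state).move with
  | none => { a with arrival := none }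
  | some d =>
    if link a.pos d ∈ M then { a with arrival := none }
    else { a with pos := d.next a.pos, arrival := some d }

/-- The lone agent after its observation. -/
def Solo.looked (A : Automaton S) (z : Solo S n m) : Agent S n m :=
  { z.agent with
    state := A.trans z.agent.state
      ⟨z.agent.arrival, z.tokens z.agent.pos, z.agent.carried, false⟩ }

/-- The tokens at the node of the lone agent after the release. -/
def Solo.avail (A : Automaton S) (z : Solo S n m) : ℕ :=
  z.tokens z.agent.pos + (z.looked A).puts A

/-- The lone agent after its token action. -/
def Solo.handled (A : Automaton S) (z : Solo S n m) : Agent S n m :=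
  { z.looked A with
    carried := (z.looked A).carried - (z.looked A).puts A +
      min ((z.looked A).asks A) (z.avail A) }

/-- One time unit of a lone agent. -/
def Solo.step (A : Automaton S) (z : Solo S n m) : Solo S n m where
  agent := (z.handled A).walk A (z.marked ∪ (z.looked A).marks A)
  tokens := Function.update z.tokens z.agent.pos (z.avail A - (z.looked A).asks A)
  marked := z.marked ∪ (z.looked A).marks A

/-- The initial configuration of a lone agent. -/
def Solo.initial (A : Automaton S) (t : ℕ) (u : Node n m) : Solo S n m where
  agent := ⟨A.init, u, none, t⟩
  tokens _ := 0
  marked := ∅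

/-- The run of a lone agent. -/
def Solo.run (A : Automaton S) (t : ℕ) (u : Node n m) (τ : ℕ) : Solo S n m :=
  (Solo.step A)^[τ] (Solo.initial A t u)

theorem Solo.run_succ (A : Automaton S) (t : ℕ) (u : Node n m) (τ : ℕ) :
    Solo.run A t u (τ + 1) = (Solo.run A t u τ).step A :=
  Function.iterate_succ_apply' _ _ _

theorem BHS_run_succ (A : Automaton S) (t : ℕ) (bh : Node n m) (start : Fin k → Node n m)
    (τ : ℕ) : run A t bh start (τ + 1) = (run A t bh start τ).step A bh :=
  Function.iterate_succ_apply' _ _ _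

theorem Agent.walk_state (A : Automaton S) (M : Finset (Sym2 (Node n m))) (a : Agent S n m) :
    (a.walk A M).state = a.state := by
  unfold Agent.walk
  split
  · rfl
  · split <;> rfl

theorem Agent.move_eq_walk (A : Automaton S) (M : Finset (Sym2 (Node n m))) (bh : Node n m)
    (a : Agent S n m) (h : a.pos ≠ bh) :
    a.move A M bh = if (a.walk A M).pos = bh then none else some (a.walk A M) := by
  unfold Agent.move Agent.walk
  cases (A.out a.state).move with
  | none => simp [h]
  | some d => by_cases hl : link a.pos d ∈ M <;> simp [h, hl]

theorem Agent.walk_congr (A : Automaton S) {M M' : Finset (Sym2 (Node n m))} (a : Agent S n m)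
    (h : ∀ d, (A.out a.state).move = some d → (link a.pos d ∈ M ↔ link a.pos d ∈ M')) :
    a.walk A M = a.walk A M' := by
  unfold Agent.walk
  split
  · rfl
  · rename_i d hd
    simp only [h d hd]

/-- The superposition of lone agents, some of which have been destroyed. -/
def combine (alive : Fin k → Bool) (z : Fin k → Solo S n m) : Config S k n m where
  agent i := if alive i then some (z i).agent else none
  tokens u := ∑ i, (z i).tokens u
  marked := Finset.univ.biUnion fun i => (z i).marked

theorem initial_eq_combine (A : Automaton S) (t : ℕ) (start : Fin k → Node n m) :
    initial A t start = combine (fun _ => true) fun i => Solo.initial A t (start i) := by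
  simp only [initial, combine, Solo.initial, if_true, Finset.sum_const_zero]
  congr 1
  ext x
  simp

theorem combine_look (A : Automaton S) (alive : Fin k → Bool) (z : Fin k → Solo S n m)
    (hpos : ∀ i j, i ≠ j → alive i → alive j → (z i).agent.pos ≠ (z j).agent.pos)
    (htok : ∀ i j, i ≠ j → alive i → (z j).tokens (z i).agent.pos = 0) :
    (combine alive z).look A =
      { combine alive z with
        agent := fun i => if alive i then some ((z i).looked A) else none } := by
  unfold Config.look
  congr 1
  funext i
  by_cases hi : alive i
  · have h1 : (combine alive z).obs i (z i).agent =
        ⟨(z i).agent.arrival, (z i).tokens (z i).agent.pos, (z i).agent.carried, false⟩ := by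
      unfold Config.obs
      congr 1
      · exact Finset.sum_eq_single i (fun j _ hj => htok i j hj.symm hi)
          fun h => absurd (Finset.mem_univ _) h
      · refine decide_eq_false ?_
        rintro ⟨j, hj, hj2⟩
        revert hj2
        by_cases hj' : alive j
        · simpa [combine, hj'] using hpos j i hj hj' hi
        · simp [combine, hj']
    have h2 : (combine alive z).agent i = some (z i).agent := by simp [combine, hi]
    simp [h2, hi, h1, Solo.looked]
  · have h2 : (combine alive z).agent i = none := by simp [combine, hi]
    simp [h2, hi]

/-- With distinct places and no foreign tokens underfoot, every agent observes what it would observe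
alone, and the token sums reduce to single terms. Foreign marks are harmless unless they block the
very link that an agent tries to use, which is all that `hlink` excludes; it refers to the marks
after the marking phase of this time unit. The tokens and marks of a dead agent stay as they were.
-/
theorem step_combine (A : Automaton S) (bh : Node n m) (alive : Fin k → Bool)
    (z : Fin k → Solo S n m)
    (hbh : ∀ i, alive i → (z i).agent.pos ≠ bh)
    (hpos : ∀ i j, i ≠ j → alive i → alive j → (z i).agent.pos ≠ (z j).agent.pos)
    (htok : ∀ i j, i ≠ j → alive i → (z j).tokens (z i).agent.pos = 0)
    (hlink : ∀ i j, i ≠ j → alive i → ∀ d, (A.out ((z i).looked A).state).move = some d →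
      link (z i).agent.pos d ∈ (if alive j then (z j).step A else z j).marked →
      link (z i).agent.pos d ∈ ((z i).step A).marked) :
    (combine alive z).step A bh =
      combine (fun i => alive i && !decide (((z i).step A).agent.pos = bh))
        fun i => if alive i then (z i).step A else z i := by
  have hput : ∀ u i, ((combine alive z).look A).putsAt A u i =
      if alive i ∧ (z i).agent.pos = u then ((z i).looked A).puts A else 0 := by
    intro u i
    rw [combine_look A alive z hpos htok]
    unfold Config.putsAt
    by_cases hi : alive i <;> simp [hi, Solo.looked]
  have hask : ∀ u i, ((combine alive z).look A).asksAt A u i =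
      if alive i ∧ (z i).agent.pos = u then ((z i).looked A).asks A else 0 := by
    intro u i
    rw [combine_look A alive z hpos htok]
    unfold Config.asksAt
    by_cases hi : alive i <;> simp [hi, Solo.looked]
  have hother : ∀ i j, alive i → i ≠ j → ¬ (alive j ∧ (z j).agent.pos = (z i).agent.pos) :=
    fun i j hi hij hj => hpos i j hij hi hj.1 hj.2.symm
  have havail : ∀ i, alive i →
      ((combine alive z).look A).available A (z i).agent.pos = (z i).avail A := by
    intro i hi
    unfold Config.available Solo.avail
    congr 1
    · exact Finset.sum_eq_single i (fun j _ hj => htok i j hj.symm hi)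
        fun h => absurd (Finset.mem_univ _) h
    · rw [Finset.sum_eq_single i]
      · rw [hput, if_pos ⟨hi, rfl⟩]
      · intro j _ hj
        rw [hput, if_neg (hother i j hi hj.symm)]
      · simp
  have hasks : ∀ i, alive i → ∑ j, ((combine alive z).look A).asksAt A (z i).agent.pos j =
      ((z i).looked A).asks A := by
    intro i hi
    rw [Finset.sum_eq_single i]
    · rw [hask, if_pos ⟨hi, rfl⟩]
    · intro j _ hj
      rw [hask, if_neg (hother i j hi hj.symm)]
    · simp
  have hh : ((combine alive z).look A).handleTokens A =
      { agent := fun i => if alive i then some ((z i).handled A) else none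
        tokens := fun u => ∑ i, (if alive i then (z i).step A else z i).tokens u
        marked := (combine alive z).marked } := by
    unfold Config.handleTokens
    congr 1
    · funext i
      by_cases hi : alive i
      · have h2 : ((combine alive z).look A).agent i = some ((z i).looked A) := by
          rw [combine_look A alive z hpos htok]; simp [hi]
        have h3 : ∑ j ∈ Finset.univ.filter (fun j => j < i),
            ((combine alive z).look A).asksAt A (z i).agent.pos j = 0 := by
          refine Finset.sum_eq_zero fun j hj => ?_
          rw [hask, if_neg (hother i j hi (Finset.mem_filter.1 hj).2.ne')]
        rw [h2]
        simp only [Option.map_some, hi, if_true]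
        have h4 : ((z i).looked A).pos = (z i).agent.pos := rfl
        rw [h4, h3, havail i hi]
        simp [Solo.handled, h4]
      · have h2 : ((combine alive z).look A).agent i = none := by
          rw [combine_look A alive z hpos htok]; simp [hi]
        simp [h2, hi]
    · funext u
      by_cases hu : ∃ i, alive i ∧ (z i).agent.pos = u
      · obtain ⟨i, hi, rfl⟩ := hu
        rw [havail i hi, hasks i hi, Finset.sum_eq_single i]
        · simp [hi, Solo.step]
        · intro j _ hj
          by_cases hj' : alive j
          · simp only [hj', if_true, Solo.step]
            rw [Function.update_of_ne (hpos i j hj.symm hi hj')]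
            exact htok i j hj.symm hi
          · simpa [hj'] using htok i j hj.symm hi
        · simp
      · have h1 : ∀ i, ¬ (alive i ∧ (z i).agent.pos = u) := fun i hi => hu ⟨i, hi⟩
        unfold Config.available
        simp only [hput, hask, h1, if_false, Finset.sum_const_zero, add_zero, Nat.sub_zero]
        change ∑ i, (z i).tokens u = _
        refine Finset.sum_congr rfl fun i _ => ?_
        by_cases hi : alive i
        · simp only [hi, if_true, Solo.step]
          rw [Function.update_of_ne]
          exact fun h => h1 i ⟨hi, h.symm⟩
        · simp [hi]
  have hmark : (((combine alive z).look A).handleTokens A).mark A =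
      { agent := fun i => if alive i then some ((z i).handled A) else none
        tokens := fun u => ∑ i, (if alive i then (z i).step A else z i).tokens u
        marked := Finset.univ.biUnion fun i =>
          (if alive i then (z i).step A else z i).marked } := by
    rw [hh]
    unfold Config.mark
    congr 1
    ext x
    simp only [combine, Finset.mem_union, Finset.mem_biUnion, Finset.mem_univ, true_and,
      Config.marksBy]
    constructor
    · rintro (⟨i, hi⟩ | ⟨i, hi⟩)
      · refine ⟨i, ?_⟩
        by_cases ha : alive i <;> simp [ha, Solo.step, hi]
      · refine ⟨i, ?_⟩
        by_cases ha : alive i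
        · simp only [ha, if_true] at hi ⊢
          exact Finset.mem_union_right _ hi
        · simp [ha] at hi
    · rintro ⟨i, hi⟩
      by_cases ha : alive i
      · simp only [ha, if_true, Solo.step, Finset.mem_union] at hi
        rcases hi with hi | hi
        · exact Or.inl ⟨i, hi⟩
        · refine Or.inr ⟨i, ?_⟩
          simp only [ha, if_true]
          exact hi
      · simp only [ha] at hi
        exact Or.inl ⟨i, by simpa using hi⟩
  unfold Config.step
  rw [hmark]
  unfold Config.move combine
  congr 1
  funext i
  by_cases hi : alive i
  · simp only [hi, if_true, Option.bind_some, Bool.true_and]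
    rw [Agent.move_eq_walk A _ bh ((z i).handled A) (hbh i hi)]
    have hw : ((z i).handled A).walk A (Finset.univ.biUnion fun i =>
        (if alive i then (z i).step A else z i).marked) = ((z i).step A).agent := by
      refine Agent.walk_congr A _ fun d hd => ?_
      rw [Finset.mem_biUnion]
      constructor
      · rintro ⟨j, _, hj⟩
        by_cases hij : i = j
        · subst hij
          rw [if_pos hi] at hj
          exact hj
        · exact hlink i j hij hi d hd hj
      · intro h
        exact ⟨i, Finset.mem_univ _, by rw [if_pos hi]; exact h⟩
    rw [hw]
    by_cases hb : ((z i).step A).agent.pos = bh <;> simp [hb]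
  · simp [hi]

/-- Agents that do not interact run like lone agents: `D i` is the time at which agent `i` enters
the black hole (if it is at most the horizon `T`). -/
theorem run_eq_combine (A : Automaton S) (t : ℕ) (bh : Node n m) (start : Fin k → Node n m)
    (D : Fin k → ℕ) (T : ℕ) (hD : ∀ i, 0 < D i)
    (hbh : ∀ i, ∀ τ ≤ T, τ < D i → (Solo.run A t (start i) τ).agent.pos ≠ bh)
    (hdeath : ∀ i, D i ≤ T → (Solo.run A t (start i) (D i)).agent.pos = bh)
    (hpos : ∀ i j, i ≠ j → ∀ τ < T, τ < D i → τ < D j →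
      (Solo.run A t (start i) τ).agent.pos ≠ (Solo.run A t (start j) τ).agent.pos)
    (htok : ∀ i j, i ≠ j → ∀ τ < T, τ < D i →
      (Solo.run A t (start j) (min τ (D j))).tokens (Solo.run A t (start i) τ).agent.pos = 0)
    (hlink : ∀ i j, i ≠ j → ∀ τ < T, τ < D i → ∀ d,
      (A.out (Solo.run A t (start i) (τ + 1)).agent.state).move = some d →
      link (Solo.run A t (start i) τ).agent.pos d ∈
        (Solo.run A t (start j) (min (τ + 1) (D j))).marked →
      link (Solo.run A t (start i) τ).agent.pos d ∈
        (Solo.run A t (start i) (τ + 1)).marked) :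
    ∀ τ ≤ T, run A t bh start τ =
      combine (fun i => decide (τ < D i)) fun i => Solo.run A t (start i) (min τ (D i)) := by
  intro τ
  induction τ with
  | zero =>
    intro _
    have h : (fun i => decide (0 < D i)) = fun _ => true := by
      funext i; simp [hD i]
    rw [h]
    simpa [Solo.run, run] using initial_eq_combine A t start
  | succ τ ih =>
    intro hτ
    have hlt : τ < T := hτ
    have hmin : ∀ i, τ < D i → min τ (D i) = τ := fun i hi => min_eq_left hi.le
    have hst : ∀ i, (if decide (τ < D i) = true then (Solo.run A t (start i) (min τ (D i))).step A
        else Solo.run A t (start i) (min τ (D i))) = Solo.run A t (start i) (min (τ + 1) (D i)) := by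
      intro i
      by_cases hi : τ < D i
      · simp only [hi, decide_true, if_true]
        rw [hmin i hi, ← Solo.run_succ, min_eq_left (Nat.succ_le_of_lt hi)]
      · simp only [hi, decide_false]
        rw [min_eq_right (by omega), min_eq_right (by omega)]
        simp
    rw [BHS_run_succ, ih hlt.le, step_combine]
    · simp only [hst]
      congr 1
      funext i
      by_cases hi : τ < D i
      · rw [hmin i hi, ← Solo.run_succ]
        by_cases hi' : τ + 1 < D i
        · simp [hi, hi', hbh i (τ + 1) hτ hi']
        · have : D i = τ + 1 := by omega
          have h2 := hdeath i (by omega)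
          rw [this] at h2
          simp [h2, this]
      · have : ¬ τ + 1 < D i := by omega
        simp [hi, this]
    · intro i hi
      have hi : τ < D i := by simpa using hi
      rw [hmin i hi]
      exact hbh i τ hlt.le hi
    · intro i j hij hi hj
      have hi : τ < D i := by simpa using hi
      have hj : τ < D j := by simpa using hj
      rw [hmin i hi, hmin j hj]
      exact hpos i j hij τ hlt hi hj
    · intro i j hij hi
      have hi : τ < D i := by simpa using hi
      rw [hmin i hi]
      exact htok i j hij τ hlt hi
    · intro i j hij hi d hd hl
      have hi : τ < D i := by simpa using hi
      rw [hst j, hmin i hi] at hl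
      rw [hmin i hi] at hd ⊢
      rw [← Solo.run_succ]
      refine hlink i j hij τ hlt hi d ?_ hl
      rw [Solo.run_succ]
      simpa only [Solo.step, Agent.walk_state, Solo.handled] using hd

end Solo

/-! ### What completion forces at all earlier times. -/

section Basics

variable {S : Type*} {k n m : ℕ}

theorem Config.step_agent_none (A : Automaton S) (bh : Node n m) (c : Config S k n m) (i : Fin k)
    (h : c.agent i = none) : (c.step A bh).agent i = none := by
  simp [Config.step, Config.move, Config.mark, Config.handleTokens, Config.look, h]

theorem run_agent_none (A : Automaton S) (t : ℕ) (bh : Node n m) (start : Fin k → Node n m)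
    (i : Fin k) {τ τ' : ℕ} (hτ : τ ≤ τ') (h : (run A t bh start τ).agent i = none) :
    (run A t bh start τ').agent i = none := by
  induction τ', hτ using Nat.le_induction with
  | base => exact h
  | succ τ' _ ih => rw [BHS_run_succ]; exact Config.step_agent_none A bh _ i ih

theorem Config.subset_step_marked (A : Automaton S) (bh : Node n m) (c : Config S k n m) :
    c.marked ⊆ (c.step A bh).marked :=
  Finset.subset_union_left

theorem run_marked_mono (A : Automaton S) (t : ℕ) (bh : Node n m) (start : Fin k → Node n m) :
    Monotone fun τ => (run A t bh start τ).marked :=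
  monotone_nat_of_le_succ fun τ => by
    rw [BHS_run_succ]; exact Config.subset_step_marked A bh _

/-- Some agent survives forever. -/
theorem exists_isSome_of_completed {A : Automaton S} {t : ℕ} {bh : Node n m}
    {start : Fin k → Node n m} (h : ∃ T, ∀ τ ≥ T, (run A t bh start τ).Completed bh) (τ : ℕ) :
    ∃ i, ((run A t bh start τ).agent i).isSome := by
  by_contra hc
  push Not at hc
  obtain ⟨T, hT⟩ := h
  obtain ⟨_, i, hi⟩ := hT (max T τ) (le_max_left _ _)
  have h0 : (run A t bh start τ).agent i = none := by simpa using hc i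
  rw [run_agent_none A t bh start i (le_max_right T τ) h0] at hi
  simp at hi

/-- Only links at the black hole are ever marked. -/
theorem marked_subset_of_completed {A : Automaton S} {t : ℕ} {bh : Node n m}
    {start : Fin k → Node n m} (h : ∃ T, ∀ τ ≥ T, (run A t bh start τ).Completed bh) (τ : ℕ) :
    (run A t bh start τ).marked ⊆ linksAt bh := by
  obtain ⟨T, hT⟩ := h
  rw [← (hT (max T τ) (le_max_left _ _)).1]
  exact run_marked_mono A t bh start (le_max_right T τ)

theorem link_mem_linksAt (u : Node n m) (d : Dir) : link u d ∈ linksAt u := by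
  cases d <;> simp [linksAt]

theorem mem_link_iff (u p : Node n m) (d : Dir) : p ∈ link u d ↔ p = u ∨ p = d.next u := by
  simp [link]

theorem mem_of_mem_linksAt {u : Node n m} {l : Sym2 (Node n m)} (h : l ∈ linksAt u) : u ∈ l := by
  simp only [linksAt, Finset.mem_insert, Finset.mem_singleton] at h
  rcases h with rfl | rfl | rfl | rfl <;> simp [link]

end Basics

end BHS

namespace BHS

/-! ### Translation invariance of lone runs, and the nodes where a lone agent leaves traces. -/

section Translation

variable {S : Type*} {k n m : ℕ}

theorem Dir.next_add (d : Dir) (u w : Node n m) : d.next (u + w) = d.next u + w := by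
  cases d <;> ext <;> simp [Dir.next] <;> ring

theorem Dir.next_eq_add (d : Dir) (u : Node n m) : d.next u = u + d.next 0 := by
  rw [add_comm u, ← Dir.next_add, zero_add]

theorem link_add_eq_iff (p q w : Node n m) (d e : Dir) :
    link (p + w) d = link (q + w) e ↔ link p d = link q e := by
  simp only [link, Sym2.eq_iff, Dir.next_add, add_left_inj]

/-- Two lone agents whose configurations differ by the translation by `w`. -/
structure Solo.Translated (w : Node n m) (z z' : Solo S n m) : Prop where
  agent : z'.agent = { z.agent with pos := z.agent.pos + w }
  tokens : ∀ x, z'.tokens (x + w) = z.tokens x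
  marked : ∀ p d, link (p + w) d ∈ z'.marked ↔ link p d ∈ z.marked

theorem Solo.Translated.step {w : Node n m} {z z' : Solo S n m} (h : Solo.Translated w z z')
    (A : Automaton S) : Solo.Translated w (z.step A) (z'.step A) := by
  obtain ⟨h1, h2, h3⟩ := h
  have hl : z'.looked A = { z.looked A with pos := z.agent.pos + w } := by
    simp only [Solo.looked, h1, h2]
  have hav : z'.avail A = z.avail A := by
    simp only [Solo.avail, hl, h1, h2]
    rfl
  have hhd : z'.handled A = { z.handled A with pos := z.agent.pos + w } := by
    simp only [Solo.handled, hl, hav]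
    rfl
  have hm : ∀ p d, link (p + w) d ∈ z'.marked ∪ (z'.looked A).marks A ↔
      link p d ∈ z.marked ∪ (z.looked A).marks A := by
    intro p d
    rw [Finset.mem_union, Finset.mem_union, h3, hl]
    unfold Agent.marks
    simp only
    cases (A.out (z.looked A).state).mark with
    | none => simp
    | some e =>
      simp only [Finset.mem_singleton, link_add_eq_iff]
      rfl
  refine ⟨?_, ?_, hm⟩
  · simp only [Solo.step, hhd]
    unfold Agent.walk
    simp only
    cases (A.out (z.handled A).state).move with
    | none => rfl
    | some e =>
      simp only [hm]
      have : (z.handled A).pos = z.agent.pos := rfl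
      rw [this]
      by_cases hc : link z.agent.pos e ∈ z.marked ∪ (z.looked A).marks A
      · simp [hc]
      · simp [hc, Dir.next_add]
  · intro x
    have ha : (z'.looked A).asks A = (z.looked A).asks A := by rw [hl]; rfl
    simp only [Solo.step, h1, hav, ha]
    by_cases hx : x = z.agent.pos
    · subst hx; simp
    · rw [Function.update_of_ne hx, Function.update_of_ne, h2]
      simpa using hx

theorem Solo.translated_run (A : Automaton S) (t : ℕ) (u w : Node n m) (τ : ℕ) :
    Solo.Translated w (Solo.run A t u τ) (Solo.run A t (u + w) τ) := by
  induction τ with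
  | zero => exact ⟨rfl, fun _ => rfl, fun _ _ => by simp [Solo.run, Solo.initial]⟩
  | succ τ ih => rw [Solo.run_succ, Solo.run_succ]; exact ih.step A

theorem Solo.pos_run_add (A : Automaton S) (t : ℕ) (u w : Node n m) (τ : ℕ) :
    (Solo.run A t (u + w) τ).agent.pos = (Solo.run A t u τ).agent.pos + w := by
  rw [(Solo.translated_run A t u w τ).agent]

theorem Solo.pos_succ_of_not_mem (A : Automaton S) (t : ℕ) (u : Node n m) (τ : ℕ) {d : Dir}
    (hd : (A.out (Solo.run A t u (τ + 1)).agent.state).move = some d)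
    (hl : link (Solo.run A t u τ).agent.pos d ∉ (Solo.run A t u (τ + 1)).marked) :
    (Solo.run A t u (τ + 1)).agent.pos = d.next (Solo.run A t u τ).agent.pos := by
  rw [Solo.run_succ] at *
  generalize Solo.run A t u τ = z at *
  simp only [Solo.step, Agent.walk_state] at hd hl ⊢
  have : (z.handled A).pos = z.agent.pos := rfl
  unfold Agent.walk
  simp only [hd, this, hl, if_false]

theorem Solo.pos_succ (A : Automaton S) (t : ℕ) (u : Node n m) (τ : ℕ) :
    (Solo.run A t u (τ + 1)).agent.pos = (Solo.run A t u τ).agent.pos ∨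
    ∃ d : Dir, (Solo.run A t u (τ + 1)).agent.pos = d.next (Solo.run A t u τ).agent.pos := by
  rw [Solo.run_succ]
  generalize Solo.run A t u τ = z
  simp only [Solo.step]
  unfold Agent.walk
  split
  · exact Or.inl rfl
  · rename_i d _
    split
    · exact Or.inl rfl
    · exact Or.inr ⟨d, rfl⟩

theorem Solo.exists_of_tokens_ne_zero (A : Automaton S) (t : ℕ) (u : Node n m) (τ : ℕ)
    (x : Node n m) (hx : (Solo.run A t u τ).tokens x ≠ 0) :
    ∃ τ' < τ, (Solo.run A t u τ').agent.pos = x := by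
  induction τ with
  | zero => exact absurd rfl hx
  | succ τ ih =>
    by_cases h : x = (Solo.run A t u τ).agent.pos
    · exact ⟨τ, τ.lt_succ_self, h.symm⟩
    · rw [Solo.run_succ] at hx
      simp only [Solo.step, Function.update_of_ne h] at hx
      obtain ⟨τ', h1, h2⟩ := ih hx
      exact ⟨τ', h1.trans τ.lt_succ_self, h2⟩

theorem Solo.exists_of_mem_marked (A : Automaton S) (t : ℕ) (u : Node n m) (τ : ℕ)
    (l : Sym2 (Node n m)) (hl : l ∈ (Solo.run A t u τ).marked) :
    ∃ τ' < τ, ∃ d, l = link (Solo.run A t u τ').agent.pos d := by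
  induction τ with
  | zero => simp [Solo.run, Solo.initial] at hl
  | succ τ ih =>
    rw [Solo.run_succ] at hl
    simp only [Solo.step, Finset.mem_union] at hl
    rcases hl with hl | hl
    · obtain ⟨τ', h1, h2⟩ := ih hl
      exact ⟨τ', h1.trans τ.lt_succ_self, h2⟩
    · unfold Agent.marks at hl
      split at hl
      · rename_i d _
        exact ⟨τ, τ.lt_succ_self, d, Finset.mem_singleton.1 hl⟩
      · simp at hl

end Translation

/-! ### Two agents are not enough. -/

section TwoAgents

variable {S : Type*} {k n m : ℕ}

/-- The line through the origin in a given direction. -/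
def Dir.OnLine (d : Dir) (p : Node n m) : Prop :=
  match d with
  | .north | .south => p.1 = 0
  | .east | .west => p.2 = 0

theorem Dir.onLine_zero (d : Dir) : d.OnLine (0 : Node n m) := by
  cases d <;> rfl

theorem Dir.onLine_add (d : Dir) (p : Node n m) : d.OnLine (p + d.next 0) ↔ d.OnLine p := by
  cases d <;> simp [Dir.OnLine, Dir.next]

theorem ZMod.one_ne_zero_of_three_le {n : ℕ} (hn : 3 ≤ n) : (1 : ZMod n) ≠ 0 := by
  have := (ZMod.natCast_eq_zero_iff 1 n).not.2 fun h => by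
    have := Nat.le_of_dvd one_pos h; omega
  simpa using this

theorem ZMod.two_ne_zero_of_three_le {n : ℕ} (hn : 3 ≤ n) : (1 + 1 : ZMod n) ≠ 0 := by
  have := (ZMod.natCast_eq_zero_iff 2 n).not.2 fun h => by
    have := Nat.le_of_dvd two_pos h; omega
  simpa [one_add_one_eq_two] using this

theorem Dir.next_zero_ne (hn : 3 ≤ n) (hm : 3 ≤ m) (d : Dir) : d.next (0 : Node n m) ≠ 0 := by
  have h1 := ZMod.one_ne_zero_of_three_le hn
  have h2 := ZMod.one_ne_zero_of_three_le hm
  cases d <;> simp [Dir.next, Prod.ext_iff, h1, h2]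

theorem Dir.next_add_next_zero_ne (hn : 3 ≤ n) (hm : 3 ≤ m) (d : Dir) :
    d.next (0 : Node n m) + d.next 0 ≠ 0 := by
  have h1 := ZMod.two_ne_zero_of_three_le hn
  have h2 := ZMod.two_ne_zero_of_three_le hm
  have h3 : ∀ {l : ℕ} (a : ZMod l), -a + -a = 0 ↔ a + a = 0 := fun a => by
    rw [← neg_add, neg_eq_zero]
  cases d <;> simp [Dir.next, Prod.ext_iff, h1, h2, h3]

theorem Dir.exists_not_onLine (hn : 3 ≤ n) (hm : 3 ≤ m) (d : Dir) :
    ∃ u : Node n m, ¬ d.OnLine u := by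
  have h1 := ZMod.one_ne_zero_of_three_le hn
  have h2 := ZMod.one_ne_zero_of_three_le hm
  exact ⟨(1, 1), by cases d <;> simp [Dir.OnLine, h1, h2]⟩

/-- The first agent stays on its line, the others wait at a node `u` outside of this line until
their first move destroys them. -/
theorem run_eq_combine_of_onLine (hn : 3 ≤ n) (hm : 3 ≤ m) (hk : k ≤ 2) (A : Automaton S)
    (t : ℕ) (d : Dir) (u : Node n m) (hu : ¬ d.OnLine u) (T DA DB : ℕ)
    (hDB : 0 < DB) (hline : ∀ τ ≤ T, τ < DB → d.OnLine (Solo.run A t (0 : Node n m) τ).agent.pos)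
    (hB : DB ≤ T → (Solo.run A t (0 : Node n m) DB).agent.pos = u + d.next 0)
    (hDA : 0 < DA) (hstay : ∀ τ ≤ T, τ < DA → (Solo.run A t (0 : Node n m) τ).agent.pos = 0)
    (hA : DA ≤ T → (Solo.run A t (0 : Node n m) DA).agent.pos = d.next 0) :
    ∀ τ ≤ T, run A t (u + d.next 0) (fun i : Fin k => if i.val = 0 then 0 else u) τ =
      combine (fun i => decide (τ < if i.val = 0 then DB else DA)) fun i =>
        Solo.run A t (if i.val = 0 then 0 else u) (min τ (if i.val = 0 then DB else DA)) := by
  have hbl : ¬ d.OnLine (u + d.next 0) := by rwa [Dir.onLine_add]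
  have hub : u ≠ u + d.next 0 := by simpa using Dir.next_zero_ne hn hm d
  have hpu : ∀ τ, (Solo.run A t u τ).agent.pos = (Solo.run A t (0 : Node n m) τ).agent.pos + u := by
    intro τ
    have := Solo.pos_run_add A t (0 : Node n m) u τ
    rwa [zero_add] at this
  have hst : ∀ τ ≤ T, τ < DA → (Solo.run A t u τ).agent.pos = u := fun τ h1 h2 => by
    rw [hpu, hstay τ h1 h2, zero_add]
  have hAu : DA ≤ T → (Solo.run A t u DA).agent.pos = u + d.next 0 := fun h => by
    rw [hpu, hA h, add_comm]
  -- Since `k ≤ 2`, two different agents are one walker on the line and one waiting agent.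
  have hcase : ∀ i j : Fin k, i ≠ j → (i.val = 0 ∧ j.val ≠ 0) ∨ (i.val ≠ 0 ∧ j.val = 0) := by
    intro i j hij
    have := Fin.val_ne_of_ne hij
    omega
  apply run_eq_combine
  · intro i
    split <;> assumption
  · intro i τ hτ hi
    by_cases h0 : i.val = 0
    · simp only [h0, if_true] at hi ⊢
      exact fun h => hbl (h ▸ hline τ hτ hi)
    · simp only [h0, if_false] at hi ⊢
      rw [hst τ hτ hi]
      exact hub
  · intro i hi
    by_cases h0 : i.val = 0
    · simp only [h0, if_true] at hi ⊢
      exact hB hi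
    · simp only [h0, if_false] at hi ⊢
      exact hAu hi
  · intro i j hij τ hτ hi hj
    rcases hcase i j hij with ⟨hi0, hj0⟩ | ⟨hi0, hj0⟩
    · simp only [hi0, hj0, if_true, if_false] at hi hj ⊢
      rw [hst τ hτ.le hj]
      exact fun h => hu (h ▸ hline τ hτ.le hi)
    · simp only [hi0, hj0, if_true, if_false] at hi hj ⊢
      rw [hst τ hτ.le hi]
      exact fun h => hu (h ▸ hline τ hτ.le hj)
  · intro i j hij τ hτ hi
    by_contra hc
    obtain ⟨τ', h1, h2⟩ := Solo.exists_of_tokens_ne_zero _ _ _ _ _ hc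
    obtain ⟨h3, h4⟩ := lt_min_iff.1 h1
    rcases hcase i j hij with ⟨hi0, hj0⟩ | ⟨hi0, hj0⟩
    · simp only [hi0, hj0, if_true, if_false] at hi h2 h4
      rw [hst τ' (by omega) h4] at h2
      exact hu (h2 ▸ hline τ hτ.le hi)
    · simp only [hi0, hj0, if_true, if_false] at hi h2 h4
      rw [hst τ hτ.le hi] at h2
      exact hu (h2 ▸ hline τ' (by omega) h4)
  -- A link marked by the other agent has a node visited by that agent as an end. If the mover's own
  -- marks do not block the link, then its ends are the mover's places at `τ` and `τ + 1`. Each of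
  -- them lies in the mover's own territory or is the black hole, and the other agent has been at
  -- neither before its death.
  · intro i j hij τ hτ hi e he hl
    by_contra hc
    have hp := Solo.pos_succ_of_not_mem _ _ _ _ he hc
    obtain ⟨τ', h1, e', h2⟩ := Solo.exists_of_mem_marked _ _ _ _ _ hl
    obtain ⟨h3, h4⟩ := lt_min_iff.1 h1
    simp only [link, Sym2.eq_iff] at h2
    rcases hcase i j hij with ⟨hi0, hj0⟩ | ⟨hi0, hj0⟩
    · simp only [hi0, hj0, if_true, if_false] at hi h2 h4 hp
      rw [hst τ' (by omega) h4, ← hp] at h2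
      rcases h2 with ⟨h2, _⟩ | ⟨_, h2⟩
      · exact hu (h2 ▸ hline τ hτ.le hi)
      · rcases lt_or_eq_of_le (Nat.succ_le_of_lt hi) with h5 | h5
        · exact hu (h2 ▸ hline (τ + 1) hτ h5)
        · have h6 := hB (h5 ▸ hτ)
          rw [← h5] at h6
          exact hub (h2.symm.trans h6)
    · simp only [hi0, hj0, if_true, if_false] at hi h2 h4 hp
      rw [← hp, hst τ hτ.le hi] at h2
      have h7 := hline τ' (by omega) h4
      rcases h2 with ⟨h2, _⟩ | ⟨_, h2⟩
      · exact hu (h2 ▸ h7)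
      · rw [← h2] at h7
        rcases lt_or_eq_of_le (Nat.succ_le_of_lt hi) with h5 | h5
        · rw [hst (τ + 1) hτ h5] at h7
          exact hu h7
        · have h6 := hAu (h5 ▸ hτ)
          rw [← h5] at h6
          exact hbl (h6 ▸ h7)

/-- The tokens and marks of the waiting agent are confined to one node and its links, those of the
walker to a line off this node and the links at that line. So the two never influence each other,
whatever their number of tokens and their memory. -/
theorem three_le_of_solvesOn (A : Automaton S) (k t n m : ℕ) (hn : 3 ≤ n) (hm : 3 ≤ m)
    (h : SolvesOn A k t n m) : 3 ≤ k := by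
  by_contra hk
  have hk : k ≤ 2 := by omega
  set pos : ℕ → Node n m := fun τ => (Solo.run A t (0 : Node n m) τ).agent.pos with hposdef
  have hpos0 : pos 0 = 0 := rfl
  -- The direction of the first move; any direction serves if the agent never moves.
  obtain ⟨d, hd⟩ : ∃ d : Dir, ∀ τ, (∀ τ' < τ, pos τ' = 0) → pos τ ≠ 0 → pos τ = d.next 0 := by
    by_cases hm : ∃ τ, pos τ ≠ 0
    · classical
      have h1 := Nat.find_spec hm
      have h2 : ∀ τ' < Nat.find hm, pos τ' = 0 := fun τ' h => not_not.1 (Nat.find_min hm h)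
      have h3 : Nat.find hm ≠ 0 := fun h => h1 (by rw [h]; exact hpos0)
      obtain ⟨σ, hσ⟩ := Nat.exists_eq_succ_of_ne_zero h3
      rw [hσ] at h1 h2
      rcases Solo.pos_succ A t (0 : Node n m) σ with h4 | ⟨d, h4⟩
      · exact absurd (h4.trans (h2 σ σ.lt_succ_self)) h1
      · have h5 : (Solo.run A t (0 : Node n m) σ).agent.pos = 0 := h2 σ σ.lt_succ_self
        rw [h5] at h4
        refine ⟨d, fun τ h6 h7 => ?_⟩
        have : τ = σ + 1 := by
          rcases lt_trichotomy τ (σ + 1) with h8 | h8 | h8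
          · exact absurd (h2 τ h8) h7
          · exact h8
          · exact absurd (h6 _ h8) h1
        rw [this]
        exact h4
    · push Not at hm
      exact ⟨.east, fun τ _ h => absurd (hm τ) h⟩
  -- `DA` is the time of the first move. The value `T + 1`, beyond the horizon, stands for an agent
  -- that never moves.
  have hDA : ∀ T, ∃ DA, 0 < DA ∧ (∀ τ ≤ T, τ < DA → pos τ = 0) ∧
      (DA ≤ T → pos DA = d.next 0) ∧ (∀ τ, pos τ ≠ 0 → τ ≤ T → DA ≤ τ) := by
    intro T
    by_cases hm : ∃ τ, pos τ ≠ 0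
    · classical
      have h1 := Nat.find_spec hm
      have h2 : ∀ τ' < Nat.find hm, pos τ' = 0 := fun τ' h => not_not.1 (Nat.find_min hm h)
      exact ⟨Nat.find hm, Nat.pos_of_ne_zero fun h => h1 (by rw [h]; exact hpos0),
        fun τ _ => h2 τ, fun _ => hd _ h2 h1, fun τ h _ => Nat.find_min' hm h⟩
    · push Not at hm
      exact ⟨T + 1, T.succ_pos, fun τ _ _ => hm τ, fun h => by omega, fun τ h => absurd (hm τ) h⟩
  have hinj : ∀ u : Node n m, ¬ d.OnLine u →
      Function.Injective fun i : Fin k => if i.val = 0 then (0 : Node n m) else u := by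
    intro u hu i j hij
    have hu0 : u ≠ 0 := fun h => hu (h ▸ d.onLine_zero)
    apply Fin.ext
    by_cases hi : i.val = 0 <;> by_cases hj : j.val = 0 <;> simp [hi, hj] at hij ⊢
    · exact absurd hij.symm hu0
    · exact absurd hij hu0
    · omega
  have hsolve : ∀ u : Node n m, ¬ d.OnLine u → ∃ T, ∀ τ ≥ T,
      (run A t (u + d.next 0) (fun i : Fin k => if i.val = 0 then 0 else u) τ).Completed
        (u + d.next 0) := by
    intro u hu
    refine h _ _ (hinj u hu) fun i => ?_
    split
    · intro h
      rw [← Dir.onLine_add, ← h] at hu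
      exact hu d.onLine_zero
    · simpa using Dir.next_zero_ne hn hm d
  by_cases hleave : ∃ τ, ¬ d.OnLine (pos τ)
  · classical
    have hB := Nat.find_spec hleave
    have hBmin : ∀ τ < Nat.find hleave, d.OnLine (pos τ) :=
      fun τ h => not_not.1 (Nat.find_min hleave h)
    set DB := Nat.find hleave
    have hDB : 0 < DB := Nat.pos_of_ne_zero fun h => hB (by rw [h, hpos0]; exact d.onLine_zero)
    -- The black hole is put at `pos DB`, the first node off the line, and the waiting agent one
    -- step before it. Leaving the line requires a move, so `DA ≤ DB` and nobody is alive at time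
    -- `DB`.
    have hu : ¬ d.OnLine (pos DB - d.next 0) := by
      rw [← Dir.onLine_add, sub_add_cancel]; exact hB
    obtain ⟨DA, h1, h2, h3, h4⟩ := hDA DB
    have hrun := run_eq_combine_of_onLine hn hm hk A t d (pos DB - d.next 0) hu DB DA DB hDB
      (fun τ _ => hBmin τ) (fun _ => (sub_add_cancel _ _).symm) h1 h2 h3 DB le_rfl
    obtain ⟨i, hi⟩ := exists_isSome_of_completed (hsolve _ hu) DB
    rw [hrun] at hi
    have h5 := h4 DB (fun h => hB (h ▸ d.onLine_zero)) le_rfl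
    by_cases hi0 : i.val = 0
    · simp [combine, hi0] at hi
    · simp [combine, hi0, Nat.not_lt.2 h5] at hi
  · push Not at hleave
    obtain ⟨u, hu⟩ := d.exists_not_onLine hn hm
    obtain ⟨T, hT⟩ := hsolve u hu
    obtain ⟨DA, h1, h2, h3, _⟩ := hDA T
    have hrun := run_eq_combine_of_onLine hn hm hk A t d u hu T DA (T + 1) T.succ_pos
      (fun τ _ _ => hleave τ) (fun h => by omega) h1 h2 h3 T le_rfl
    have hc := (hT T le_rfl).1
    rw [hrun] at hc
    -- This link joins `u + d` and `u + 2d`. Both ends are off the walker's line, and both differ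
    -- from `u` since `n` and `m` are at least 3.
    have hl : link (u + d.next 0) d ∈ linksAt (u + d.next 0) := link_mem_linksAt _ _
    rw [← hc] at hl
    simp only [combine, Finset.mem_biUnion, Finset.mem_univ, true_and] at hl
    obtain ⟨i, hi⟩ := hl
    obtain ⟨τ', h5, e, h6⟩ := Solo.exists_of_mem_marked _ _ _ _ _ hi
    obtain ⟨h7, h8⟩ := lt_min_iff.1 h5
    have h9 : (Solo.run A t (if i.val = 0 then (0 : Node n m) else u) τ').agent.pos =
        u + d.next 0 ∨ (Solo.run A t (if i.val = 0 then (0 : Node n m) else u) τ').agent.pos =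
          u + d.next 0 + d.next 0 := by
      have h10 : d.next (u + d.next 0) = u + d.next 0 + d.next 0 := Dir.next_eq_add d _
      simp only [link, Sym2.eq_iff, h10] at h6
      rcases h6 with h6 | h6
      · exact Or.inl h6.1.symm
      · exact Or.inr h6.2.symm
    by_cases hi0 : i.val = 0
    · simp only [hi0, if_true] at h9
      have := hleave τ'
      rcases h9 with h9 | h9
      · rw [hposdef] at this
        simp only [h9, Dir.onLine_add] at this
        exact hu this
      · rw [hposdef] at this
        simp only [h9, Dir.onLine_add] at this
        exact hu this
    · simp only [hi0, if_false] at h8 h9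
      have h11 : (Solo.run A t u τ').agent.pos = u := by
        have h12 := Solo.pos_run_add A t (0 : Node n m) u τ'
        rw [zero_add] at h12
        have h13 : (Solo.run A t (0 : Node n m) τ').agent.pos = 0 := h2 τ' (by omega) h8
        rw [h12, h13, zero_add]
      rw [h11] at h9
      rcases h9 with h9 | h9
      · exact Dir.next_zero_ne hn hm d (by simpa using h9)
      · exact Dir.next_add_next_zero_ne hn hm d (by simpa [add_assoc] using h9)

end TwoAgents

end BHS

namespace BHS

/-! ### Agents with at most one token that mark nothing. -/

/-- A lone agent that ignores marks, on an arbitrary type `G` of places; its `t` tokens are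
handled as a single bundle, which lies at `tok` or is carried. -/
@[ext]
structure Lite (S G : Type*) where
  state : S
  arr : Option Dir
  pos : G
  tok : Option G

section Lite

variable {S G H : Type*}

/-- The classical conditional. -/
noncomputable def select {α : Type*} (p : Prop) (x y : α) : α :=
  @ite α p (Classical.propDecidable p) x y

theorem select_eq {α : Type*} (p : Prop) [Decidable p] (x y : α) :
    select p x y = if p then x else y := by
  by_cases h : p <;> simp [select, h]

/-- The size of a bundle of `t` tokens which is present if `p` holds. -/
noncomputable def bundle (t : ℕ) (p : Prop) : ℕ := select p t 0

theorem bundle_eq (t : ℕ) (p : Prop) [Decidable p] : bundle t p = if p then t else 0 :=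
  select_eq p t 0

/-- The observation of the agent. -/
noncomputable def Lite.obs (t : ℕ) (L : Lite S G) : Obs :=
  ⟨L.arr, bundle t (L.tok = some L.pos), bundle t (L.tok = none), false⟩

/-- One time unit; `nxt` tells the neighbours of a place. -/
noncomputable def Lite.step (A : Automaton S) (t : ℕ) (nxt : Dir → G → G) (L : Lite S G) :
    Lite S G :=
  let s := A.trans L.state (L.obs t)
  { state := s
    arr := (A.out s).move
    pos := match (A.out s).move with
      | none => L.pos
      | some d => nxt d L.pos
    tok := match (A.out s).action with
      | .put k => select (L.tok = none ∧ k ≠ 0) (some L.pos) L.tok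
      | .pick k => select (L.tok = some L.pos ∧ k ≠ 0) none L.tok }

/-- Transport along a map of places. -/
def Lite.map (f : G → H) (L : Lite S G) : Lite S H :=
  ⟨L.state, L.arr, f L.pos, L.tok.map f⟩

/-- The map `f` need not be injective: the observation only depends on whether the agent is at its
token, so it suffices that `f` does not create this coincidence. This is what allows runs to be
compared along the covering of a torus by the plane. -/
theorem Lite.map_step (A : Automaton S) (t : ℕ) {nxt : Dir → G → G} {nxt' : Dir → H → H}
    (f : G → H) (hf : ∀ d u, f (nxt d u) = nxt' d (f u)) (L : Lite S G)
    (hL : ∀ q, L.tok = some q → f L.pos = f q → L.pos = q) :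
    (L.map f).step A t nxt' = (L.step A t nxt).map f := by
  have h1 : (L.tok.map f = some (f L.pos)) ↔ L.tok = some L.pos := by
    cases hq : L.tok with
    | none => simp
    | some q =>
      simp only [Option.map_some, Option.some.injEq]
      exact ⟨fun h => (hL q hq h.symm).symm, fun h => h ▸ rfl⟩
  have h2 : (L.tok.map f = none) ↔ L.tok = none := Option.map_eq_none_iff
  have hobs : (L.map f).obs t = L.obs t := by
    simp only [Lite.obs, Lite.map, h1, h2]
  unfold Lite.step
  simp only [hobs]
  have hs : (L.map f).state = L.state := rfl
  simp only [hs]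
  generalize A.trans L.state (L.obs t) = s
  simp only [Lite.map, h1, h2, Lite.mk.injEq, true_and]
  constructor
  · cases (A.out s).move with
    | none => rfl
    | some d => exact (hf d L.pos).symm
  · cases (A.out s).action with
    | put k => by_cases h : L.tok = none ∧ k ≠ 0 <;> simp [select, h]
    | pick k => by_cases h : L.tok = some L.pos ∧ k ≠ 0 <;> simp [select, h]

/-- The initial configuration. -/
def Lite.initial (A : Automaton S) (u : G) : Lite S G := ⟨A.init, none, u, none⟩

/-- The run of such an agent on a torus. -/
noncomputable def Lite.run {n m : ℕ} (A : Automaton S) (t : ℕ) (u : Node n m) (τ : ℕ) :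
    Lite S (Node n m) :=
  (Lite.step A t Dir.next)^[τ] (Lite.initial A u)

variable {n m : ℕ}

theorem Lite.run_succ (A : Automaton S) (t : ℕ) (u : Node n m) (τ : ℕ) :
    Lite.run A t u (τ + 1) = (Lite.run A t u τ).step A t Dir.next :=
  Function.iterate_succ_apply' _ _ _

theorem Lite.run_eq_map (A : Automaton S) (t : ℕ) (u : Node n m) (τ : ℕ) :
    Lite.run A t u τ = (Lite.run A t (0 : Node n m) τ).map (· + u) := by
  induction τ with
  | zero => simp [Lite.run, Lite.initial, Lite.map]
  | succ τ ih =>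
    rw [Lite.run_succ, Lite.run_succ, ih]
    exact Lite.map_step A t _ (fun d v => (Dir.next_add d v u).symm) _
      fun q _ h => add_right_cancel h

/-- The corresponding lone agent. -/
noncomputable def Lite.toSolo (t : ℕ) (L : Lite S (Node n m)) : Solo S n m where
  agent := ⟨L.state, L.pos, L.arr, bundle t (L.tok = none)⟩
  tokens v := bundle t (L.tok = some v)
  marked := ∅

/-- For `t ≤ 1` a request for any nonzero number of tokens concerns the whole bundle, so the tokens
of an agent are never split. -/
theorem Lite.toSolo_step (A : Automaton S) (t : ℕ) (ht : t ≤ 1) (L : Lite S (Node n m))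
    (hq : (A.out (L.step A t Dir.next).state).mark = none) :
    (L.toSolo t).step A = (L.step A t Dir.next).toSolo t := by
  have hlook : (L.toSolo t).looked A =
      ⟨(L.step A t Dir.next).state, L.pos, L.arr, bundle t (L.tok = none)⟩ := rfl
  have hM : (L.toSolo t).marked ∪ ((L.toSolo t).looked A).marks A = ∅ := by
    rw [hlook]
    unfold Agent.marks
    simp only [hq]
    simp [Lite.toSolo]
  set s := (L.step A t Dir.next).state with hs
  have hs' : A.trans L.state (L.obs t) = s := rfl
  have htok : (L.step A t Dir.next).tok = match (A.out s).action with
      | .put k => select (L.tok = none ∧ k ≠ 0) (some L.pos) L.tok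
      | .pick k => select (L.tok = some L.pos ∧ k ≠ 0) none L.tok := rfl
  have hpos : (L.step A t Dir.next).pos = match (A.out s).move with
      | none => L.pos
      | some d => d.next L.pos := rfl
  have hmin : ∀ k, k ≠ 0 → min k t = t := fun k hk => by omega
  have hav : (L.toSolo t).avail A = bundle t (L.tok = some L.pos) +
      ((L.toSolo t).looked A).puts A := rfl
  refine Solo.ext ?_ ?_ hM
  · change ((L.toSolo t).handled A).walk A ((L.toSolo t).marked ∪ ((L.toSolo t).looked A).marks A)
      = ⟨s, (L.step A t Dir.next).pos, (L.step A t Dir.next).arr,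
        bundle t ((L.step A t Dir.next).tok = none)⟩
    rw [hM]
    unfold Agent.walk Solo.handled
    rw [hav, hlook]
    simp only [Finset.notMem_empty, if_false]
    have hc : bundle t (L.tok = none) -
        Agent.puts A ⟨s, L.pos, L.arr, bundle t (L.tok = none)⟩ +
        min (Agent.asks A ⟨s, L.pos, L.arr, bundle t (L.tok = none)⟩)
          (bundle t (L.tok = some L.pos) +
            Agent.puts A ⟨s, L.pos, L.arr, bundle t (L.tok = none)⟩) =
        bundle t ((L.step A t Dir.next).tok = none) := by
      rw [htok]
      unfold Agent.puts Agent.asks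
      cases (A.out s).action with
      | put k =>
        simp only
        by_cases hk : k = 0
        · subst hk; simp [bundle_eq, select_eq]
        · by_cases hL : L.tok = none
          · simp [bundle_eq, select_eq, hL, hk, hmin k hk]
          · simp [bundle_eq, select_eq, hL]
      | pick k =>
        simp only
        by_cases hk : k = 0
        · subst hk; simp [bundle_eq, select_eq]
        · by_cases hL : L.tok = some L.pos
          · simp [bundle_eq, select_eq, hL, hk, hmin k hk]
          · simp [bundle_eq, select_eq, hL]
    rw [hc, hpos]
    have ha : (L.step A t Dir.next).arr = (A.out s).move := rfl
    rw [ha]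
    cases (A.out s).move with
    | none => rfl
    | some d => rfl
  · funext v
    change Function.update (fun v => bundle t (L.tok = some v)) L.pos
      ((L.toSolo t).avail A - ((L.toSolo t).looked A).asks A) v =
        bundle t ((L.step A t Dir.next).tok = some v)
    rw [hav, hlook, htok]
    unfold Agent.puts Agent.asks
    by_cases hv : v = L.pos
    · subst hv
      simp only [Function.update_self]
      cases (A.out s).action with
      | put k =>
        simp only
        by_cases hk : k = 0
        · subst hk; simp [bundle_eq, select_eq]
        · cases hL : L.tok with
          | none => simp [bundle_eq, select_eq, hk, hmin k hk]
          | some q => simp [bundle_eq, select_eq]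
      | pick k =>
        simp only
        by_cases hk : k = 0
        · subst hk; simp [bundle_eq, select_eq]
        · by_cases hL : L.tok = some L.pos
          · simp [bundle_eq, select_eq, hL, hk]
            omega
          · simp [bundle_eq, select_eq, hL]
    · rw [Function.update_of_ne hv]
      have hv' : L.pos ≠ v := Ne.symm hv
      cases (A.out s).action with
      | put k =>
        simp only
        by_cases hL : L.tok = none ∧ k ≠ 0
        · simp [bundle_eq, select_eq, hL, hv']
        · simp only [select_eq, if_neg hL]
      | pick k =>
        simp only
        by_cases hL : L.tok = some L.pos ∧ k ≠ 0
        · simp [bundle_eq, select_eq, hL, hv']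
        · simp only [select_eq, if_neg hL]

/-- The agent marks nothing in the first `T` time units. -/
def Quiet (A : Automaton S) (t n m T : ℕ) : Prop :=
  ∀ τ < T, (A.out (Lite.run A t (0 : Node n m) (τ + 1)).state).mark = none

theorem Solo.run_eq_toSolo (A : Automaton S) (t : ℕ) (ht : t ≤ 1) (u : Node n m) (T : ℕ)
    (hq : Quiet A t n m T) : ∀ τ ≤ T, Solo.run A t u τ = (Lite.run A t u τ).toSolo t := by
  intro τ
  induction τ with
  | zero =>
    intro _
    simp [Solo.run, Solo.initial, Lite.run, Lite.initial, Lite.toSolo, bundle_eq]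
  | succ τ ih =>
    intro hτ
    rw [Solo.run_succ, ih (by omega), Lite.run_succ]
    refine Lite.toSolo_step A t ht _ ?_
    rw [← Lite.run_succ, Lite.run_eq_map]
    exact hq τ hτ

theorem Lite.pos_run (A : Automaton S) (t : ℕ) (u : Node n m) (τ : ℕ) :
    (Lite.run A t u τ).pos = (Lite.run A t (0 : Node n m) τ).pos + u := by
  rw [Lite.run_eq_map]; rfl

theorem Lite.tok_run (A : Automaton S) (t : ℕ) (u : Node n m) (τ : ℕ) :
    (Lite.run A t u τ).tok = (Lite.run A t (0 : Node n m) τ).tok.map (· + u) := by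
  rw [Lite.run_eq_map]; rfl

/-- Non-interacting agents with at most one token each, as long as they mark nothing. -/
theorem run_eq_combine_lite {k : ℕ} (A : Automaton S) (t : ℕ) (ht : t ≤ 1) (bh : Node n m)
    (start : Fin k → Node n m) (hst : Function.Injective start) (D : Fin k → ℕ) (T : ℕ)
    (hq : Quiet A t n m T) (hD : ∀ i, 0 < D i)
    (hbh : ∀ i, ∀ τ ≤ T, τ < D i → (Lite.run A t (0 : Node n m) τ).pos + start i ≠ bh)
    (hdeath : ∀ i, D i ≤ T → (Lite.run A t (0 : Node n m) (D i)).pos + start i = bh)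
    (htok : ∀ i j, i ≠ j → ∀ τ < T, τ < D i → ∀ q,
      (Lite.run A t (0 : Node n m) (min τ (D j))).tok = some q →
      q + start j ≠ (Lite.run A t (0 : Node n m) τ).pos + start i) :
    ∀ τ ≤ T, run A t bh start τ = combine (fun i => decide (τ < D i))
      fun i => (Lite.run A t (start i) (min τ (D i))).toSolo t := by
  have hsolo : ∀ i, ∀ τ ≤ T, Solo.run A t (start i) τ = (Lite.run A t (start i) τ).toSolo t :=
    fun i => Solo.run_eq_toSolo A t ht (start i) T hq
  have hp : ∀ i, ∀ τ ≤ T, (Solo.run A t (start i) τ).agent.pos =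
      (Lite.run A t (0 : Node n m) τ).pos + start i := fun i τ hτ => by
    rw [hsolo i τ hτ, ← Lite.pos_run]; rfl
  intro τ hτ
  rw [run_eq_combine A t bh start D T hD _ _ _ _ _ τ hτ]
  · congr 1
    funext i
    exact hsolo i _ (by omega)
  · intro i τ hτ hi
    rw [hp i τ hτ]
    exact hbh i τ hτ hi
  · intro i hi
    rw [hp i _ hi]
    exact hdeath i hi
  -- The offset between two agents is always that of their starting nodes, so they never meet.
  · intro i j hij τ hτ _ _
    rw [hp i τ hτ.le, hp j τ hτ.le]
    exact fun h => hij (hst (add_left_cancel h))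
  · intro i j hij τ hτ hi
    rw [hp i τ hτ.le, hsolo j _ (by omega)]
    have h : (Lite.run A t (start j) (min τ (D j))).tok ≠
        some ((Lite.run A t (0 : Node n m) τ).pos + start i) := by
      rw [Lite.tok_run]
      intro h
      obtain ⟨q, h1, h2⟩ := Option.map_eq_some_iff.1 h
      exact htok i j hij τ hτ hi q h1 h2
    simp [Lite.toSolo, bundle_eq, h]
  · intro i j _ τ hτ _ d _ hl
    rw [hsolo j _ (by omega)] at hl
    simp [Lite.toSolo] at hl

theorem Config.link_mem_step_marked {k : ℕ} (A : Automaton S) (bh : Node n m)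
    (c : Config S k n m) (i : Fin k) (a : Agent S n m) (h : (c.look A).agent i = some a) (d : Dir)
    (hd : (A.out a.state).mark = some d) : link a.pos d ∈ (c.step A bh).marked := by
  refine Finset.mem_union_right _ (Finset.mem_biUnion.2 ⟨i, Finset.mem_univ _, ?_⟩)
  simp [Config.marksBy, Config.handleTokens, h, hd]

/-- Conditions under which three agents never notice each other nor the black hole up to time
`T`. -/
structure Apart (A : Automaton S) (t : ℕ) (b : Node n m) (start : Fin 3 → Node n m) (T : ℕ) :
    Prop where
  inj : Function.Injective start
  bh : ∀ i, ∀ τ ≤ T, (Lite.run A t (0 : Node n m) τ).pos + start i ≠ b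
  nbr : ∀ i, ∀ τ ≤ T, ∀ d : Dir, d.next ((Lite.run A t (0 : Node n m) τ).pos + start i) ≠ b
  tok : ∀ i j, i ≠ j → ∀ τ ≤ T, ∀ q, (Lite.run A t (0 : Node n m) τ).tok = some q →
      q + start j ≠ (Lite.run A t (0 : Node n m) τ).pos + start i

theorem Apart.run_eq {A : Automaton S} {t : ℕ} (ht : t ≤ 1) {bh : Node n m}
    {start : Fin 3 → Node n m} {T : ℕ} (h : Apart A t bh start T) (hq : Quiet A t n m T) :
    run A t bh start T = combine (fun _ => true)
      fun i => (Lite.run A t (start i) T).toSolo t := by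
  rw [run_eq_combine_lite A t ht bh start h.inj (fun _ => T + 1) T hq (fun _ => T.succ_pos)
    (fun i τ hτ _ => h.bh i τ hτ) (fun i hi => by omega) ?_ T le_rfl]
  · congr 1
    · funext i; simp
    · funext i
      rw [min_eq_left (by omega)]
  · intro i j hij τ hτ _ q hq
    rw [min_eq_left (by omega)] at hq
    exact h.tok i j hij τ hτ.le q hq

/-- By induction on time, the configuration is a superposition of unmarked lone runs. A first mark
would lie on a link at an agent's node, but neither this node nor a neighbour of it is the black
hole, so the mark would be wrong forever. The conclusion concerns the lone run only and can be used
for every other placement. -/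
theorem Apart.quiet {A : Automaton S} {t : ℕ} (ht : t ≤ 1) {bh : Node n m}
    {start : Fin 3 → Node n m} {T : ℕ} (h : Apart A t bh start T)
    (hs : SolvesOn A 3 t n m) : Quiet A t n m (T + 1) := by
  have hmono : ∀ T' ≤ T, Apart A t bh start T' := fun T' hT' =>
    ⟨h.inj, fun i τ hτ => h.bh i τ (hτ.trans hT'), fun i τ hτ => h.nbr i τ (hτ.trans hT'),
      fun i j hij τ hτ => h.tok i j hij τ (hτ.trans hT')⟩
  suffices ∀ T' ≤ T + 1, Quiet A t n m T' from this _ le_rfl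
  intro T'
  induction T' with
  | zero => intro _ τ hτ; omega
  | succ T' ih =>
    intro hT' τ hτ
    have hq := ih (by omega)
    rcases Nat.lt_succ_iff_lt_or_eq.1 hτ with hlt | rfl
    · exact hq τ hlt
    have ha := hmono τ (by omega)
    by_contra hc
    obtain ⟨d, hd⟩ := Option.ne_none_iff_exists'.1 hc
    have hrun := ha.run_eq ht hq
    have hsol := hs bh start h.inj fun i => by
      have := h.bh i 0 (Nat.zero_le _)
      simpa [Lite.run, Lite.initial] using this
    have hsub := marked_subset_of_completed hsol (τ + 1)
    have hpos : ∀ i, (((Lite.run A t (start i) τ).toSolo t)).agent.pos =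
        (Lite.run A t (0 : Node n m) τ).pos + start i := fun i => Lite.pos_run A t _ _
    have hlook := combine_look A (fun _ : Fin 3 => true)
      (fun i => (Lite.run A t (start i) τ).toSolo t)
      (fun i j hij _ _ => by
        rw [hpos, hpos]
        exact fun h' => hij (h.inj (add_left_cancel h')))
      (fun i j hij _ => by
        rw [hpos]
        have : (Lite.run A t (start j) τ).tok ≠
            some ((Lite.run A t (0 : Node n m) τ).pos + start i) := by
          rw [Lite.tok_run]
          intro h'
          obtain ⟨q, h1, h2⟩ := Option.map_eq_some_iff.1 h'
          exact ha.tok i j hij τ le_rfl q h1 h2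
        simp [Lite.toSolo, bundle_eq, this])
    have hmem : link ((Lite.run A t (0 : Node n m) τ).pos + start 0) d ∈
        (run A t bh start (τ + 1)).marked := by
      rw [BHS_run_succ, hrun, ← hpos 0]
      refine Config.link_mem_step_marked A bh _ 0
        (Solo.looked A ((Lite.run A t (start 0) τ).toSolo t)) ?_ d ?_
      · rw [hlook]; simp
      · have h1 : (Solo.looked A ((Lite.run A t (start 0) τ).toSolo t)).state =
            (Lite.run A t (0 : Node n m) (τ + 1)).state := by
          have h2 : (Solo.looked A ((Lite.run A t (start 0) τ).toSolo t)).state =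
            (Lite.run A t (start 0) (τ + 1)).state := by
            rw [Lite.run_succ]; rfl
          rw [h2, Lite.run_eq_map]; rfl
        rw [h1]; exact hd
    have := mem_of_mem_linksAt (hsub hmem)
    rcases (mem_link_iff _ _ _).1 this with h' | h'
    · exact ha.bh 0 τ le_rfl h'.symm
    · exact ha.nbr 0 τ le_rfl d h'.symm

/-- Agents that are apart forever never mark a link, whereas four marks are due. -/
theorem false_of_forall_apart {A : Automaton S} {t : ℕ} (ht : t ≤ 1) {bh : Node n m}
    {start : Fin 3 → Node n m} (h : ∀ T, Apart A t bh start T)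
    (hs : SolvesOn A 3 t n m) : False := by
  obtain ⟨T, hT⟩ := hs bh start (h 0).inj fun i => by
    have := (h 0).bh i 0 (Nat.zero_le _)
    simpa [Lite.run, Lite.initial] using this
  have hc := (hT T le_rfl).1
  rw [(h T).run_eq ht fun τ hτ => (h T).quiet ht hs τ (by omega)] at hc
  have hl := link_mem_linksAt bh .north
  rw [← hc] at hl
  simp [combine, Lite.toSolo] at hl

/-- A node other than `v` on both the north and the south link of `v` would be both neighbours at
once, which is impossible for `m ≥ 3`. -/
theorem linksAt_injective (hm : 3 ≤ m) {u v : Node n m} (h : linksAt u = linksAt v) : u = v := by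
  have h1 : u ∈ link v .north := mem_of_mem_linksAt (h ▸ link_mem_linksAt v .north)
  have h2 : u ∈ link v .south := mem_of_mem_linksAt (h ▸ link_mem_linksAt v .south)
  rw [mem_link_iff] at h1 h2
  rcases h1 with h1 | h1
  · exact h1
  rcases h2 with h2 | h2
  · exact h2
  exfalso
  have h3 := congrArg Prod.snd (h1.symm.trans h2)
  simp only [Dir.next] at h3
  refine ZMod.two_ne_zero_of_three_le hm ?_
  linear_combination h3

theorem Agent.move_unique (A : Automaton S) (M : Finset (Sym2 (Node n m))) (b b' : Node n m)
    (a x y : Agent S n m) (hx : a.move A M b = some x) (hy : a.move A M b' = some y) : x = y := by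
  unfold Agent.move at hx hy
  cases hmv : (A.out a.state).move with
  | none =>
    simp only [hmv] at hx hy
    exact Option.some_injective _ (hx.symm.trans hy)
  | some d =>
    simp only [hmv] at hx hy
    split at hx
    · rename_i hl
      rw [if_pos hl] at hy
      exact Option.some_injective _ (hx.symm.trans hy)
    · rename_i hl
      rw [if_neg hl] at hy
      split at hx
      · simp at hx
      · split at hy
        · simp at hy
        · exact Option.some_injective _ (hx.symm.trans hy)

/-- A lone survivor cannot distinguish two possible places of the black hole. -/
theorem false_of_run_eq (hm : 3 ≤ m) {k : ℕ} (A : Automaton S) (t : ℕ) (b b' : Node n m)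
    (hb : b ≠ b') (start start' : Fin k → Node n m) (T : ℕ) (l : Fin k)
    (heq : run A t b start T = run A t b' start' T)
    (hnone : ∀ i ≠ l, (run A t b start T).agent i = none)
    (hs : ∃ T, ∀ τ ≥ T, (run A t b start τ).Completed b)
    (hs' : ∃ T, ∀ τ ≥ T, (run A t b' start' τ).Completed b') : False := by
  have hall : ∀ τ ≥ T, run A t b start τ = run A t b' start' τ := by
    intro τ hτ
    induction τ, hτ using Nat.le_induction with
    | base => exact heq
    | succ τ hτ ih =>
      have hn : ∀ i ≠ l, (run A t b start (τ + 1)).agent i = none := fun i hi =>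
        run_agent_none A t b start i (by omega) (hnone i hi)
      have hn' : ∀ i ≠ l, (run A t b' start' (τ + 1)).agent i = none := fun i hi =>
        run_agent_none A t b' start' i (by omega) (heq ▸ hnone i hi)
      -- Each run must keep a survivor, which can only be `l`. So `l` enters the black hole in
      -- neither run and makes the same move in both.
      obtain ⟨i, hi⟩ := exists_isSome_of_completed hs (τ + 1)
      have hil : i = l := by
        by_contra h; rw [hn i h] at hi; simp at hi
      obtain ⟨j, hj⟩ := exists_isSome_of_completed hs' (τ + 1)
      have hjl : j = l := by
        by_contra h; rw [hn' j h] at hj; simp at hj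
      subst hil hjl
      obtain ⟨x, hx⟩ := Option.isSome_iff_exists.1 hi
      obtain ⟨y, hy⟩ := Option.isSome_iff_exists.1 hj
      have hxy : x = y := by
        rw [BHS_run_succ] at hx hy
        rw [← ih] at hy
        obtain ⟨a, ha, ha'⟩ := Option.bind_eq_some_iff.1 hx
        obtain ⟨a2, ha2, ha2'⟩ := Option.bind_eq_some_iff.1 hy
        obtain rfl : a = a2 := Option.some_injective _ (ha.symm.trans ha2)
        exact Agent.move_unique A _ b b' a x y ha' ha2'
      have hag : (run A t b start (τ + 1)).agent = (run A t b' start' (τ + 1)).agent := by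
        funext i
        by_cases h : i = j
        · rw [h, hx, hy, hxy]
        · rw [hn i h, hn' i h]
      have htk : (run A t b start (τ + 1)).tokens = (run A t b' start' (τ + 1)).tokens := by
        rw [BHS_run_succ, BHS_run_succ, ih]; rfl
      have hmk : (run A t b start (τ + 1)).marked = (run A t b' start' (τ + 1)).marked := by
        rw [BHS_run_succ, BHS_run_succ, ih]; rfl
      revert hag htk hmk
      generalize run A t b start (τ + 1) = c
      generalize run A t b' start' (τ + 1) = c'
      cases c; cases c'
      simp only [Config.mk.injEq]
      exact fun h1 h2 h3 => ⟨h1, h2, h3⟩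
  obtain ⟨T1, h1⟩ := hs
  obtain ⟨T2, h2⟩ := hs'
  have h3 := (h1 (max T (max T1 T2)) (by omega)).1
  have h4 := (h2 (max T (max T1 T2)) (by omega)).1
  rw [hall _ (by omega), h4] at h3
  exact hb (linksAt_injective hm h3).symm

/-- Two agents that die far away from their tokens, without noticing each other, leave the third
agent with no information on the place of the black hole. -/
theorem false_of_two_deaths (hm : 3 ≤ m) {A : Automaton S} {t : ℕ} (ht : t ≤ 1)
    (hs : SolvesOn A 3 t n m) (start : Fin 3 → Node n m) (hst : Function.Injective start)
    (b : Bool → Node n m) (hb : b false ≠ b true) (D : Bool → Fin 3 → ℕ) (T : ℕ)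
    (hq : Quiet A t n m T) (hD : ∀ e i, 0 < D e i)
    (hD2 : ∀ e i, i ≠ 2 → D e i ≤ T) (hDT : ∀ e, D e 2 = T + 1)
    (hbh : ∀ e i, ∀ τ ≤ T, τ < D e i → (Lite.run A t (0 : Node n m) τ).pos + start i ≠ b e)
    (hdeath : ∀ e i, i ≠ 2 → (Lite.run A t (0 : Node n m) (D e i)).pos + start i = b e)
    (htok : ∀ e i j, i ≠ j → ∀ τ < T, τ < D e i → ∀ q,
      (Lite.run A t (0 : Node n m) (min τ (D e j))).tok = some q →
      q + start j ≠ (Lite.run A t (0 : Node n m) τ).pos + start i)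
    (hsame : ∀ i, i ≠ 2 → (Lite.run A t (0 : Node n m) (D false i)).tok =
      (Lite.run A t (0 : Node n m) (D true i)).tok) : False := by
  have hrun : ∀ e, run A t (b e) start T = combine (fun i => decide (T < D e i))
      fun i => (Lite.run A t (start i) (min T (D e i))).toSolo t := fun e =>
    run_eq_combine_lite A t ht (b e) start hst (D e) T hq (hD e) (hbh e)
      (fun i hi => hdeath e i (by rintro rfl; rw [hDT] at hi; omega)) (htok e) T le_rfl
  have hsol : ∀ e, ∃ T, ∀ τ ≥ T, (run A t (b e) start τ).Completed (b e) := fun e =>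
    hs (b e) start hst fun i => by
      have := hbh e i 0 (Nat.zero_le _) (hD e i)
      simpa [Lite.run, Lite.initial] using this
  refine false_of_run_eq hm A t (b false) (b true) hb start start T 2 ?_ ?_ (hsol _) (hsol _)
  · rw [hrun, hrun]
    unfold combine
    have hdec : ∀ i, decide (T < D false i) = decide (T < D true i) := by
      intro i
      by_cases hi : i = 2
      · subst hi; rw [hDT, hDT]
      · simp [Nat.not_lt.2 (hD2 _ i hi)]
    congr 1
    · funext i
      simp only [hdec]
      by_cases hi : i = 2
      · subst hi; rw [hDT, hDT]
      · simp [Nat.not_lt.2 (hD2 _ i hi)]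
    · funext u
      refine Finset.sum_congr rfl fun i _ => ?_
      by_cases hi : i = 2
      · subst hi; simp only [hDT]
      · simp only
        rw [min_eq_right (hD2 _ i hi), min_eq_right (hD2 _ i hi)]
        simp only [Lite.toSolo, Lite.tok_run A t (start i), hsame i hi]
  · intro i hi
    rw [hrun]
    simp [combine, Nat.not_lt.2 (hD2 _ i hi)]

end Lite

end BHS

namespace BHS

/-! ### The plane as a covering of the tori. -/

section Plane

/-- The neighbours of a point of the plane. -/
def Dir.nextZ : Dir → ℤ × ℤ → ℤ × ℤ
  | .north, u => (u.1, u.2 + 1)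
  | .east, u => (u.1 + 1, u.2)
  | .south, u => (u.1, u.2 - 1)
  | .west, u => (u.1 - 1, u.2)

/-- The coordinates of a point of the plane. -/
def co (b : Bool) (z : ℤ × ℤ) : ℤ := cond b z.2 z.1

@[simp] theorem co_add (b : Bool) (z w : ℤ × ℤ) : co b (z + w) = co b z + co b w := by
  cases b <;> rfl

@[simp] theorem co_sub (b : Bool) (z w : ℤ × ℤ) : co b (z - w) = co b z - co b w := by
  cases b <;> rfl

@[simp] theorem co_zero (b : Bool) : co b 0 = 0 := by
  cases b <;> rfl

@[simp] theorem co_nsmul (b : Bool) (k : ℕ) (z : ℤ × ℤ) : co b (k • z) = k * co b z := by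
  cases b <;> simp [co]

theorem co_ext {z w : ℤ × ℤ} (h : ∀ b, co b z = co b w) : z = w :=
  Prod.ext (h false) (h true)

theorem exists_co_ne_zero {z : ℤ × ℤ} (h : z ≠ 0) : ∃ b, co b z ≠ 0 := by
  by_contra hc
  push Not at hc
  exact h (co_ext fun b => by rw [hc b, co_zero])

theorem Dir.nextZ_add (d : Dir) (u w : ℤ × ℤ) : d.nextZ (u + w) = d.nextZ u + w := by
  cases d <;> ext <;> simp [Dir.nextZ] <;> ring

theorem Dir.abs_co_nextZ_sub_le (d : Dir) (u : ℤ × ℤ) (b : Bool) :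
    |co b (d.nextZ u) - co b u| ≤ 1 := by
  cases d <;> cases b <;> simp [Dir.nextZ, co]

/-- The projection of the plane onto a torus. -/
def proj (N : ℕ) (z : ℤ × ℤ) : Node N N := (z.1, z.2)

theorem proj_add (N : ℕ) (z w : ℤ × ℤ) : proj N (z + w) = proj N z + proj N w := by
  ext <;> simp [proj]

theorem proj_sub (N : ℕ) (z w : ℤ × ℤ) : proj N (z - w) = proj N z - proj N w := by
  ext <;> simp [proj]

theorem proj_zero (N : ℕ) : proj N 0 = 0 := by
  ext <;> simp [proj]

theorem proj_nextZ (N : ℕ) (d : Dir) (z : ℤ × ℤ) : proj N (d.nextZ z) = d.next (proj N z) := by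
  cases d <;> ext <;> simp [proj, Dir.nextZ, Dir.next]

theorem proj_eq_iff (N : ℕ) (z w : ℤ × ℤ) :
    proj N z = proj N w ↔ ∀ b, (N : ℤ) ∣ co b z - co b w := by
  have h : ∀ a c : ℤ, (a : ZMod N) = c ↔ (N : ℤ) ∣ a - c := fun a c => by
    rw [← ZMod.intCast_zmod_eq_zero_iff_dvd, Int.cast_sub, sub_eq_zero]
  simp only [proj, Prod.mk.injEq, h, Bool.forall_bool, co, cond_true, cond_false]

/-- Points with a coordinate that differs, but not by more than `M`. -/
def Sep (M : ℕ) (z w : ℤ × ℤ) : Prop := ∃ b, co b z ≠ co b w ∧ |co b z - co b w| ≤ M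

theorem Sep.proj_ne {M N : ℕ} (hMN : M < N) {z w : ℤ × ℤ} (h : Sep M z w) :
    proj N z ≠ proj N w := by
  obtain ⟨b, h1, h2⟩ := h
  intro h3
  have h4 := (proj_eq_iff N z w).1 h3 b
  have := Int.eq_zero_of_abs_lt_dvd h4 (by omega)
  omega

theorem Sep.of_ne {M : ℕ} {z w : ℤ × ℤ} (h : z ≠ w) (hM : ∀ b, |co b z - co b w| ≤ M) :
    Sep M z w := by
  obtain ⟨b, hb⟩ := exists_co_ne_zero (sub_ne_zero.2 h)
  exact ⟨b, by rw [co_sub] at hb; omega, hM b⟩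

end Plane

/-! ### Eventual periodicity of the lone run in the plane. -/

section Unrolled

variable {S : Type*}

instance : Finite Dir :=
  Finite.of_injective (fun d : Dir => match d with
    | .north => (0 : Fin 4) | .east => 1 | .south => 2 | .west => 3) fun a b h => by
    cases a <;> cases b <;> simp_all

/-- The situation of an agent at its token, which lies on the ground or is carried. -/
abbrev Contact (S : Type*) : Type _ := S × Option Dir × Bool

/-- An agent in the plane at its token. -/
def Contact.toLite (σ : Contact S) : Lite S (ℤ × ℤ) :=
  ⟨σ.1, σ.2.1, 0, cond σ.2.2 (some 0) none⟩

/-- The run of the agent in the plane. -/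
noncomputable def plane (A : Automaton S) (t : ℕ) (σ : Contact S) (τ : ℕ) : Lite S (ℤ × ℤ) :=
  (Lite.step A t Dir.nextZ)^[τ] σ.toLite

theorem plane_zero (A : Automaton S) (t : ℕ) (σ : Contact S) : plane A t σ 0 = σ.toLite := rfl

theorem plane_succ (A : Automaton S) (t : ℕ) (σ : Contact S) (τ : ℕ) :
    plane A t σ (τ + 1) = (plane A t σ τ).step A t Dir.nextZ :=
  Function.iterate_succ_apply' _ _ _

theorem Lite.step_pos (A : Automaton S) (t : ℕ) {G : Type*} (nxt : Dir → G → G) (L : Lite S G) :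
    (L.step A t nxt).pos = L.pos ∨ ∃ d, (L.step A t nxt).pos = nxt d L.pos := by
  unfold Lite.step
  simp only
  cases (A.out (A.trans L.state (L.obs t))).move with
  | none => exact Or.inl rfl
  | some d => exact Or.inr ⟨d, rfl⟩

theorem abs_co_pos_plane_succ_le (A : Automaton S) (t : ℕ) (σ : Contact S) (τ : ℕ) (b : Bool) :
    |co b (plane A t σ (τ + 1)).pos - co b (plane A t σ τ).pos| ≤ 1 := by
  rw [plane_succ]
  rcases Lite.step_pos A t Dir.nextZ (plane A t σ τ) with h | ⟨d, h⟩
  · simp [h]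
  · rw [h]; exact Dir.abs_co_nextZ_sub_le d _ b

theorem Lite.map_map {G H K : Type*} (f : G → H) (g : H → K) (L : Lite S G) :
    (L.map f).map g = L.map (g ∘ f) := by
  simp [Lite.map]

theorem Lite.map_add_step (A : Automaton S) (t : ℕ) (w : ℤ × ℤ) (L : Lite S (ℤ × ℤ)) :
    (L.map (· + w)).step A t Dir.nextZ = (L.step A t Dir.nextZ).map (· + w) :=
  Lite.map_step A t _ (fun d v => (Dir.nextZ_add d v w).symm) _ fun _ _ h => add_right_cancel h

theorem plane_add_eq_map (A : Automaton S) (t : ℕ) (σ : Contact S) (w : ℤ × ℤ) (τ₁ τ₂ : ℕ)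
    (h : plane A t σ τ₂ = (plane A t σ τ₁).map (· + w)) (d : ℕ) :
    plane A t σ (τ₂ + d) = (plane A t σ (τ₁ + d)).map (· + w) := by
  induction d with
  | zero => exact h
  | succ d ih => rw [← add_assoc, ← add_assoc, plane_succ, plane_succ, ih, Lite.map_add_step]

/-- The agent carries its token or is at the same place. -/
def Lite.Touch {G : Type*} (L : Lite S G) : Prop := L.tok = none ∨ L.tok = some L.pos

theorem Lite.tok_step_of_not_touch (A : Automaton S) (t : ℕ) {G : Type*} (nxt : Dir → G → G)
    (L : Lite S G) (h : ¬ L.Touch) : (L.step A t nxt).tok = L.tok := by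
  unfold Lite.Touch at h
  push Not at h
  unfold Lite.step
  simp only
  cases (A.out (A.trans L.state (L.obs t))).action with
  | put k => simp [select_eq, h.1]
  | pick k => simp [select_eq, h.2]

theorem Lite.step_eq_of_not_touch (A : Automaton S) (t : ℕ) (L L' : Lite S (ℤ × ℤ))
    (h : ¬ L.Touch) (h' : ¬ L'.Touch) (hs : L.state = L'.state) (ha : L.arr = L'.arr) :
    (L.step A t Dir.nextZ).state = (L'.step A t Dir.nextZ).state ∧
    (L.step A t Dir.nextZ).arr = (L'.step A t Dir.nextZ).arr ∧
    (L.step A t Dir.nextZ).pos - L.pos = (L'.step A t Dir.nextZ).pos - L'.pos := by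
  unfold Lite.Touch at h h'
  push Not at h h'
  have ho : L.obs t = L'.obs t := by
    simp [Lite.obs, bundle_eq, h, h', ha]
  have hst : A.trans L.state (L.obs t) = A.trans L'.state (L'.obs t) := by rw [ho, hs]
  unfold Lite.step
  simp only [hst, true_and]
  cases (A.out (A.trans L'.state (L'.obs t))).move with
  | none => simp
  | some d =>
    have h1 := Dir.nextZ_add d 0 L.pos
    have h2 := Dir.nextZ_add d 0 L'.pos
    rw [zero_add] at h1 h2
    simp [h1, h2]

/-- The long-term behaviour of the agent in the plane: in the period `P`, the agent moves by `w`,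
together with its token, or away from its token, which it has left at `y`. -/
structure Shape where
  /-- Start of the periodic behaviour. -/
  T : ℕ
  /-- Period. -/
  P : ℕ
  /-- Displacement in a period. -/
  w : ℤ × ℤ
  /-- Place where the token is left. -/
  y : ℤ × ℤ
  /-- Whether the token is left behind. -/
  leg : Prop

/-- The behaviour is described correctly. -/
structure Shape.Spec (A : Automaton S) (t : ℕ) (σ : Contact S) (s : Shape) : Prop where
  pos : 0 < s.P
  stay : ¬ s.leg → ∀ τ ≥ s.T, plane A t σ (τ + s.P) = (plane A t σ τ).map (· + s.w)
  ne_zero : s.leg → s.w ≠ 0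
  tok : s.leg → ∀ τ ≥ s.T, (plane A t σ τ).tok = some s.y
  periodic : s.leg → ∀ τ ≥ s.T, (plane A t σ (τ + s.P)).pos = (plane A t σ τ).pos + s.w

/-- If the agent is with its token infinitely often, then two such situations agree up to a
translation, which then repeats forever and carries the token along. Otherwise the token finally
lies still and unseen, the agent is an autonomous finite automaton, and its state and arrival
direction repeat with some displacement. -/
theorem exists_spec [Finite S] (A : Automaton S) (t : ℕ) (σ : Contact S) :
    ∃ s : Shape, s.Spec A t σ := by
  classical
  by_cases hinf : ∀ T, ∃ τ ≥ T, (plane A t σ τ).Touch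
  · have hset : Set.Infinite {τ | (plane A t σ τ).Touch} :=
      Set.infinite_of_not_bddAbove fun ⟨B, hB⟩ => by
        obtain ⟨τ, h1, h2⟩ := hinf (B + 1)
        exact absurd (hB h2) (by omega)
    obtain ⟨τ₁, h1, τ₂, h2, hne, heq⟩ := hset.exists_ne_map_eq_of_mapsTo
      (f := fun τ => ((plane A t σ τ).state, (plane A t σ τ).arr,
        decide ((plane A t σ τ).tok = none))) (t := Set.univ) (fun _ _ => Set.mem_univ _)
      Set.finite_univ
    wlog hlt : τ₁ < τ₂ generalizing τ₁ τ₂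
    · exact this τ₂ h2 τ₁ h1 hne.symm heq.symm (by omega)
    simp only [Prod.mk.injEq] at heq
    obtain ⟨e1, e2, e3⟩ := heq
    have e3 : (plane A t σ τ₁).tok = none ↔ (plane A t σ τ₂).tok = none := by
      simpa using e3
    set w := (plane A t σ τ₂).pos - (plane A t σ τ₁).pos with hw
    have hmap : plane A t σ τ₂ = (plane A t σ τ₁).map (· + w) := by
      have hp : (plane A t σ τ₂).pos = (plane A t σ τ₁).pos + w := by rw [hw]; abel
      have ht : (plane A t σ τ₂).tok = (plane A t σ τ₁).tok.map (· + w) := by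
        rcases h1 with h1 | h1
        · rw [e3.1 h1, h1]; rfl
        · rcases h2 with h2 | h2
          · rw [e3.2 h2] at h1; cases h1
          · rw [h1, h2, hp]; rfl
      exact Lite.ext e1.symm e2.symm hp ht
    refine ⟨⟨τ₁, τ₂ - τ₁, w, 0, False⟩, by simpa using hlt, fun _ τ hτ => ?_, False.elim,
      False.elim, False.elim⟩
    have := plane_add_eq_map A t σ w τ₁ τ₂ hmap (τ - τ₁)
    simp only at hτ ⊢
    rwa [show τ₂ + (τ - τ₁) = τ + (τ₂ - τ₁) by omega,
      show τ₁ + (τ - τ₁) = τ by omega] at this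
  · push Not at hinf
    obtain ⟨T, hT⟩ := hinf
    have htok : ∀ τ ≥ T, (plane A t σ τ).tok = (plane A t σ T).tok := by
      intro τ hτ
      induction τ, hτ using Nat.le_induction with
      | base => rfl
      | succ τ hτ ih => rw [plane_succ, Lite.tok_step_of_not_touch _ _ _ _ (hT τ hτ), ih]
    obtain ⟨y, hy⟩ : ∃ y, (plane A t σ T).tok = some y :=
      Option.ne_none_iff_exists'.1 fun h => hT T le_rfl (Or.inl h)
    obtain ⟨τ₁, h1, τ₂, h2, hne, heq⟩ := (Set.Ici_infinite T).exists_ne_map_eq_of_mapsTo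
      (f := fun τ => ((plane A t σ τ).state, (plane A t σ τ).arr))
      (t := Set.univ) (fun _ _ => Set.mem_univ _) Set.finite_univ
    wlog hlt : τ₁ < τ₂ generalizing τ₁ τ₂
    · exact this τ₂ h2 τ₁ h1 hne.symm heq.symm (by omega)
    have h1 : T ≤ τ₁ := h1
    have h2 : T ≤ τ₂ := h2
    simp only [Prod.mk.injEq] at heq
    set w := (plane A t σ τ₂).pos - (plane A t σ τ₁).pos with hw
    have hd : ∀ d, (plane A t σ (τ₁ + d)).state = (plane A t σ (τ₂ + d)).state ∧
        (plane A t σ (τ₁ + d)).arr = (plane A t σ (τ₂ + d)).arr ∧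
        (plane A t σ (τ₂ + d)).pos = (plane A t σ (τ₁ + d)).pos + w := by
      intro d
      induction d with
      | zero => exact ⟨heq.1, heq.2, by rw [hw]; simp⟩
      | succ d ih =>
        obtain ⟨i1, i2, i3⟩ := ih
        obtain ⟨j1, j2, j3⟩ := Lite.step_eq_of_not_touch A t _ _ (hT (τ₁ + d) (by omega))
          (hT (τ₂ + d) (by omega)) i1 i2
        rw [← add_assoc, ← add_assoc, plane_succ, plane_succ]
        refine ⟨j1, j2, ?_⟩
        rw [i3] at j3
        have := congrArg (· + ((plane A t σ (τ₁ + d)).pos + w)) j3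
        simp only [sub_add_cancel] at this
        rw [← this]; abel
    -- An agent that circles forever without displacement repeats its whole configuration, so it
    -- counts as staying, although it never sees its token again.
    by_cases hw0 : w = 0
    · have hmap : plane A t σ τ₂ = (plane A t σ τ₁).map (· + (0 : ℤ × ℤ)) := by
        have hp : (plane A t σ τ₂).pos = (plane A t σ τ₁).pos := by
          have := (hd 0).2.2
          rwa [hw0, add_zero, add_zero, add_zero] at this
        have ht : (plane A t σ τ₂).tok = (plane A t σ τ₁).tok := by rw [htok _ h2, htok _ h1]
        refine Lite.ext heq.1.symm heq.2.symm ?_ ?_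
        · simpa [Lite.map] using hp
        · simpa [Lite.map] using ht
      refine ⟨⟨τ₁, τ₂ - τ₁, 0, 0, False⟩, by simpa using hlt, fun _ τ hτ => ?_, False.elim,
        False.elim, False.elim⟩
      have := plane_add_eq_map A t σ 0 τ₁ τ₂ hmap (τ - τ₁)
      simp only at hτ ⊢
      rwa [show τ₂ + (τ - τ₁) = τ + (τ₂ - τ₁) by omega,
        show τ₁ + (τ - τ₁) = τ by omega] at this
    · refine ⟨⟨τ₁, τ₂ - τ₁, w, y, True⟩, by simpa using hlt, fun h => absurd trivial h,
        fun _ => hw0, fun _ τ hτ => ?_, fun _ τ hτ => ?_⟩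
      · simp only at hτ
        rw [htok τ (by omega), hy]
      · simp only at hτ ⊢
        have := (hd (τ - τ₁)).2.2
        rwa [show τ₂ + (τ - τ₁) = τ + (τ₂ - τ₁) by omega,
          show τ₁ + (τ - τ₁) = τ by omega] at this

theorem Shape.Spec.pos_add_mul {A : Automaton S} {t : ℕ} {σ : Contact S} {s : Shape}
    (h : s.Spec A t σ) (hl : s.leg) (k τ : ℕ) (hτ : s.T ≤ τ) :
    (plane A t σ (τ + k * s.P)).pos = (plane A t σ τ).pos + k • s.w := by
  induction k with
  | zero => simp
  | succ k ih =>
    rw [Nat.succ_mul, ← add_assoc, h.periodic hl _ (by omega), ih, succ_nsmul, add_assoc]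

theorem Shape.Spec.map_mul {A : Automaton S} {t : ℕ} {σ : Contact S} {s : Shape}
    (h : s.Spec A t σ) (hl : ¬ s.leg) (k τ : ℕ) (hτ : s.T ≤ τ) :
    plane A t σ (τ + k * s.P) = (plane A t σ τ).map (· + k • s.w) := by
  induction k with
  | zero => simp [Lite.map]
  | succ k ih =>
    rw [Nat.succ_mul, ← add_assoc, h.stay hl _ (by omega), ih, Lite.map_map]
    congr 1
    funext z
    simp only [Function.comp, succ_nsmul, add_assoc]

/-- A time after the start of the periodic behaviour, reduced to the first period. -/
theorem Shape.Spec.exists_reduce {A : Automaton S} {t : ℕ} {σ : Contact S} {s : Shape}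
    (h : s.Spec A t σ) (τ : ℕ) (hτ : s.T ≤ τ) :
    ∃ τ' k, s.T ≤ τ' ∧ τ' < s.T + s.P ∧ τ = τ' + k * s.P := by
  refine ⟨s.T + (τ - s.T) % s.P, (τ - s.T) / s.P, by omega, ?_, ?_⟩
  · have := Nat.mod_lt (τ - s.T) h.pos
    omega
  · have := Nat.mod_add_div (τ - s.T) s.P
    rw [mul_comm] at this
    omega

/-- A bound on the distances in the non-periodic part of the behaviour. -/
structure Bounded (A : Automaton S) (t : ℕ) (sh : Contact S → Shape) (R : ℕ) : Prop where
  pos : ∀ σ, ∀ τ ≤ (sh σ).T + (sh σ).P, ∀ b, |co b (plane A t σ τ).pos| ≤ R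
  tok : ∀ σ, ∀ τ ≤ (sh σ).T + (sh σ).P, ∀ q, (plane A t σ τ).tok = some q →
    ∀ b, |co b q| ≤ R

theorem Bounded.y {A : Automaton S} {t : ℕ} {sh : Contact S → Shape} {R : ℕ}
    (hsh : ∀ σ, (sh σ).Spec A t σ) (h : Bounded A t sh R) (σ : Contact S) (hl : (sh σ).leg)
    (b : Bool) : |co b (sh σ).y| ≤ R :=
  h.tok σ (sh σ).T (by omega) _ ((hsh σ).tok hl _ le_rfl) b

/-- Except on a trip, the vector from the token to the agent takes only the values of the initial
part and of one period. -/
theorem Bounded.tok_lt {A : Automaton S} {t : ℕ} {sh : Contact S → Shape} {R : ℕ}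
    (hsh : ∀ σ, (sh σ).Spec A t σ) (h : Bounded A t sh R) (σ : Contact S) (τ : ℕ)
    (hτ : (sh σ).leg → τ < (sh σ).T) (q : ℤ × ℤ) (hq : (plane A t σ τ).tok = some q) (b : Bool) :
    |co b (plane A t σ τ).pos - co b q| ≤ 2 * R := by
  have key : ∀ τ ≤ (sh σ).T + (sh σ).P, ∀ q, (plane A t σ τ).tok = some q →
      |co b (plane A t σ τ).pos - co b q| ≤ 2 * R := fun τ hτ q hq => by
    have h1 := abs_le.1 (h.pos σ τ hτ b)
    have h2 := abs_le.1 (h.tok σ τ hτ q hq b)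
    exact abs_le.2 ⟨by linarith, by linarith⟩
  by_cases hT : τ < (sh σ).T
  · exact key τ (by omega) q hq
  · have hl : ¬ (sh σ).leg := fun hl => hT (hτ hl)
    obtain ⟨τ', k, h1, h2, rfl⟩ := (hsh σ).exists_reduce τ (by omega)
    rw [(hsh σ).map_mul hl k τ' h1] at hq ⊢
    obtain ⟨q', h3, rfl⟩ := Option.map_eq_some_iff.1 hq
    have := key τ' (by omega) q' h3
    simpa [Lite.map] using this

theorem exists_bounded [Finite S] (A : Automaton S) (t : ℕ) (sh : Contact S → Shape) :
    ∃ R, Bounded A t sh R := by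
  have hfin : ∀ B : ℕ, ∃ R : ℕ, ∀ σ, ∀ τ ≤ B, ∀ b, |co b (plane A t σ τ).pos| ≤ R ∧
      ∀ q, (plane A t σ τ).tok = some q → |co b q| ≤ R := by
    intro B
    have : ∀ x : Contact S × Fin (B + 1) × Bool, ∃ R : ℕ,
        |co x.2.2 (plane A t x.1 x.2.1).pos| ≤ R ∧
        ∀ q, (plane A t x.1 x.2.1).tok = some q → |co x.2.2 q| ≤ R := by
      intro x
      cases hq : (plane A t x.1 x.2.1).tok with
      | none => exact ⟨_, (Int.natCast_natAbs _).ge, fun q h => by cases h⟩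
      | some q =>
        refine ⟨(co x.2.2 (plane A t x.1 x.2.1).pos).natAbs + (co x.2.2 q).natAbs, ?_, ?_⟩
        · push_cast; simp
        · rintro q' h; cases h; push_cast; simp
    choose r hr using this
    obtain ⟨R, hR⟩ := (Set.finite_range r).bddAbove
    refine ⟨R, fun σ τ hτ b => ?_⟩
    have h1 := hr (σ, ⟨τ, by omega⟩, b)
    have h2 : r (σ, ⟨τ, by omega⟩, b) ≤ R := hR ⟨_, rfl⟩
    have h3 : (r (σ, ⟨τ, by omega⟩, b) : ℤ) ≤ R := by exact_mod_cast h2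
    exact ⟨h1.1.trans h3, fun q hq => (h1.2 q hq).trans h3⟩
  obtain ⟨B, hB⟩ := (Set.finite_range fun σ => (sh σ).T + (sh σ).P).bddAbove
  obtain ⟨R, hR⟩ := hfin B
  have hle : ∀ σ, (sh σ).T + (sh σ).P ≤ B := fun σ => hB ⟨σ, rfl⟩
  exact ⟨R, fun σ τ hτ b => (hR σ τ (hτ.trans (hle σ)) b).1,
    fun σ τ hτ q hq b => (hR σ τ (hτ.trans (hle σ)) b).2 q hq⟩

end Unrolled

end BHS

namespace BHS

/-! ### Runs on a torus as sequences of plane runs. -/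

section Stages

variable {S : Type*}

/-- On the torus, the agent comes upon its token, but not in the plane. -/
def Coll (A : Automaton S) (t N : ℕ) (σ : Contact S) (τ : ℕ) : Prop :=
  ∃ q, (plane A t σ τ).tok = some q ∧ proj N (plane A t σ τ).pos = proj N q ∧
    (plane A t σ τ).pos ≠ q

open Classical in
/-- The time at which the agent first comes upon its token after a trip around the torus. -/
noncomputable def collTime (A : Automaton S) (t N : ℕ) (σ : Contact S) : ℕ :=
  if h : ∃ τ, Coll A t N σ τ then Nat.find h else 0

open Classical in
/-- The situation when the agent comes upon its token after a trip around the torus. -/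
noncomputable def nextContact (A : Automaton S) (t N : ℕ) (σ : Contact S) :
    Option (Contact S) :=
  if ∃ τ, Coll A t N σ τ then
    some ((plane A t σ (collTime A t N σ)).state, (plane A t σ (collTime A t N σ)).arr, true)
  else none

theorem coll_collTime {A : Automaton S} {t N : ℕ} {σ : Contact S}
    (h : (nextContact A t N σ).isSome) : Coll A t N σ (collTime A t N σ) := by
  classical
  have h' : ∃ τ, Coll A t N σ τ := by
    by_contra hc
    simp [nextContact, hc] at h
  rw [collTime, dif_pos h']
  exact Nat.find_spec h'

theorem not_coll_of_lt {A : Automaton S} {t N : ℕ} {σ : Contact S} {τ : ℕ}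
    (h : τ < collTime A t N σ) : ¬ Coll A t N σ τ := by
  classical
  by_cases h' : ∃ τ, Coll A t N σ τ
  · rw [collTime, dif_pos h'] at h
    exact Nat.find_min h' h
  · exact fun hc => h' ⟨τ, hc⟩

theorem not_coll_of_eq_none {A : Automaton S} {t N : ℕ} {σ : Contact S}
    (h : nextContact A t N σ = none) (τ : ℕ) : ¬ Coll A t N σ τ := by
  intro hc
  have : ∃ τ, Coll A t N σ τ := ⟨τ, hc⟩
  simp [nextContact, this] at h

theorem not_coll_zero {A : Automaton S} {t N : ℕ} {σ : Contact S} : ¬ Coll A t N σ 0 := by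
  rintro ⟨q, h1, -, h2⟩
  rw [plane_zero] at h1 h2
  unfold Contact.toLite at h1 h2
  cases hb : σ.2.2 with
  | false => simp [hb] at h1
  | true => simp [hb] at h1; exact h2 h1

theorem collTime_pos {A : Automaton S} {t N : ℕ} {σ : Contact S}
    (h : (nextContact A t N σ).isSome) : 0 < collTime A t N σ :=
  Nat.pos_of_ne_zero fun h0 => by
    have := coll_collTime h
    rw [h0] at this
    exact not_coll_zero this

/-- The torus looks like the plane to a lone agent until it comes upon its token modulo `N` but not
in the plane. -/
theorem iterate_step_eq_map {A : Automaton S} {t N : ℕ} {σ : Contact S} (x : ℤ × ℤ) (τ : ℕ)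
    (h : ∀ τ' < τ, ¬ Coll A t N σ τ') :
    (Lite.step A t Dir.next)^[τ] (σ.toLite.map fun z => proj N (z + x)) =
      (plane A t σ τ).map fun z => proj N (z + x) := by
  induction τ with
  | zero => rfl
  | succ τ ih =>
    rw [Function.iterate_succ_apply', ih fun τ' h' => h τ' (by omega), plane_succ]
    refine Lite.map_step A t (fun z => proj N (z + x)) ?_ _ ?_
    · intro d u
      simp only [Dir.nextZ_add, ← proj_nextZ]
    · intro q hq he
      by_contra hne
      simp only [proj_add, add_left_inj] at he
      exact h τ (by omega) ⟨q, hq, he, hne⟩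

/-- The situations at the beginnings of the stages of a run on a torus, and the places of the
token at these times. -/
noncomputable def stage (A : Automaton S) (sh : Contact S → Shape)
    (F : Contact S → Option (Contact S)) : ℕ → Contact S × (ℤ × ℤ)
  | 0 => ((A.init, none, false), 0)
  -- The default value of `getD` only matters for stages that are not reached. A stage ends at the
  -- token, which lies where the trip has left it; hence the offset grows by `y` and does not depend
  -- on `N`.
  | i + 1 => ((F (stage A sh F i).1).getD (stage A sh F i).1,
      (stage A sh F i).2 + (sh (stage A sh F i).1).y)

/-- The position of the agent in a stage. -/
noncomputable def stPos (A : Automaton S) (t : ℕ) (sh : Contact S → Shape)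
    (F : Contact S → Option (Contact S)) (i τ : ℕ) : ℤ × ℤ :=
  (plane A t (stage A sh F i).1 τ).pos + (stage A sh F i).2

/-- The place of the token in a stage. -/
noncomputable def stTok (A : Automaton S) (t : ℕ) (sh : Contact S → Shape)
    (F : Contact S → Option (Contact S)) (i τ : ℕ) : Option (ℤ × ℤ) :=
  (plane A t (stage A sh F i).1 τ).tok.map (· + (stage A sh F i).2)

/-- Stage `j` is reached. -/
def Reached (A : Automaton S) (sh : Contact S → Shape) (F : Contact S → Option (Contact S))
    (j : ℕ) : Prop :=
  ∀ i < j, (F (stage A sh F i).1).isSome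

/-- The beginning of a stage. -/
noncomputable def stTime (A : Automaton S) (t N : ℕ) (sh : Contact S → Shape)
    (F : Contact S → Option (Contact S)) : ℕ → ℕ
  | 0 => 0
  | i + 1 => stTime A t N sh F i + collTime A t N (stage A sh F i).1

/-- The description of the runs on a torus by stages. -/
structure Model (A : Automaton S) (t : ℕ) (sh : Contact S → Shape) (R : ℕ)
    (F : Contact S → Option (Contact S)) : Prop where
  spec : ∀ σ, (sh σ).Spec A t σ
  bdd : Bounded A t sh R
  large : ∀ B, ∃ N ≥ B, ∀ σ, nextContact A t N σ = F σ

/-- There are only finitely many maps from contacts to optional contacts, so one of them is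
`nextContact` for infinitely many `N`. -/
theorem exists_model [Finite S] (A : Automaton S) (t : ℕ) :
    ∃ sh R F, Model A t sh R F := by
  choose sh hsh using exists_spec A t
  obtain ⟨R, hR⟩ := exists_bounded A t sh
  obtain ⟨F, hF⟩ := Finite.exists_infinite_fiber fun N : ℕ => nextContact A t N
  rw [Set.infinite_coe_iff] at hF
  refine ⟨sh, R, F, hsh, hR, fun B => ?_⟩
  obtain ⟨N, h1, h2⟩ := hF.exists_gt B
  exact ⟨N, h2.le, fun σ => congrFun h1 σ⟩

variable {A : Automaton S} {t R : ℕ} {sh : Contact S → Shape}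
  {F : Contact S → Option (Contact S)}

/-- Outside of a trip the agent is within `2 * R < N` of its token in each coordinate, where
congruence modulo `N` is equality. -/
theorem Model.leg_of_coll (M : Model A t sh R F) {N : ℕ} (hN : 2 * R < N) {σ : Contact S} {τ : ℕ}
    (h : Coll A t N σ τ) : (sh σ).leg ∧ (sh σ).T ≤ τ := by
  by_contra hc
  obtain ⟨q, h1, h2, h3⟩ := h
  refine h3 (co_ext fun b => ?_)
  have h4 := M.bdd.tok_lt M.spec σ τ (fun hl => by
    by_contra h; exact hc ⟨hl, by omega⟩) q h1 b
  have h5 := (proj_eq_iff N _ _).1 h2 b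
  have := Int.eq_zero_of_abs_lt_dvd h5 (by omega)
  omega

theorem abs_co_pos_plane_le (A : Automaton S) (t : ℕ) (σ : Contact S) (τ : ℕ) (b : Bool) :
    |co b (plane A t σ τ).pos| ≤ τ := by
  induction τ with
  | zero => simp [plane_zero, Contact.toLite]
  | succ τ ih =>
    have h1 := abs_le.1 (abs_co_pos_plane_succ_le A t σ τ b)
    have h2 := abs_le.1 ih
    push_cast
    exact abs_le.2 ⟨by linarith, by linarith⟩

theorem Model.not_coll (M : Model A t sh R F) {N : ℕ} (hN : 2 * R < N) (σ : Contact S) {τ : ℕ}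
    (hτ : R + τ < N) : ¬ Coll A t N σ τ := by
  intro h
  obtain ⟨hl, hT⟩ := M.leg_of_coll hN h
  obtain ⟨q, h1, h2, h3⟩ := h
  rw [(M.spec σ).tok hl τ hT] at h1
  cases h1
  refine h3 (co_ext fun b => ?_)
  have h4 := abs_le.1 (abs_co_pos_plane_le A t σ τ b)
  have h6 := abs_le.1 (M.bdd.y M.spec σ hl b)
  have h5 := (proj_eq_iff N _ _).1 h2 b
  have := Int.eq_zero_of_abs_lt_dvd h5 (abs_lt.2 ⟨by omega, by omega⟩)
  omega

/-- A torus on which the stages are as described. -/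
structure Fits (A : Automaton S) (t R : ℕ) (F : Contact S → Option (Contact S)) (N : ℕ) :
    Prop where
  lt : 2 * R < N
  next : ∀ σ, nextContact A t N σ = F σ

theorem Reached.mono {i j : ℕ} (h : Reached A sh F j) (hij : i ≤ j) : Reached A sh F i :=
  fun k hk => h k (hk.trans_le hij)

/-- The starting times depend on `N`, but the positions are projections of points of the plane that
do not. This makes it possible to choose placements in the plane first and a large `N` afterwards.
-/
theorem Model.run_stTime (M : Model A t sh R F) {N : ℕ} (hN : Fits A t R F N) {j : ℕ}
    (hj : Reached A sh F j) :
    Lite.run A t (0 : Node N N) (stTime A t N sh F j) =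
      (stage A sh F j).1.toLite.map fun z => proj N (z + (stage A sh F j).2) := by
  induction j with
  | zero =>
    simp [stTime, Lite.run, Lite.initial, stage, Contact.toLite, Lite.map, proj_zero]
  | succ j ih =>
    have hs := hj j j.lt_succ_self
    have hs' := hs
    rw [← hN.next] at hs'
    have hc := coll_collTime hs'
    obtain ⟨hl, hT⟩ := M.leg_of_coll hN.lt hc
    have h1 : Lite.run A t (0 : Node N N) (stTime A t N sh F (j + 1)) =
        (plane A t (stage A sh F j).1 (collTime A t N (stage A sh F j).1)).map
          fun z => proj N (z + (stage A sh F j).2) := by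
      rw [← iterate_step_eq_map _ _ fun τ h => not_coll_of_lt h, ← ih (hj.mono j.le_succ),
        stTime, Lite.run, add_comm, Function.iterate_add_apply]
      rfl
    rw [h1]
    obtain ⟨q, h2, h3, h4⟩ := hc
    rw [(M.spec _).tok hl _ hT] at h2
    cases h2
    have h5 : (stage A sh F (j + 1)).1 =
        ((plane A t (stage A sh F j).1 (collTime A t N (stage A sh F j).1)).state,
          (plane A t (stage A sh F j).1 (collTime A t N (stage A sh F j).1)).arr, true) := by
      have h6 : nextContact A t N (stage A sh F j).1 = _ :=
        if_pos ⟨_, coll_collTime hs'⟩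
      simp only [stage]
      rw [← hN.next, h6]
      rfl
    have h7 : (stage A sh F (j + 1)).2 = (stage A sh F j).2 + (sh (stage A sh F j).1).y := rfl
    rw [h5, h7]
    refine Lite.ext rfl rfl ?_ ?_
    · simp only [Lite.map, Contact.toLite]
      rw [proj_add, h3, ← proj_add, zero_add, add_comm]
    · simp only [Lite.map, Contact.toLite, (M.spec _).tok hl _ hT]
      simp [add_comm]

theorem Model.run_stage (M : Model A t sh R F) {N : ℕ} (hN : Fits A t R F N) {j : ℕ}
    (hj : Reached A sh F j) {τ : ℕ} (hτ : ∀ τ' < τ, ¬ Coll A t N (stage A sh F j).1 τ') :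
    (Lite.run A t (0 : Node N N) (stTime A t N sh F j + τ)).pos =
        proj N (stPos A t sh F j τ) ∧
      (Lite.run A t (0 : Node N N) (stTime A t N sh F j + τ)).tok =
        (stTok A t sh F j τ).map (proj N) := by
  have h1 : Lite.run A t (0 : Node N N) (stTime A t N sh F j + τ) =
      (plane A t (stage A sh F j).1 τ).map fun z => proj N (z + (stage A sh F j).2) := by
    rw [← iterate_step_eq_map _ _ hτ, ← M.run_stTime hN hj,
        Lite.run, add_comm, Function.iterate_add_apply]
    rfl
  rw [h1]
  exact ⟨rfl, by simp [Lite.map, stTok, Function.comp_def]⟩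

theorem exists_stage_of_lt {N : ℕ} {j : ℕ}
    (hj : Reached A sh F j) {τ₀ : ℕ} (h : τ₀ < stTime A t N sh F j) :
    ∃ i < j, ∃ τ, τ₀ = stTime A t N sh F i + τ ∧ τ < collTime A t N (stage A sh F i).1 := by
  induction j with
  | zero => simp [stTime] at h
  | succ j ih =>
    by_cases h' : τ₀ < stTime A t N sh F j
    · obtain ⟨i, h1, h2⟩ := ih (hj.mono j.le_succ) h'
      exact ⟨i, by omega, h2⟩
    · refine ⟨j, j.lt_succ_self, τ₀ - stTime A t N sh F j, by omega, ?_⟩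
      rw [stTime] at h
      omega

theorem exists_stage {N : ℕ} (hN : Fits A t R F N) (τ₀ : ℕ) :
    ∃ i, Reached A sh F i ∧ ∃ τ, τ₀ = stTime A t N sh F i + τ ∧
      ∀ τ' < τ, ¬ Coll A t N (stage A sh F i).1 τ' := by
  classical
  by_cases hall : ∀ j, Reached A sh F j
  -- Every stage takes at least one time unit, so infinitely many stages exhaust the time.
  · have hge : ∀ j, j ≤ stTime A t N sh F j := by
      intro j
      induction j with
      | zero => simp
      | succ j ih =>
        have := hall (j + 1) j j.lt_succ_self
        rw [← hN.next] at this
        have := collTime_pos this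
        rw [stTime]
        omega
    obtain ⟨i, _, τ, h1, h2⟩ := exists_stage_of_lt (A := A) (t := t) (N := N)
      (hall (τ₀ + 1)) (τ₀ := τ₀) (by have := hge (τ₀ + 1); omega)
    exact ⟨i, hall i, τ, h1, fun τ' h' => not_coll_of_lt (h'.trans h2)⟩
  · push Not at hall
    obtain ⟨k, hk⟩ : ∃ k, Reached A sh F k ∧ F (stage A sh F k).1 = none := by
      have hs := Nat.find_spec hall
      have h0 : Nat.find hall ≠ 0 := fun h => hs (by rw [h]; exact fun i hi => by omega)
      obtain ⟨k, hk⟩ := Nat.exists_eq_succ_of_ne_zero h0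
      have hr : Reached A sh F k := not_not.1 (Nat.find_min hall (by omega))
      refine ⟨k, hr, ?_⟩
      by_contra hne
      rw [hk] at hs
      refine hs fun i hi => ?_
      rcases Nat.lt_succ_iff_lt_or_eq.1 hi with h | rfl
      · exact hr i h
      · exact Option.isSome_iff_ne_none.2 hne
    by_cases h : τ₀ < stTime A t N sh F k
    · obtain ⟨i, h0, τ, h1, h2⟩ := exists_stage_of_lt hk.1 h
      exact ⟨i, hk.1.mono h0.le, τ, h1, fun τ' h' => not_coll_of_lt (h'.trans h2)⟩
    · refine ⟨k, hk.1, τ₀ - stTime A t N sh F k, by omega, fun τ' _ => ?_⟩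
      have := hk.2
      rw [← hN.next] at this
      exact not_coll_of_eq_none this τ'

theorem Model.isLeg_of_reached (M : Model A t sh R F) {i : ℕ}
    (h : (F (stage A sh F i).1).isSome) : (sh (stage A sh F i).1).leg := by
  obtain ⟨N, h1, h2⟩ := M.large (2 * R + 1)
  rw [← h2] at h
  exact (M.leg_of_coll (by omega) (coll_collTime h)).1

theorem stTime_mono (A : Automaton S) (t N : ℕ) (sh : Contact S → Shape)
    (F : Contact S → Option (Contact S)) : Monotone (stTime A t N sh F) :=
  monotone_nat_of_le_succ fun i => by rw [stTime]; omega

/-- At unit speed, a trip around the torus takes at least `N - R` time units. So any fixed horizon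
fits into a stage when `N` is large. -/
theorem Model.stTime_add_le (M : Model A t sh R F) {N : ℕ} (hN : Fits A t R F N) {i j : ℕ}
    (hj : Reached A sh F j) (hij : i < j) {l : ℕ} (hl : R + l < N) :
    stTime A t N sh F i + l ≤ stTime A t N sh F j := by
  refine le_trans ?_ (stTime_mono A t N sh F hij)
  rw [stTime]
  have hs := hj i hij
  rw [← hN.next] at hs
  have hc := coll_collTime hs
  have : ¬ collTime A t N (stage A sh F i).1 < l := fun hlt =>
    M.not_coll hN.lt _ (by omega) hc
  omega

end Stages

end BHS

namespace BHS

/-! ### Placements in which the agents meet nothing. -/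

section Apartness

variable {S : Type*}

/-- Points close to one of the axes. -/
def Near (B : ℕ) (z : ℤ × ℤ) : Prop := ∃ b, |co b z| ≤ B

/-- A point far away from both axes. -/
def diag (h : ℕ) : ℤ × ℤ := (h, h)

@[simp] theorem co_diag (b : Bool) (h : ℕ) : co b (diag h) = h := by cases b <;> rfl

theorem Near.proj_ne {B N : ℕ} {z v : ℤ × ℤ} (hz : Near B z) (hv : ∀ b, 2 * (B : ℤ) < |co b v|)
    (hv' : ∀ b, |co b v| + B < N) : proj N z ≠ proj N v := by
  obtain ⟨b, hb⟩ := hz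
  intro h
  have h1 := (proj_eq_iff N _ _).1 h b
  have h2 := hv b
  have h3 := hv' b
  have h4 := abs_sub (co b z) (co b v)
  have := Int.eq_zero_of_abs_lt_dvd h1 (by linarith)
  have h5 : co b z = co b v := by linarith
  rw [← h5] at h2
  linarith [Nat.cast_nonneg (α := ℤ) B]

/-- A set of nodes that is small enough for three agents that only visit translates of it to leave
a node and all its neighbours unvisited. -/
def Small {N : ℕ} (U : Finset (Node N N)) : Prop := Nat.card (Fin 3 × Option Dir) * U.card < N * N

/-- The three agents start at multiples of a point of the diagonal. A forbidden place of the black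
hole is visited by one of them or adjacent to such a node; by `hU` these do not fill the torus. The
placement does not depend on `T`, so that it also serves for all times at once. -/
theorem exists_apart {A : Automaton S} {t N B : ℕ} (hN : 6 * (2 * B + 1) < N)
    (U : Finset (Node N N)) (hU : Small U) :
    ∃ (b : Node N N) (start : Fin 3 → Node N N), ∀ T,
      (∀ τ ≤ T, (Lite.run A t (0 : Node N N) τ).pos ∈ U ∧
        ∀ q, (Lite.run A t (0 : Node N N) τ).tok = some q →
          ∃ z, Near B z ∧ (Lite.run A t (0 : Node N N) τ).pos = q + proj N z) →
      Apart A t b start T := by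
  classical
  have : NeZero N := ⟨by omega⟩
  have : Fintype Dir := Fintype.ofFinite Dir
  -- Two starting nodes differ by `±h` or `±2h` in both coordinates. This exceeds `B` and stays
  -- below `N - B`, so it is not congruent to a point within `B` of an axis.
  set h : ℕ := 2 * B + 1 with hh
  set start : Fin 3 → Node N N := fun i => proj N (diag (i.val * h)) with hst
  set f : Node N N × (Fin 3 × Option Dir) → Node N N := fun x =>
    x.2.2.elim (x.1 + start x.2.1) fun d => d.next (x.1 + start x.2.1) with hf
  obtain ⟨b, hb⟩ : ∃ b, b ∉ (U ×ˢ Finset.univ).image f := by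
    by_contra hc
    push Not at hc
    have h1 : (U ×ˢ (Finset.univ : Finset (Fin 3 × Option Dir))).image f = Finset.univ :=
      Finset.eq_univ_iff_forall.2 hc
    have h2 := Finset.card_image_le (s := U ×ˢ (Finset.univ : Finset (Fin 3 × Option Dir)))
      (f := f)
    rw [h1, Finset.card_univ, Finset.card_product, Finset.card_univ, Fintype.card_prod,
      ZMod.card, ← Nat.card_eq_fintype_card, mul_comm U.card] at h2
    exact absurd hU (by unfold Small; omega)
  have hbf : ∀ p ∈ U, ∀ i d, f (p, i, d) ≠ b := fun p hp i d h =>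
    hb (Finset.mem_image.2 ⟨_, Finset.mem_product.2 ⟨hp, Finset.mem_univ _⟩, h⟩)
  have hdiff : ∀ i j : Fin 3, i ≠ j → ∀ z, |co true z| ≤ B ∨ |co false z| ≤ B →
      proj N z + start i ≠ start j := by
    intro i j hij z hz heq
    have hij' : i.val ≠ j.val := fun h => hij (Fin.ext h)
    have h3 : (i.val : ℤ) ≤ 2 := by omega
    have h4 : (j.val : ℤ) ≤ 2 := by omega
    have h5 : (1 : ℤ) ≤ |(i.val : ℤ) - j.val| := Int.one_le_abs (by omega)
    have h6 : |(i.val : ℤ) - j.val| ≤ 2 := abs_le.2 ⟨by omega, by omega⟩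
    rw [hst, ← proj_add] at heq
    obtain ⟨c, hc⟩ : ∃ c, |co c z| ≤ B := by
      rcases hz with hz | hz
      exacts [⟨_, hz⟩, ⟨_, hz⟩]
    have h1 := (proj_eq_iff N _ _).1 heq c
    rw [co_add, co_diag, co_diag] at h1
    push_cast at h1
    have h7 : co c z + i.val * (h : ℤ) - j.val * h = co c z + (i.val - j.val : ℤ) * h := by ring
    have h8 : |((i.val : ℤ) - j.val) * h| = |(i.val : ℤ) - j.val| * h := by
      rw [abs_mul, Nat.abs_cast]
    rw [h7] at h1
    have h9 : |((i.val : ℤ) - j.val) * h| ≤ 2 * h := by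
      rw [h8]; exact mul_le_mul_of_nonneg_right h6 (by positivity)
    have h10 : (h : ℤ) ≤ |((i.val : ℤ) - j.val) * h| := by
      rw [h8]; exact le_mul_of_one_le_left (by positivity) h5
    have h11 := Int.eq_zero_of_abs_lt_dvd h1 (by
      refine (abs_add_le _ _).trans_lt ?_
      omega)
    have h12 : |co c z| = |((i.val : ℤ) - j.val) * h| := by
      rw [show co c z = -(((i.val : ℤ) - j.val) * h) by linarith, abs_neg]
    omega
  refine ⟨b, start, fun T hT => ⟨?_, ?_, ?_, ?_⟩⟩
  · intro i j hij
    by_contra hne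
    refine hdiff i j hne 0 (by simp) ?_
    rw [proj_zero, zero_add, hij]
  · intro i τ hτ
    exact hbf _ (hT τ hτ).1 i none
  · intro i τ hτ d
    exact hbf _ (hT τ hτ).1 i (some d)
  · intro i j hij τ hτ q hq heq
    obtain ⟨z, ⟨c, hc⟩, h2⟩ := (hT τ hτ).2 q hq
    refine hdiff i j hij z (by cases c <;> simp [hc]) ?_
    rw [h2, add_assoc] at heq
    exact (add_left_cancel heq).symm

/-- The nodes close to one of the axes. -/
noncomputable def cross (B N : ℕ) [NeZero N] : Finset (Node N N) :=
  (Finset.Icc (-(B : ℤ)) B ×ˢ (Finset.univ : Finset (ZMod N))).image (fun x => ((x.1 : ZMod N), x.2))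
  ∪ (Finset.Icc (-(B : ℤ)) B ×ˢ (Finset.univ : Finset (ZMod N))).image
    (fun x => (x.2, (x.1 : ZMod N)))

theorem Near.mem_cross {B N : ℕ} [NeZero N] {z : ℤ × ℤ} (h : Near B z) :
    proj N z ∈ cross B N := by
  obtain ⟨b, hb⟩ := h
  have hb := abs_le.1 hb
  rw [cross, Finset.mem_union]
  cases b with
  | false =>
    exact Or.inl (Finset.mem_image.2 ⟨(z.1, (z.2 : ZMod N)), by
      simp only [Finset.mem_product, Finset.mem_Icc, Finset.mem_univ, and_true]; exact hb, rfl⟩)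
  | true =>
    exact Or.inr (Finset.mem_image.2 ⟨(z.2, (z.1 : ZMod N)), by
      simp only [Finset.mem_product, Finset.mem_Icc, Finset.mem_univ, and_true]; exact hb, rfl⟩)

theorem card_cross_le (B N : ℕ) [NeZero N] : (cross B N).card ≤ 2 * (2 * B + 1) * N := by
  have h : (Finset.Icc (-(B : ℤ)) B ×ˢ (Finset.univ : Finset (ZMod N))).card = (2 * B + 1) * N := by
    rw [Finset.card_product, Int.card_Icc, Finset.card_univ, ZMod.card]
    congr 1
    omega
  refine (Finset.card_union_le _ _).trans ?_
  have h1 := Finset.card_image_le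
    (s := Finset.Icc (-(B : ℤ)) B ×ˢ (Finset.univ : Finset (ZMod N)))
    (f := fun x => (((x.1 : ZMod N), x.2) : Node N N))
  have h2 := Finset.card_image_le
    (s := Finset.Icc (-(B : ℤ)) B ×ˢ (Finset.univ : Finset (ZMod N)))
    (f := fun x => ((x.2, (x.1 : ZMod N)) : Node N N))
  rw [h] at h1 h2
  rw [mul_assoc, two_mul]
  exact add_le_add h1 h2

theorem small_cross (B N : ℕ) [NeZero N]
    (hN : Nat.card (Fin 3 × Option Dir) * (2 * (2 * B + 1)) < N) : Small (cross B N) := by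
  unfold Small
  refine (Nat.mul_le_mul_left _ (card_cross_le B N)).trans_lt ?_
  rw [← mul_assoc]
  exact Nat.mul_lt_mul_of_pos_right hN (NeZero.pos N)

end Apartness

/-! ### Two deaths that do not locate the black hole. -/

section Deaths

variable {S : Type*} {A : Automaton S} {t R : ℕ} {sh : Contact S → Shape}
  {F : Contact S → Option (Contact S)}

/-- The place at which the token is left in a stage. -/
noncomputable def stY (A : Automaton S) (sh : Contact S → Shape)
    (F : Contact S → Option (Contact S)) (i : ℕ) : ℤ × ℤ :=
  (sh (stage A sh F i).1).y + (stage A sh F i).2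

/-- The start of the periodic behaviour in a stage. -/
noncomputable def stT (A : Automaton S) (sh : Contact S → Shape)
    (F : Contact S → Option (Contact S)) (i : ℕ) : ℕ :=
  (sh (stage A sh F i).1).T

theorem Model.stTok_eq (M : Model A t sh R F) {i : ℕ} (hl : (sh (stage A sh F i).1).leg) {τ : ℕ}
    (hτ : stT A sh F i ≤ τ) : stTok A t sh F i τ = some (stY A sh F i) := by
  rw [stTok, (M.spec _).tok hl τ hτ]; rfl

/-- A time before stage `l` belongs to an earlier stage; after its start there is no collision for
`L` time units, since `R + L < N`. -/
theorem Model.classify (M : Model A t sh R F) {N : ℕ} (hN : Fits A t R F N) {l : ℕ}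
    (hl : Reached A sh F l) {L : ℕ} (hL : R + L < N) {τ₀ : ℕ}
    (hτ : τ₀ ≤ stTime A t N sh F l + L) :
    ∃ k τ, (k < l ∨ k = l ∧ τ₀ = stTime A t N sh F l + τ ∧ τ ≤ L) ∧
      (Lite.run A t (0 : Node N N) τ₀).pos = proj N (stPos A t sh F k τ) ∧
      (Lite.run A t (0 : Node N N) τ₀).tok = (stTok A t sh F k τ).map (proj N) := by
  by_cases h : τ₀ < stTime A t N sh F l
  · obtain ⟨i, h1, τ, rfl, h3⟩ := exists_stage_of_lt hl h
    exact ⟨i, τ, Or.inl h1, M.run_stage hN (hl.mono h1.le)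
      fun τ' h' => not_coll_of_lt (h'.trans h3)⟩
  · obtain ⟨τ, rfl⟩ := Nat.exists_eq_add_of_le (not_lt.1 h)
    exact ⟨l, τ, Or.inr ⟨rfl, rfl, by omega⟩, M.run_stage hN hl
      fun τ' h' => M.not_coll hN.lt _ (by omega)⟩

/-- Two agents that start at `0` and at `u` and die on the trips of the stages `i` and `j`. -/
structure Deaths (A : Automaton S) (t : ℕ) (sh : Contact S → Shape)
    (F : Contact S → Option (Contact S)) (i j : ℕ) (u : ℤ × ℤ) (b : Bool → ℤ × ℤ) (B L₁ L₂ : ℕ) :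
    Prop where
  le : i ≤ j
  reached : Reached A sh F j
  leg_i : (sh (stage A sh F i).1).leg
  leg_j : (sh (stage A sh F j).1).leg
  u_ne : u ≠ 0
  b_ne : b false ≠ b true
  b_ne_zero : ∀ e, b e ≠ 0
  b_ne_u : ∀ e, b e ≠ u
  u_le : ∀ c, |co c u| ≤ B
  b_le : ∀ e c, |co c (b e)| ≤ B
  yi_le : ∀ c, |co c (stY A sh F i)| ≤ B
  yj_le : ∀ c, |co c (stY A sh F j)| ≤ B
  die_i : ∀ e, ∃ τ, stT A sh F i ≤ τ ∧ τ ≤ L₁ ∧ stPos A t sh F i τ = b e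
  die_j : ∀ e, ∃ τ, stT A sh F j ≤ τ ∧ τ ≤ L₂ ∧ stPos A t sh F j τ + u = b e
  live_i : ∀ k τ, (k < i ∨ k = i ∧ τ < stT A sh F i) → ∀ e, Sep B (stPos A t sh F k τ) (b e)
  live_j : ∀ k τ, (k < j ∨ k = j ∧ τ < stT A sh F j) → ∀ e, Sep B (stPos A t sh F k τ + u) (b e)
  sep_ij : ∀ k τ q, (k < i ∨ k = i ∧ τ ≤ L₁) → stTok A t sh F k τ = some q →
    Sep B (stPos A t sh F k τ) (q + u)
  sep_ji : ∀ k τ q, (k < i ∨ k = i ∧ τ < stT A sh F i) → stTok A t sh F k τ = some q →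
    Sep B (stPos A t sh F k τ + u) q
  sep_y : ∀ k τ, (k < j ∨ k = j ∧ τ ≤ L₂) → Sep B (stPos A t sh F k τ + u) (stY A sh F i)
  near : ∀ k τ, (k < j ∨ k = j ∧ τ ≤ max L₁ L₂) → Near B (stPos A t sh F k τ)
  near_tok : ∀ k τ q, (k < j ∨ k = j ∧ τ ≤ max L₁ L₂) → stTok A t sh F k τ = some q →
    Near B (stPos A t sh F k τ - q)

/-- The data in `Deaths` live in the plane. They are projected to a torus with `N` much larger than
all of them, where bounded differences remain nonzero. The third agent starts far out on the
diagonal, which keeps it away from everything, as all lone positions in question and their distances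
to the token are close to an axis. -/
theorem false_of_deaths (M : Model A t sh R F) (ht : t ≤ 1) (hs : Solves A 3 t) {i j : ℕ}
    {u : ℤ × ℤ} {b : Bool → ℤ × ℤ} {B L₁ L₂ : ℕ} (H : Deaths A t sh F i j u b B L₁ L₂) :
    False := by
  classical
  obtain ⟨N, hNge, hnext⟩ := M.large (100 * (B + 1) + 2 * R + L₁ + L₂ + 3 +
    Nat.card (Fin 3 × Option Dir) * (2 * (2 * B + 1)))
  have hN : Fits A t R F N := ⟨by omega, hnext⟩
  have hne : NeZero N := ⟨by omega⟩
  have hBN : B < N := by omega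
  -- Subtracting a point with coordinates up to `2 * B` leaves more than `2 * B` in each coordinate,
  -- as `Near.proj_ne` requires.
  set h : ℕ := 5 * B + 1 with hh
  set p : ℕ → Node N N := fun τ => (Lite.run A t (0 : Node N N) τ).pos with hp
  set ti := stTime A t N sh F i with hti
  set tj := stTime A t N sh F j with htj
  set L := max L₁ L₂ with hL
  have hL1 : L₁ ≤ L := le_max_left _ _
  have hL2 : L₂ ≤ L := le_max_right _ _
  have hLN : R + L < N := by omega
  have hri := H.reached.mono H.le
  have htij : ti + L₁ ≤ tj + L := by
    rcases H.le.lt_or_eq with hlt | heq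
    · have : ti + L₁ ≤ tj := M.stTime_add_le hN H.reached hlt (by omega)
      omega
    · rw [hti, htj, heq]; omega
  have hti_tj : ti ≤ tj := stTime_mono A t N sh F H.le
  have hclI := fun τ₀ => M.classify hN hri (L := L₁) (by omega) (τ₀ := τ₀)
  have hclJ := fun τ₀ => M.classify hN H.reached hLN (τ₀ := τ₀)
  have hexA : ∀ e, ∃ τ, p τ = proj N (b e) := fun e => by
    obtain ⟨τ, h1, h2, h3⟩ := H.die_i e
    refine ⟨ti + τ, ?_⟩
    rw [hp, ← h3]
    exact (M.run_stage hN hri fun τ' _ => M.not_coll hN.lt _ (by omega)).1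
  have hexB : ∀ e, ∃ τ, p τ + proj N u = proj N (b e) := fun e => by
    obtain ⟨τ, h1, h2, h3⟩ := H.die_j e
    refine ⟨tj + τ, ?_⟩
    rw [← h3, proj_add, hp]
    simp only
    rw [(M.run_stage hN H.reached fun τ' _ => M.not_coll hN.lt _ (by omega)).1]
  -- Death times are first visits of the black hole. By `live_i` and `live_j` they come after the
  -- token has been left for good, so the final place of the token is the same for both values of
  -- `e`.
  set DA : Bool → ℕ := fun e => Nat.find (hexA e) with hDA
  set DB : Bool → ℕ := fun e => Nat.find (hexB e) with hDB
  have hDAle : ∀ e, DA e ≤ ti + L₁ := fun e => by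
    obtain ⟨τ, h1, h2, h3⟩ := H.die_i e
    refine (Nat.find_min' (hexA e) (m := ti + τ) ?_).trans (by omega)
    rw [← h3]
    exact (M.run_stage hN hri fun τ' _ => M.not_coll hN.lt _ (by omega)).1
  have hDBle : ∀ e, DB e ≤ tj + L₂ := fun e => by
    obtain ⟨τ, h1, h2, h3⟩ := H.die_j e
    refine (Nat.find_min' (hexB e) (m := tj + τ) ?_).trans (by omega)
    rw [← h3, proj_add, hp]
    simp only
    rw [(M.run_stage hN H.reached fun τ' _ => M.not_coll hN.lt _ (by omega)).1]
  have hDAge : ∀ e, ti + stT A sh F i ≤ DA e := fun e => by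
    by_contra hc
    have h1 : p (DA e) = proj N (b e) := Nat.find_spec (hexA e)
    obtain ⟨k, τ, h2, h3, -⟩ := hclI (DA e) (hDAle e)
    rw [hp] at h1
    refine (H.live_i k τ ?_ e).proj_ne hBN (h3.symm.trans h1)
    rcases h2 with h2 | ⟨h2, h4, -⟩
    · exact Or.inl h2
    · exact Or.inr ⟨h2, by omega⟩
  have hDBge : ∀ e, tj + stT A sh F j ≤ DB e := fun e => by
    by_contra hc
    have h1 : p (DB e) + proj N u = proj N (b e) := Nat.find_spec (hexB e)
    obtain ⟨k, τ, h2, h3, -⟩ := hclJ (DB e) ((hDBle e).trans (by omega))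
    rw [hp] at h1
    simp only at h1
    rw [h3, ← proj_add] at h1
    refine (H.live_j k τ ?_ e).proj_ne hBN h1
    rcases h2 with h2 | ⟨h2, h4, -⟩
    · exact Or.inl h2
    · exact Or.inr ⟨h2, by omega⟩
  have htokI : ∀ τ, ti + stT A sh F i ≤ τ → τ ≤ ti + L₁ →
      (Lite.run A t (0 : Node N N) τ).tok = some (proj N (stY A sh F i)) := by
    intro τ h1 h2
    obtain ⟨d, rfl⟩ := Nat.exists_eq_add_of_le (show ti ≤ τ by omega)
    rw [(M.run_stage hN hri fun τ' _ => M.not_coll hN.lt _ (by omega)).2,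
      M.stTok_eq H.leg_i (by omega)]
    rfl
  have htokJ : ∀ τ, tj + stT A sh F j ≤ τ → τ ≤ tj + L →
      (Lite.run A t (0 : Node N N) τ).tok = some (proj N (stY A sh F j)) := by
    intro τ h1 h2
    obtain ⟨d, rfl⟩ := Nat.exists_eq_add_of_le (show tj ≤ τ by omega)
    rw [(M.run_stage hN H.reached fun τ' _ => M.not_coll hN.lt _ (by omega)).2,
      M.stTok_eq H.leg_j (by omega)]
    rfl
  have hz1 : ∀ v, (∀ c, |co c v| ≤ 2 * (B : ℤ)) → ∀ c, 2 * (B : ℤ) < |co c (v - diag h)| ∧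
      |co c (v - diag h)| + B < N := by
    intro v hv c
    have h1 := abs_le.1 (hv c)
    rw [co_sub, co_diag]
    have h2 : co c v - h < 0 := by omega
    rw [abs_of_neg h2]
    omega
  have hz2 : ∀ v, (∀ c, |co c v| ≤ 2 * (B : ℤ)) → ∀ c, 2 * (B : ℤ) < |co c (diag h - v)| ∧
      |co c (diag h - v)| + B < N := by
    intro v hv c
    have h1 := hz1 v hv c
    rwa [co_sub, abs_sub_comm, ← co_sub]
  have hC1 : ∀ τ ≤ tj + L, ∀ v, (∀ c, |co c v| ≤ 2 * (B : ℤ)) →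
      p τ + proj N (diag h) ≠ proj N v := by
    intro τ₀ hτ₀ v hv heq
    obtain ⟨k, τ, h2, h3, -⟩ := hclJ τ₀ hτ₀
    have h4 : proj N (stPos A t sh F k τ) = proj N (v - diag h) := by
      rw [proj_sub, ← heq, ← h3, add_sub_cancel_right]
    refine (H.near k τ ?_).proj_ne (fun c => (hz1 v hv c).1) (fun c => (hz1 v hv c).2) h4
    rcases h2 with h2 | ⟨h2, h4, h5⟩
    · exact Or.inl h2
    · exact Or.inr ⟨h2, h5⟩
  have hC2 : ∀ τ ≤ tj + L, ∀ q, (Lite.run A t (0 : Node N N) τ).tok = some q →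
      ∀ v, (∀ c, |co c v| ≤ 2 * (B : ℤ)) →
      q + proj N v ≠ p τ + proj N (diag h) ∧ q + proj N (diag h) ≠ p τ + proj N v := by
    intro τ₀ hτ₀ q hq v hv
    obtain ⟨k, τ, h2, h3, h4⟩ := hclJ τ₀ hτ₀
    rw [h4] at hq
    obtain ⟨q', h5, rfl⟩ := Option.map_eq_some_iff.1 hq
    have h6 := H.near_tok k τ q' (by
      rcases h2 with h2 | ⟨h2, h4, h5⟩
      · exact Or.inl h2
      · exact Or.inr ⟨h2, h5⟩) h5
    constructor
    · intro heq
      refine h6.proj_ne (fun c => (hz1 v hv c).1) (fun c => (hz1 v hv c).2) ?_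
      rw [proj_sub, proj_sub, ← h3, sub_eq_sub_iff_add_eq_add, add_comm (proj N v), heq]
    · intro heq
      refine h6.proj_ne (fun c => (hz2 v hv c).1) (fun c => (hz2 v hv c).2) ?_
      rw [proj_sub, proj_sub, ← h3, sub_eq_sub_iff_add_eq_add, add_comm (proj N (diag h)), heq]
  have hv0 : ∀ c, |co c (0 : ℤ × ℤ)| ≤ 2 * (B : ℤ) := fun c => by simp
  have hvu : ∀ c, |co c u| ≤ 2 * (B : ℤ) := fun c => (H.u_le c).trans (by omega)
  -- Quietness concerns the lone run only, so it is obtained from another placement, with another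
  -- black hole.
  have hq : Quiet A t N N (tj + L) := by
    obtain ⟨b', start, hap⟩ := exists_apart (A := A) (t := t) (B := B) (N := N) (by omega)
      (cross B N) (small_cross B N (by omega))
    have := (hap (tj + L) fun τ₀ hτ₀ => by
      obtain ⟨k, τ, h2, h3, h4⟩ := hclJ τ₀ hτ₀
      have h2' : k < j ∨ k = j ∧ τ ≤ max L₁ L₂ := by
        rcases h2 with h2 | ⟨h2, h4, h5⟩
        · exact Or.inl h2
        · exact Or.inr ⟨h2, h5⟩
      refine ⟨h3 ▸ (H.near k τ h2').mem_cross, fun q hq => ?_⟩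
      rw [h4] at hq
      obtain ⟨q', h5, rfl⟩ := Option.map_eq_some_iff.1 hq
      refine ⟨_, H.near_tok k τ q' h2' h5, ?_⟩
      rw [← proj_add, h3, add_sub_cancel]).quiet ht (hs N N (by omega) (by omega))
    exact fun τ hτ => this τ (by omega)
  have hinj : Function.Injective ![0, proj N u, proj N (diag h)] := by
    have e1 : (0 : Node N N) ≠ proj N u := by
      rw [← proj_zero]
      exact (Sep.of_ne H.u_ne.symm fun c => by
        rw [co_zero, zero_sub, abs_neg]; exact H.u_le c).proj_ne hBN
    have e0 : p 0 = 0 := rfl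
    have e2 : (0 : Node N N) ≠ proj N (diag h) := by
      have := hC1 0 (Nat.zero_le _) 0 hv0
      rw [e0, zero_add, proj_zero] at this
      exact this.symm
    have e3 : proj N u ≠ proj N (diag h) := by
      have := hC1 0 (Nat.zero_le _) u hvu
      rw [e0, zero_add] at this
      exact this.symm
    intro x y hxy
    fin_cases x <;> fin_cases y <;> simp [e1, e2, e3, e1.symm, e2.symm, e3.symm] at hxy ⊢
  have hminA : ∀ e τ, τ < DA e → p τ ≠ proj N (b e) := fun e τ h => Nat.find_min (hexA e) h
  have hminB : ∀ e τ, τ < DB e → p τ + proj N u ≠ proj N (b e) :=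
    fun e τ h => Nat.find_min (hexB e) h
  have hbne : proj N (b false) ≠ proj N (b true) := by
    intro h'
    refine H.b_ne (co_ext fun c => ?_)
    have h1 := (proj_eq_iff N _ _).1 h' c
    have h2 := abs_le.1 (H.b_le false c)
    have h3 := abs_le.1 (H.b_le true c)
    have := Int.eq_zero_of_abs_lt_dvd h1 (abs_lt.2 ⟨by omega, by omega⟩)
    omega
  have hpos0 : ∀ e, 0 < DA e := fun e => Nat.pos_of_ne_zero fun h0 => by
    have h1 : p (DA e) = proj N (b e) := Nat.find_spec (hexA e)
    rw [h0, show p 0 = proj N 0 from (proj_zero N).symm] at h1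
    exact (Sep.of_ne (H.b_ne_zero e).symm fun c => by
      rw [co_zero, zero_sub, abs_neg]; exact H.b_le e c).proj_ne hBN h1
  have hpos1 : ∀ e, 0 < DB e := fun e => Nat.pos_of_ne_zero fun h0 => by
    have h1 : p (DB e) + proj N u = proj N (b e) := Nat.find_spec (hexB e)
    rw [h0, show p 0 = 0 from rfl, zero_add] at h1
    refine (Sep.of_ne (M := 2 * B) (H.b_ne_u e).symm fun c => ?_).proj_ne (by omega) h1
    have g1 := H.u_le c
    have g2 := H.b_le e c
    exact (abs_sub _ _).trans (by push_cast; omega)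
  refine false_of_two_deaths (n := N) (m := N) (by omega) ht (hs N N (by omega) (by omega))
    ![0, proj N u, proj N (diag h)] hinj (fun e => proj N (b e)) hbne
    -- The third agent outlives the horizon `tj + L`.
    (fun e => ![DA e, DB e, tj + L + 1]) (tj + L) hq ?_ ?_ ?_ ?_ ?_ ?_ ?_
  · intro e x
    fin_cases x
    exacts [hpos0 e, hpos1 e, Nat.succ_pos _]
  · intro e x hx
    fin_cases x
    exacts [(hDAle e).trans htij, (hDBle e).trans (by simp; omega), absurd rfl hx]
  · intro e; rfl
  · intro e x τ hτ hx
    fin_cases x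
    · simp only [Fin.zero_eta, Matrix.cons_val_zero, add_zero] at hx ⊢
      exact hminA e τ hx
    · exact hminB e τ hx
    · exact hC1 τ hτ (b e) fun c => (H.b_le e c).trans (by omega)
  · intro e x hx
    fin_cases x
    · simp only [Fin.zero_eta, Matrix.cons_val_zero, add_zero]
      exact Nat.find_spec (hexA e)
    · exact Nat.find_spec (hexB e)
    · exact absurd rfl hx
  · intro e x y hxy τ hτ hx q hq
    have hmin2 : min τ (tj + L + 1) = τ := min_eq_left (by omega)
    fin_cases x <;> fin_cases y
    · exact absurd rfl hxy
    · simp only [Fin.zero_eta, Matrix.cons_val_zero, add_zero] at hx ⊢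
      have hq : (Lite.run A t (0 : Node N N) (min τ (DB e))).tok = some q := hq
      have h1 : (Lite.run A t (0 : Node N N) τ).tok = some q := by
        by_cases hle : τ ≤ DB e
        · rwa [min_eq_left hle] at hq
        · have g1 := hDAle e
          have g2 := hDBge e
          rcases H.le.lt_or_eq with hlt | heq
          · have : ti + L₁ ≤ tj := M.stTime_add_le hN H.reached hlt (by omega)
            omega
          · rw [min_eq_right (by omega), htokJ _ g2 ((hDBle e).trans (by omega))] at hq
            rw [htokJ τ (by omega) (by omega), hq]
      obtain ⟨k, τ', h2, h3, h4⟩ := hclI τ (hx.le.trans (hDAle e))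
      rw [h4] at h1
      obtain ⟨q', h5, rfl⟩ := Option.map_eq_some_iff.1 h1
      rw [h3]
      have h6 := (H.sep_ij k τ' q' (by
        rcases h2 with h2 | ⟨h2, h4, h5⟩
        · exact Or.inl h2
        · exact Or.inr ⟨h2, h5⟩) h5).proj_ne hBN
      rw [proj_add] at h6
      exact h6.symm
    · simp only [Fin.zero_eta, Matrix.cons_val_zero, add_zero] at hx ⊢
      have hq : (Lite.run A t (0 : Node N N) (min τ (tj + L + 1))).tok = some q := hq
      rw [hmin2] at hq
      have := (hC2 τ hτ.le q hq 0 hv0).2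
      rwa [proj_zero, add_zero] at this
    · have hx : τ < DB e := hx
      have hq : (Lite.run A t (0 : Node N N) (min τ (DA e))).tok = some q := hq
      change q + 0 ≠ p τ + proj N u
      rw [add_zero]
      by_cases hlt : τ < ti + stT A sh F i
      · rw [min_eq_left (by have := hDAge e; omega)] at hq
        obtain ⟨k, τ', h2, h3, h4⟩ := hclI τ (by have := hDAge e; have := hDAle e; omega)
        rw [h4] at hq
        obtain ⟨q', h5, rfl⟩ := Option.map_eq_some_iff.1 hq
        rw [hp]
        simp only
        rw [h3, ← proj_add]
        refine ((H.sep_ji k τ' q' ?_ h5).proj_ne hBN).symm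
        rcases h2 with h2 | ⟨h2, h4, h5⟩
        · exact Or.inl h2
        · exact Or.inr ⟨h2, by omega⟩
      · rw [htokI _ (le_min (by omega) (hDAge e)) ((min_le_right _ _).trans (hDAle e))] at hq
        cases hq
        obtain ⟨k, τ', h2, h3, h4⟩ := M.classify hN H.reached (L := L₂) (by omega)
          (τ₀ := τ) (by have := hDBle e; omega)
        rw [hp]
        simp only
        rw [h3, ← proj_add]
        refine ((H.sep_y k τ' ?_).proj_ne hBN).symm
        rcases h2 with h2 | ⟨h2, h4, h5⟩
        · exact Or.inl h2
        · exact Or.inr ⟨h2, h5⟩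
    · exact absurd rfl hxy
    · have hq : (Lite.run A t (0 : Node N N) (min τ (tj + L + 1))).tok = some q := hq
      rw [hmin2] at hq
      exact (hC2 τ hτ.le q hq u hvu).2
    · have hq : (Lite.run A t (0 : Node N N) (min τ (DA e))).tok = some q := hq
      change q + 0 ≠ p τ + proj N (diag h)
      rw [add_zero]
      by_cases hle : τ ≤ DA e
      · rw [min_eq_left hle] at hq
        have := (hC2 τ hτ.le q hq 0 hv0).1
        rwa [proj_zero, add_zero] at this
      · rw [min_eq_right (by omega), htokI _ (hDAge e) (hDAle e)] at hq
        cases hq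
        exact (hC1 τ hτ.le _ fun c => (H.yi_le c).trans (by omega)).symm
    · have hq : (Lite.run A t (0 : Node N N) (min τ (DB e))).tok = some q := hq
      change q + proj N u ≠ p τ + proj N (diag h)
      by_cases hle : τ ≤ DB e
      · rw [min_eq_left hle] at hq
        exact (hC2 τ hτ.le q hq u hvu).1
      · rw [min_eq_right (by omega), htokJ _ (hDBge e) ((hDBle e).trans (by omega))] at hq
        cases hq
        rw [← proj_add]
        refine (hC1 τ hτ.le _ fun c => ?_).symm
        have g1 := H.yj_le c
        have g2 := H.u_le c
        rw [co_add]
        exact (abs_add_le _ _).trans (by omega)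
    · exact absurd rfl hxy
  · intro x hx
    fin_cases x
    · exact (htokI _ (hDAge _) (hDAle _)).trans (htokI _ (hDAge _) (hDAle _)).symm
    · exact (htokJ _ (hDBge _) ((hDBle _).trans (by omega))).trans
        (htokJ _ (hDBge _) ((hDBle _).trans (by omega))).symm
    · exact absurd rfl hx

end Deaths

end BHS

namespace BHS

/-! ### Two copies on one trip: the case of a new direction. -/

section Confined

variable {S : Type*} {A : Automaton S} {t R : ℕ} {sh : Contact S → Shape}
  {F : Contact S → Option (Contact S)}

/-- The displacement in a period of a stage. -/
noncomputable def stW (A : Automaton S) (sh : Contact S → Shape)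
    (F : Contact S → Option (Contact S)) (i : ℕ) : ℤ × ℤ :=
  (sh (stage A sh F i).1).w

/-- The period of a stage. -/
noncomputable def stP (A : Automaton S) (sh : Contact S → Shape)
    (F : Contact S → Option (Contact S)) (i : ℕ) : ℕ :=
  (sh (stage A sh F i).1).P

theorem Model.stPos_add_mul (M : Model A t sh R F) {i : ℕ} (hl : (sh (stage A sh F i).1).leg)
    (k : ℕ) {τ : ℕ} (hτ : stT A sh F i ≤ τ) :
    stPos A t sh F i (τ + k * stP A sh F i) = stPos A t sh F i τ + k • stW A sh F i := by
  rw [stPos, stP, (M.spec _).pos_add_mul hl k τ hτ, stPos, stW]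
  abel

/-- At a time of a stage, a coordinate of the agent and of its token is bounded. -/
def Confined (A : Automaton S) (t : ℕ) (sh : Contact S → Shape)
    (F : Contact S → Option (Contact S)) (C : ℕ) (c : Bool) (k τ : ℕ) : Prop :=
  |co c (stPos A t sh F k τ)| ≤ C ∧ ∀ q, stTok A t sh F k τ = some q → |co c q| ≤ C

theorem Confined.mono {C C' : ℕ} {c : Bool} {k τ : ℕ} (h : Confined A t sh F C c k τ)
    (hC : C ≤ C') : Confined A t sh F C' c k τ :=
  ⟨h.1.trans (by omega), fun q hq => (h.2 q hq).trans (by omega)⟩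

theorem Model.exists_bound (M : Model A t sh R F) (j : ℕ) : ∃ C : ℕ, ∀ k ≤ j, ∀ c,
    (∀ τ ≤ stT A sh F k + stP A sh F k, Confined A t sh F C c k τ) ∧
    ((sh (stage A sh F k).1).leg → |co c (stY A sh F k)| ≤ C) ∧
    ∀ τ, |co c (stPos A t sh F k τ)| ≤ C + τ := by
  obtain ⟨C, hC⟩ : ∃ C : ℕ, ∀ k ≤ j, ∀ c, |co c (stage A sh F k).2| ≤ C := by
    obtain ⟨C, hC⟩ := (Set.finite_range fun x : Fin (j + 1) × Bool =>
      (co x.2 (stage A sh F x.1).2).natAbs).bddAbove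
    refine ⟨C, fun k hk c => ?_⟩
    have : (co c (stage A sh F k).2).natAbs ≤ C := hC ⟨(⟨k, by omega⟩, c), rfl⟩
    rw [← Int.natCast_natAbs]
    exact_mod_cast this
  refine ⟨C + R, fun k hk c => ⟨fun τ hτ => ⟨?_, fun q hq => ?_⟩, fun hl => ?_, fun τ => ?_⟩⟩
  · have h1 := M.bdd.pos _ τ hτ c
    have h2 := hC k hk c
    rw [stPos, co_add]
    exact (abs_add_le _ _).trans (by push_cast; omega)
  · obtain ⟨q', h, rfl⟩ := Option.map_eq_some_iff.1 hq
    have h1 := M.bdd.tok _ τ hτ q' h c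
    have h2 := hC k hk c
    rw [co_add]
    exact (abs_add_le _ _).trans (by push_cast; omega)
  · have h1 := M.bdd.y M.spec _ hl c
    have h2 := hC k hk c
    rw [stY, co_add]
    exact (abs_add_le _ _).trans (by push_cast; omega)
  · have h1 := abs_co_pos_plane_le A t (stage A sh F k).1 τ c
    have h2 := hC k hk c
    rw [stPos, co_add]
    exact (abs_add_le _ _).trans (by push_cast; omega)

/-- The determinant of two vectors of the plane. -/
def det (w z : ℤ × ℤ) : ℤ := co false w * co true z - co true w * co false z

@[simp] theorem det_add (w z z' : ℤ × ℤ) : det w (z + z') = det w z + det w z' := by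
  simp [det]; ring

@[simp] theorem det_sub (w z z' : ℤ × ℤ) : det w (z - z') = det w z - det w z' := by
  simp [det]; ring

@[simp] theorem det_nsmul_self (w : ℤ × ℤ) (k : ℕ) : det w (k • w) = 0 := by
  simp only [det, co_nsmul]; ring

theorem mul_ge_or_le {s : ℤ} (hs : s ≠ 0) (m : ℕ) :
    (1 ≤ s ∧ (m : ℤ) ≤ m * s) ∨ (s ≤ -1 ∧ m * s ≤ -(m : ℤ)) := by
  rcases lt_or_gt_of_ne hs with h | h
  · right; exact ⟨by omega, by nlinarith⟩
  · left; exact ⟨by omega, by nlinarith⟩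

theorem exists_bound_co (z : ℤ × ℤ) : ∃ U : ℕ, ∀ c, |co c z| ≤ U :=
  ⟨(co false z).natAbs + (co true z).natAbs, fun c => by
    push_cast
    cases c <;> simp⟩

/-- On the first trip in a direction, the agent and the place where it left the token are on a
line parallel to the trip. -/
theorem Model.det_mem (M : Model A t sh R F) (ht : t ≤ 1) (hs : Solves A 3 t) {j : ℕ}
    (hr : Reached A sh F j) (hl : (sh (stage A sh F j).1).leg) {C : ℕ}
    (hC : ∀ k < j, ∀ τ, ∃ c, co c (stW A sh F j) ≠ 0 ∧ Confined A t sh F C c k τ)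
    {τ₁ τ₂ : ℕ} (h₁ : stT A sh F j ≤ τ₁) (h₂ : stT A sh F j ≤ τ₂) :
    ∃ τ ≥ stT A sh F j, det (stW A sh F j) (stPos A t sh F j τ - stY A sh F j) =
      det (stW A sh F j) (stPos A t sh F j τ₁ - stPos A t sh F j τ₂) := by
  -- Two copies are put on the same trip, in phases `τ₁` and `τ₂`, with the black hole ahead of
  -- both. They die unnoticed unless the first copy meets the token of the second one, and such a
  -- meeting yields the `τ` required.
  by_contra hne
  push Not at hne
  obtain ⟨C₀, hC₀⟩ := M.exists_bound j
  set w := stW A sh F j with hw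
  set p₁ := stPos A t sh F j τ₁ with hp₁
  set p₂ := stPos A t sh F j τ₂ with hp₂
  set D : ℕ := C + C₀ + τ₁ + τ₂ with hD
  -- In a coordinate where `w` does not vanish, `m` periods exceed every bounded quantity that
  -- occurs.
  set m : ℕ := 8 * D + 8 with hm
  have hw0 : w ≠ 0 := (M.spec _).ne_zero hl
  obtain ⟨c₀, hc₀⟩ := exists_co_ne_zero hw0
  obtain ⟨W, hW⟩ := exists_bound_co w
  -- The copy that starts at `u` is at `p₁ + (m + n) • w` when it is `n` periods past phase `τ₂`. So
  -- it reaches `b e` after `m + e` periods, the copy that starts at `0` after `2 * m + e` periods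
  -- past phase `τ₁`.
  set u := p₁ - p₂ + m • w with hu
  set b : Bool → ℤ × ℤ := fun e => p₁ + (2 * m + e.toNat) • w with hb
  set P := stP A sh F j with hP
  set L₁ := τ₁ + (2 * m + 1) * P with hL₁
  set L₂ := τ₂ + (m + 1) * P with hL₂
  set U := D + (2 * m + 1) * W with hU
  have hp₁' : ∀ c, |co c p₁| ≤ D := fun c => ((hC₀ j le_rfl c).2.2 τ₁).trans (by omega)
  have hp₂' : ∀ c, |co c p₂| ≤ D := fun c => ((hC₀ j le_rfl c).2.2 τ₂).trans (by omega)
  have hY : ∀ c, |co c (stY A sh F j)| ≤ D := fun c =>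
    ((hC₀ j le_rfl c).2.1 hl).trans (by omega)
  have hconf : ∀ k τ, (k < j ∨ k = j ∧ τ < stT A sh F j) →
      ∃ c, co c w ≠ 0 ∧ Confined A t sh F D c k τ := by
    rintro k τ (hk | ⟨rfl, hk⟩)
    · obtain ⟨c, h1, h2⟩ := hC k hk τ
      exact ⟨c, h1, h2.mono (by omega)⟩
    · exact ⟨c₀, hc₀, ((hC₀ k le_rfl c₀).1 τ (by omega)).mono (by omega)⟩
  have hmul : ∀ (n : ℕ) c, |n * co c w| ≤ n * W := fun n c => by
    rw [abs_mul, Nat.abs_cast]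
    exact mul_le_mul_of_nonneg_left (hW c) (by positivity)
  have hule : ∀ c, |co c u| ≤ 2 * U := fun c => by
    have g1 := abs_le.1 (hp₁' c)
    have g2 := abs_le.1 (hp₂' c)
    have g3 := abs_le.1 (hmul m c)
    rw [hu, co_add, co_sub, co_nsmul]
    refine abs_le.2 ?_
    push_cast [hU] at *
    constructor <;> nlinarith
  have hble : ∀ e c, |co c (b e)| ≤ U := fun e c => by
    have g1 := abs_le.1 (hp₁' c)
    have g3 := abs_le.1 (hmul (2 * m + e.toNat) c)
    rw [hb]
    simp only
    rw [co_add, co_nsmul]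
    have g4 : e.toNat ≤ 1 := Bool.toNat_le e
    have g5 : (2 * m + e.toNat) * W ≤ (2 * m + 1) * W := Nat.mul_le_mul_right _ (by omega)
    have g6 : (((2 * m + e.toNat : ℕ) : ℤ)) * W ≤ (((2 * m + 1) * W : ℕ) : ℤ) := by
      exact_mod_cast g5
    refine abs_le.2 ?_
    omega
  have hcu : ∀ c, co c u = co c p₁ - co c p₂ + m * co c w := fun c => by
    rw [hu, co_add, co_sub, co_nsmul]
  have hcb : ∀ e c, co c (b e) = co c p₁ + 2 * (m * co c w) + e.toNat * co c w := fun e c => by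
    rw [hb]
    simp only
    rw [co_add, co_nsmul]
    push_cast
    ring
  have hsep : ∀ e c, co c w ≠ 0 → ∀ x y : ℤ, |x| ≤ D → |y| ≤ D →
      x ≠ co c (b e) ∧ x + co c u ≠ co c (b e) ∧ x ≠ y + co c u ∧ co c u ≠ co c (b e) := by
    intro e c hc x y hx hy
    have g1 := abs_le.1 (hp₁' c)
    have g2 := abs_le.1 (hp₂' c)
    have hx := abs_le.1 hx
    have hy := abs_le.1 hy
    rw [hcu, hcb]
    have he : ((e.toNat : ℕ) : ℤ) * co c w = 0 ∨ (e.toNat : ℤ) * co c w = co c w := by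
      cases e <;> simp
    generalize (e.toNat : ℤ) * co c w = s at he
    have h3 := mul_ge_or_le hc m
    generalize (m : ℤ) * co c w = X at h3
    omega
  refine false_of_deaths (i := j) (j := j) (u := u) (b := b)
    (B := 4 * (D + U + L₁ + L₂)) (L₁ := L₁) (L₂ := L₂) M ht hs
    ⟨le_rfl, hr, hl, hl, ?_, ?_, ?_, ?_, ?_, ?_, ?_, ?_, ?_, ?_, ?_, ?_, ?_, ?_, ?_, ?_, ?_⟩
  · intro h
    have := (hsep false c₀ hc₀ 0 0 (by simp) (by simp)).2.2.1
    rw [h, co_zero] at this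
    exact this rfl
  · intro h
    have h1 := hcb false c₀
    rw [h, hcb true c₀] at h1
    simp at h1
    exact hc₀ h1
  · intro e h
    have := (hsep e c₀ hc₀ 0 0 (by simp) (by simp)).1
    rw [h, co_zero] at this
    exact this rfl
  · intro e h
    have := (hsep e c₀ hc₀ 0 0 (by simp) (by simp)).2.2.2
    rw [h] at this
    exact this rfl
  · exact fun c => (hule c).trans (by push_cast; omega)
  · exact fun e c => (hble e c).trans (by push_cast; omega)
  · exact fun c => (hY c).trans (by push_cast; omega)
  · exact fun c => (hY c).trans (by push_cast; omega)
  · intro e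
    refine ⟨τ₁ + (2 * m + e.toNat) * P, by omega, ?_, M.stPos_add_mul hl _ h₁⟩
    have := Nat.mul_le_mul_right P (show 2 * m + e.toNat ≤ 2 * m + 1 by
      have := Bool.toNat_le e; omega)
    omega
  · intro e
    refine ⟨τ₂ + (m + e.toNat) * P, by omega, ?_, ?_⟩
    · have := Nat.mul_le_mul_right P (show m + e.toNat ≤ m + 1 by
        have := Bool.toNat_le e; omega)
      omega
    · rw [M.stPos_add_mul hl _ h₂]
      refine co_ext fun c => ?_
      rw [hcb, co_add, hcu, co_add, co_nsmul]
      push_cast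
      ring
  · intro k τ hk e
    obtain ⟨c, hc, h1, -⟩ := hconf k τ hk
    refine ⟨c, (hsep e c hc _ _ h1 h1).1, (abs_sub _ _).trans ?_⟩
    have := hble e c
    push_cast
    omega
  · intro k τ hk e
    obtain ⟨c, hc, h1, -⟩ := hconf k τ hk
    refine ⟨c, by rw [co_add]; exact (hsep e c hc _ _ h1 h1).2.1, (abs_sub _ _).trans ?_⟩
    have := hble e c
    have := hule c
    have := abs_add_le (co c (stPos A t sh F k τ)) (co c u)
    rw [co_add]
    push_cast
    omega
  · intro k τ q hk hq
    by_cases hk' : k < j ∨ k = j ∧ τ < stT A sh F j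
    · obtain ⟨c, hc, h1, h2⟩ := hconf k τ hk'
      have h2 := h2 q hq
      refine ⟨c, by rw [co_add]; exact (hsep false c hc _ _ h1 h2).2.2.1, (abs_sub _ _).trans ?_⟩
      have := hule c
      have := abs_add_le (co c q) (co c u)
      rw [co_add]
      push_cast
      omega
    · obtain ⟨rfl, hτ⟩ : k = j ∧ stT A sh F j ≤ τ := by omega
      rw [M.stTok_eq hl hτ] at hq
      cases hq
      refine Sep.of_ne (fun h => ?_) fun c => (abs_sub _ _).trans ?_
      -- The only possible encounter: the first copy at the token `Y + u` of the second. Since `det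
      -- w` kills multiples of `w`, this is the equation excluded by `hne`.
      · refine hne τ hτ ?_
        rw [h, add_sub_cancel_left, hu, det_add, det_nsmul_self, add_zero]
      · have := hule c
        have := abs_add_le (co c (stY A sh F k)) (co c u)
        have := (hC₀ k le_rfl c).2.2 τ
        have := hY c
        rw [co_add]
        push_cast
        omega
  · intro k τ q hk hq
    obtain ⟨c, hc, h1, h2⟩ := hconf k τ hk
    have h2 := h2 q hq
    refine ⟨c, by rw [co_add]; exact (hsep false c hc _ _ h2 h1).2.2.1.symm,
      (abs_sub _ _).trans ?_⟩
    have := hule c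
    have := abs_add_le (co c (stPos A t sh F k τ)) (co c u)
    rw [co_add]
    push_cast
    omega
  · intro k τ hk
    by_cases hk' : k < j ∨ k = j ∧ τ < stT A sh F j
    · obtain ⟨c, hc, h1, -⟩ := hconf k τ hk'
      have h2 := hY c
      refine ⟨c, by rw [co_add]; exact (hsep false c hc _ _ h2 h1).2.2.1.symm,
        (abs_sub _ _).trans ?_⟩
      have := hule c
      have := abs_add_le (co c (stPos A t sh F k τ)) (co c u)
      rw [co_add]
      push_cast
      omega
    · obtain ⟨rfl, hτ, hτ'⟩ : k = j ∧ stT A sh F j ≤ τ ∧ τ ≤ L₂ := by omega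
      have h0 := (hC₀ k le_rfl c₀).2.2 τ
      -- The shift `u` is `m` periods ahead and the trip adds `n ≥ 0` more of the same sign, so the
      -- second copy does not return to the token of the first.
      obtain ⟨τ', n, g1, g2, rfl⟩ := (M.spec (stage A sh F k).1).exists_reduce τ hτ
      refine ⟨c₀, ?_, (abs_sub _ _).trans ?_⟩
      · have g3 := abs_le.1 ((hC₀ k le_rfl c₀).1 τ' (by rw [stT, stP]; omega)).1
        have g4 := M.stPos_add_mul hl n (τ := τ') g1
        rw [stP] at g4
        rw [g4, co_add, co_add, co_nsmul, hcu]
        have g5 := mul_ge_or_le hc₀ m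
        have g6 := mul_ge_or_le hc₀ n
        rw [← hw]
        generalize (m : ℤ) * co c₀ w = X at g5
        generalize (n : ℤ) * co c₀ w = Z at g6
        have g7 := abs_le.1 (hp₁' c₀)
        have g8 := abs_le.1 (hp₂' c₀)
        have g9 := abs_le.1 (hY c₀)
        omega
      · have := hule c₀
        have := abs_add_le (co c₀ (stPos A t sh F k (τ' + n * (sh (stage A sh F k).1).P))) (co c₀ u)
        have := hY c₀
        rw [co_add]
        push_cast at *
        omega
  · intro k τ hk
    by_cases hk' : k < j
    · obtain ⟨c, hc, h1, -⟩ := hconf k τ (Or.inl hk')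
      exact ⟨c, h1.trans (by push_cast; omega)⟩
    · obtain ⟨rfl, hτ⟩ : k = j ∧ τ ≤ max L₁ L₂ := by omega
      refine ⟨c₀, ((hC₀ k le_rfl c₀).2.2 τ).trans (by push_cast; omega)⟩
  · intro k τ q hk hq
    by_cases hk' : k < j ∨ k = j ∧ τ < stT A sh F j
    · obtain ⟨c, hc, h1, h2⟩ := hconf k τ hk'
      have h2 := h2 q hq
      refine ⟨c, ?_⟩
      rw [co_sub]
      exact (abs_sub _ _).trans (by push_cast; omega)
    · obtain ⟨rfl, hτ, hτ'⟩ : k = j ∧ stT A sh F j ≤ τ ∧ τ ≤ max L₁ L₂ := by omega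
      rw [M.stTok_eq hl hτ] at hq
      cases hq
      refine ⟨c₀, ?_⟩
      have := (hC₀ k le_rfl c₀).2.2 τ
      have := hY c₀
      rw [co_sub]
      exact (abs_sub _ _).trans (by push_cast; omega)

end Confined

end BHS

namespace BHS

/-! ### Copies on two parallel trips. -/

section Confined

variable {S : Type*} {A : Automaton S} {t R : ℕ} {sh : Contact S → Shape}
  {F : Contact S → Option (Contact S)}

/-- Numbers of periods after which trips with displacements `g` and `g'` along an axis, with one
fixed offset, meet at two different places. They come from the common multiple `|g| * |g'|`; for
opposite signs one number increases while the other decreases, hence `f`. The last bound lets the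
first trip dominate all that the second one does until it is over. -/
theorem exists_two_pairs {g g' : ℤ} (hg : g ≠ 0) (hg' : g' ≠ 0) (K : ℕ) :
    ∃ m₁ m₂ : Bool → ℕ, (∀ e, m₁ e * g - m₂ e * g' = m₁ false * g - m₂ false * g') ∧
      m₁ false ≠ m₁ true ∧ ∀ e, K ≤ |m₂ e * g'| ∧ K ≤ |m₁ e * g| ∧
        (m₂ false + m₂ true + K) * |g'| + K ≤ |m₁ e * g| := by
  obtain ⟨f, hf, hf1⟩ : ∃ f : Bool → ℕ,
      (∀ e : Bool, (e.toNat : ℤ) * (|g'| * g) = (f e - f false) * (|g| * g')) ∧ ∀ e, f e ≤ 1 := by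
    rcases lt_or_gt_of_ne hg with h | h <;> rcases lt_or_gt_of_ne hg' with h' | h'
    · refine ⟨fun e => e.toNat, fun e => ?_, Bool.toNat_le⟩
      cases e <;> simp [abs_of_neg h, abs_of_neg h']; ring
    · refine ⟨fun e => 1 - e.toNat, fun e => ?_, fun e => Nat.sub_le _ _⟩
      cases e <;> simp [abs_of_neg h, abs_of_pos h']; ring
    · refine ⟨fun e => 1 - e.toNat, fun e => ?_, fun e => Nat.sub_le _ _⟩
      cases e <;> simp [abs_of_pos h, abs_of_neg h']; ring
    · refine ⟨fun e => e.toNat, fun e => ?_, Bool.toNat_le⟩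
      cases e <;> simp [abs_of_pos h, abs_of_pos h']; ring
  have h1 : (1 : ℤ) ≤ |g| := Int.one_le_abs hg
  have h1' : (1 : ℤ) ≤ |g'| := Int.one_le_abs hg'
  have hp : (1 : ℤ) ≤ |g| * |g'| := by nlinarith
  refine ⟨fun e => g'.natAbs * (4 * K + 2 + e.toNat), fun e => g.natAbs * (K + f e),
    fun e => ?_, ?_, fun e => ?_⟩
  · push_cast
    have := hf e
    simp only [Bool.toNat_false]
    push_cast
    linear_combination this
  · simp only [Bool.toNat_false, Bool.toNat_true]
    intro h
    have := Nat.eq_of_mul_eq_mul_left (Int.natAbs_pos.2 hg') h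
    omega
  · have h2 := hf1 false
    have h3 := hf1 true
    push_cast
    simp only [abs_mul, abs_abs]
    have a1 : |(K : ℤ) + f e| = K + f e := abs_of_nonneg (by positivity)
    have a2 : |(4 : ℤ) * K + 2 + (e.toNat : ℤ)| = 4 * K + 2 + e.toNat :=
      abs_of_nonneg (by positivity)
    have a3 : (0 : ℤ) ≤ K := by positivity
    have a4 : (0 : ℤ) ≤ f e := by positivity
    have a5 : (0 : ℤ) ≤ (e.toNat : ℤ) := by positivity
    have a6 : (f false : ℤ) ≤ 1 := by exact_mod_cast h2
    have a7 : (f true : ℤ) ≤ 1 := by exact_mod_cast h3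
    rw [a1, a2]
    have b1 : |g| * (K + f e) * |g'| = |g| * |g'| * (K + f e) := by ring
    have b2 : |g'| * (4 * K + 2 + e.toNat) * |g| = |g| * |g'| * (4 * K + 2 + e.toNat) := by ring
    have b3 : (|g| * (K + f false) + |g| * (K + f true) + K) * |g'| + K =
      |g| * |g'| * (2 * K + f false + f true) + K * |g'| + K := by ring
    rw [b1, b2, b3]
    have c1 : K * |g'| ≤ |g| * |g'| * K := by nlinarith [mul_nonneg a3 (abs_nonneg g')]
    have c2 : K ≤ |g| * |g'| * K := by nlinarith
    refine ⟨by nlinarith, by nlinarith, by nlinarith⟩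

/-- If two trips are parallel to an axis, and the first one is in the line of its token, then the
other one is in the same line. -/
theorem Model.co_eq (M : Model A t sh R F) (ht : t ≤ 1) (hs : Solves A 3 t) {i j : ℕ}
    (hij : i < j) (hr : Reached A sh F j) (hl : (sh (stage A sh F j).1).leg) {b : Bool}
    (hi : co b (stW A sh F i) = 0) (hj : co b (stW A sh F j) = 0)
    (hrow : ∀ τ ≥ stT A sh F i, co b (stPos A t sh F i τ) = co b (stY A sh F i)) {C : ℕ}
    (hCi : ∀ k < i, ∀ τ, Confined A t sh F C (!b) k τ)
    (hCj : ∀ k < j, ∀ τ, Confined A t sh F C (!b) k τ ∨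
      Confined A t sh F C b k τ ∧ co b (stPos A t sh F k τ) = co b (stY A sh F i))
    {τ₂ : ℕ} (h₂ : stT A sh F j ≤ τ₂) :
    co b (stPos A t sh F j τ₂) = co b (stY A sh F i) := by
  -- One copy dies on trip `i`, the other on trip `j`. The shift `u` brings trip `j` to the row of
  -- trip `i`, so if the rows differ originally, the second copy's token and its earlier trips
  -- parallel to this row end up off the row of the black hole.
  by_contra hne
  obtain ⟨C₀, hC₀⟩ := M.exists_bound j
  have hri := hr.mono hij.le
  have hli := M.isLeg_of_reached (hr i hij)
  have hwne : ∀ k, (sh (stage A sh F k).1).leg → co b (stW A sh F k) = 0 →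
      co (!b) (stW A sh F k) ≠ 0 := by
    intro k hk h0 h1
    refine (M.spec _).ne_zero hk (co_ext fun c => ?_)
    rw [co_zero]
    cases b <;> cases c <;> assumption
  have hg := hwne i hli hi
  have hg' := hwne j hl hj
  set g := co (!b) (stW A sh F i) with hgdef
  set g' := co (!b) (stW A sh F j) with hgdef'
  set τ₁ := stT A sh F i with hτ₁
  set p₁ := stPos A t sh F i τ₁ with hp₁
  set p₂ := stPos A t sh F j τ₂ with hp₂
  set D : ℕ := C + C₀ + τ₁ + τ₂ with hD
  obtain ⟨m₁, m₂, hm, hmne, hbig⟩ := exists_two_pairs hg hg' (8 * D + 8)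
  set u := p₁ - p₂ + m₁ false • stW A sh F i - m₂ false • stW A sh F j with hu
  set β : Bool → ℤ × ℤ := fun e => p₁ + m₁ e • stW A sh F i with hβ
  set L₁ := τ₁ + (m₁ false + m₁ true) * stP A sh F i with hL₁
  set L₂ := τ₂ + (m₂ false + m₂ true) * stP A sh F j with hL₂
  obtain ⟨U, hule, hble⟩ : ∃ U : ℕ, (∀ c, |co c u| ≤ U) ∧ ∀ e c, |co c (β e)| ≤ U := by
    obtain ⟨U₀, h0⟩ := exists_bound_co u
    obtain ⟨U₁, h1⟩ := exists_bound_co (β false)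
    obtain ⟨U₂, h2⟩ := exists_bound_co (β true)
    refine ⟨U₀ + U₁ + U₂, fun c => (h0 c).trans (by omega), fun e c => ?_⟩
    cases e
    · exact (h1 c).trans (by omega)
    · exact (h2 c).trans (by omega)
  have hp₁' : ∀ c, |co c p₁| ≤ D := fun c => ((hC₀ i hij.le c).2.2 τ₁).trans (by omega)
  have hp₂' : ∀ c, |co c p₂| ≤ D := fun c => ((hC₀ j le_rfl c).2.2 τ₂).trans (by omega)
  have hYi : ∀ c, |co c (stY A sh F i)| ≤ D := fun c =>
    ((hC₀ i hij.le c).2.1 hli).trans (by omega)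
  have hYj : ∀ c, |co c (stY A sh F j)| ≤ D := fun c =>
    ((hC₀ j le_rfl c).2.1 hl).trans (by omega)
  have hp₁b : co b p₁ = co b (stY A sh F i) := hrow τ₁ le_rfl
  have hub : co b u = co b p₁ - co b p₂ := by
    rw [hu, co_sub, co_add, co_sub, co_nsmul, co_nsmul, hi, hj]; ring
  have hβb : ∀ e, co b (β e) = co b p₁ := fun e => by
    rw [hβ]; simp only; rw [co_add, co_nsmul, hi]; ring
  have hun : co (!b) u = co (!b) p₁ - co (!b) p₂ + m₁ false * g - m₂ false * g' := by
    rw [hu, co_sub, co_add, co_sub, co_nsmul, co_nsmul]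
  have hβn : ∀ e, co (!b) (β e) = co (!b) p₁ + m₁ e * g := fun e => by
    rw [hβ]; simp only; rw [co_add, co_nsmul]
  have hsep : ∀ e, ∀ x y : ℤ, |x| ≤ D → |y| ≤ D →
      x ≠ co (!b) (β e) ∧ x + co (!b) u ≠ co (!b) (β e) ∧ x ≠ y + co (!b) u ∧
        co (!b) u ≠ co (!b) (β e) := by
    intro e x y hx hy
    have g1 := abs_le.1 (hp₁' (!b))
    have g2 := abs_le.1 (hp₂' (!b))
    have hx := abs_le.1 hx
    have hy := abs_le.1 hy
    rw [hun, hβn]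
    have h1 := hm e
    obtain ⟨h2, h3, -⟩ := hbig e
    obtain ⟨-, -, h5⟩ := hbig false
    have h6 : |(m₂ false : ℤ) * g'| ≤ ((m₂ false : ℤ) + m₂ true + (8 * D + 8 : ℕ)) * |g'| := by
      rw [abs_mul, Nat.abs_cast]
      exact mul_le_mul_of_nonneg_right (by omega) (abs_nonneg _)
    have h7 := h6.trans (by linarith : _ ≤ |(m₁ false : ℤ) * g| - ((8 * D + 8 : ℕ) : ℤ))
    clear h5 h6
    generalize (m₁ e : ℤ) * g = X₁ at *
    generalize (m₂ e : ℤ) * g' = X₂ at *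
    generalize (m₁ false : ℤ) * g = Z₁ at *
    generalize (m₂ false : ℤ) * g' = Z₂ at *
    push_cast at *
    refine ⟨?_, ?_, ?_, ?_⟩
    · rcases abs_cases X₁ with h | h <;> omega
    · rcases abs_cases X₂ with h | h <;> omega
    · rcases abs_cases Z₁ with h | h <;> rcases abs_cases Z₂ with h' | h' <;> omega
    · rcases abs_cases X₂ with h | h <;> omega
  have hconfi : ∀ k τ, (k < i ∨ k = i ∧ τ < stT A sh F i) → Confined A t sh F D (!b) k τ := by
    rintro k τ (hk | ⟨rfl, hk⟩)
    · exact (hCi k hk τ).mono (by omega)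
    · exact ((hC₀ k hij.le (!b)).1 τ (by omega)).mono (by omega)
  have hconfj : ∀ k τ, (k < j ∨ k = j ∧ τ < stT A sh F j) → Confined A t sh F D (!b) k τ ∨
      Confined A t sh F D b k τ ∧ co b (stPos A t sh F k τ) = co b (stY A sh F i) := by
    rintro k τ (hk | ⟨rfl, hk⟩)
    · exact (hCj k hk τ).imp (fun h => h.mono (by omega)) fun h => ⟨h.1.mono (by omega), h.2⟩
    · exact Or.inl (((hC₀ k le_rfl (!b)).1 τ (by omega)).mono (by omega))
  refine false_of_deaths (i := i) (j := j) (u := u) (b := β)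
    (B := 4 * (D + U + L₁ + L₂)) (L₁ := L₁) (L₂ := L₂) M ht hs
    ⟨hij.le, hr, hli, hl, ?_, ?_, ?_, ?_, ?_, ?_, ?_, ?_, ?_, ?_, ?_, ?_, ?_, ?_, ?_, ?_, ?_⟩
  · intro h
    have := (hsep false 0 0 (by simp) (by simp)).2.2.1
    rw [h, co_zero] at this
    exact this rfl
  · intro h
    have h1 := hβn false
    rw [h, hβn true] at h1
    have h2 := mul_right_cancel₀ hg (add_left_cancel h1)
    exact hmne (by exact_mod_cast h2.symm)
  · intro e h
    have := (hsep e 0 0 (by simp) (by simp)).1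
    rw [h, co_zero] at this
    exact this rfl
  · intro e h
    have := (hsep e 0 0 (by simp) (by simp)).2.2.2
    rw [h] at this
    exact this rfl
  · exact fun c => (hule c).trans (by push_cast; omega)
  · exact fun e c => (hble e c).trans (by push_cast; omega)
  · exact fun c => (hYi c).trans (by push_cast; omega)
  · exact fun c => (hYj c).trans (by push_cast; omega)
  · intro e
    refine ⟨τ₁ + m₁ e * stP A sh F i, by omega, ?_, M.stPos_add_mul hli _ le_rfl⟩
    have := Nat.mul_le_mul_right (stP A sh F i) (show m₁ e ≤ m₁ false + m₁ true by
      cases e <;> omega)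
    omega
  · intro e
    refine ⟨τ₂ + m₂ e * stP A sh F j, by omega, ?_, ?_⟩
    · have := Nat.mul_le_mul_right (stP A sh F j) (show m₂ e ≤ m₂ false + m₂ true by
        cases e <;> omega)
      omega
    · rw [M.stPos_add_mul hl _ h₂]
      have e1 : co b (p₂ + m₂ e • stW A sh F j + u) = co b (β e) := by
        rw [hβb, co_add, hub, co_add, co_nsmul, hj]; ring
      have e2 : co (!b) (p₂ + m₂ e • stW A sh F j + u) = co (!b) (β e) := by
        rw [hβn, co_add, hun, co_add, co_nsmul]
        linear_combination -hm e
      refine co_ext fun c => ?_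
      cases b <;> cases c <;> assumption
  · intro k τ hk e
    have h1 := (hconfi k τ hk).1
    refine ⟨!b, (hsep e _ _ h1 h1).1, (abs_sub _ _).trans ?_⟩
    have := hble e (!b)
    push_cast
    omega
  · intro k τ hk e
    have hcase : ∃ c, |co c (stPos A t sh F k τ)| ≤ D ∧
        co c (stPos A t sh F k τ + u) ≠ co c (β e) := by
      rcases hconfj k τ hk with h | ⟨h, h'⟩
      · exact ⟨_, h.1, by rw [co_add]; exact (hsep e _ _ h.1 h.1).2.1⟩
      -- An earlier trip in the row of `stY A sh F i` is moved off this row by `u`, while the black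
      -- hole stays in it.
      · refine ⟨_, h.1, ?_⟩
        rw [co_add, h', hub, hβb]
        omega
    obtain ⟨c, h1, h2⟩ := hcase
    refine ⟨c, h2, (abs_sub _ _).trans ?_⟩
    have := hble e c
    have := hule c
    have := abs_add_le (co c (stPos A t sh F k τ)) (co c u)
    rw [co_add]
    push_cast
    omega
  · intro k τ q hk hq
    by_cases hk' : k < i ∨ k = i ∧ τ < stT A sh F i
    · obtain ⟨h1, h2⟩ := hconfi k τ hk'
      have h2 := h2 q hq
      refine ⟨!b, by rw [co_add]; exact (hsep false _ _ h1 h2).2.2.1, (abs_sub _ _).trans ?_⟩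
      have := hule (!b)
      have := abs_add_le (co (!b) q) (co (!b) u)
      rw [co_add]
      push_cast
      omega
    · obtain ⟨rfl, hτ⟩ : k = i ∧ stT A sh F i ≤ τ := by omega
      rw [M.stTok_eq hli hτ] at hq
      cases hq
      -- The first copy remains in the row of its own token, and the second copy's token is
      -- displaced from this row by `u`.
      have := hrow τ hτ
      refine ⟨b, ?_, (abs_sub _ _).trans ?_⟩
      · rw [this, co_add, hub]
        omega
      · rw [this]
        have := hule b
        have := abs_add_le (co b (stY A sh F k)) (co b u)
        have := hYi b
        rw [co_add]
        push_cast
        omega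
  · intro k τ q hk hq
    obtain ⟨h1, h2⟩ := hconfi k τ hk
    have h2 := h2 q hq
    refine ⟨!b, by rw [co_add]; exact (hsep false _ _ h2 h1).2.2.1.symm,
      (abs_sub _ _).trans ?_⟩
    have := hule (!b)
    have := abs_add_le (co (!b) (stPos A t sh F k τ)) (co (!b) u)
    rw [co_add]
    push_cast
    omega
  · intro k τ hk
    by_cases hk' : k < j ∨ k = j ∧ τ < stT A sh F j
    · have hcase : ∃ c, |co c (stPos A t sh F k τ)| ≤ D ∧
          co c (stPos A t sh F k τ + u) ≠ co c (stY A sh F i) := by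
        rcases hconfj k τ hk' with h | ⟨h, h'⟩
        · exact ⟨_, h.1, by rw [co_add]; exact (hsep false _ _ (hYi _) h.1).2.2.1.symm⟩
        · refine ⟨_, h.1, ?_⟩
          rw [co_add, h', hub]
          omega
      obtain ⟨c, h1, h2⟩ := hcase
      refine ⟨c, h2, (abs_sub _ _).trans ?_⟩
      have := hule c
      have := hYi c
      have := abs_add_le (co c (stPos A t sh F k τ)) (co c u)
      rw [co_add]
      push_cast
      omega
    · obtain ⟨rfl, hτ, hτ'⟩ : k = j ∧ stT A sh F j ≤ τ ∧ τ ≤ L₂ := by omega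
      have h0 := (hC₀ k le_rfl (!b)).2.2 τ
      refine ⟨!b, ?_, (abs_sub _ _).trans ?_⟩
      · obtain ⟨τ', n, g1, g2, rfl⟩ := (M.spec (stage A sh F k).1).exists_reduce τ hτ
        have g3 := abs_le.1 ((hC₀ k le_rfl (!b)).1 τ' (by rw [stT, stP]; omega)).1
        have g4 := M.stPos_add_mul hl n (τ := τ') g1
        have hP : 0 < stP A sh F k := (M.spec _).pos
        -- So many periods fit into the horizon `L₂`. Up to then the displacement along trip `j` is
        -- dominated by `m₁ false * g`, by the last bound of `exists_two_pairs`.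
        have hn : n ≤ τ₂ + m₂ false + m₂ true := by
          by_contra hc
          have h1 := Nat.mul_le_mul_right (stP A sh F k)
            (show τ₂ + (m₂ false + m₂ true) + 1 ≤ n by omega)
          have h2 : τ₂ ≤ τ₂ * stP A sh F k := Nat.le_mul_of_pos_right _ hP
          rw [add_mul, add_mul] at h1
          change τ' + n * stP A sh F k ≤ _ at hτ'
          omega
        change co (!b) (stPos A t sh F k (τ' + n * stP A sh F k) + u) ≠ _
        rw [g4, co_add, co_add, co_nsmul, hun, ← hgdef']
        obtain ⟨-, -, h5⟩ := hbig false
        have h6 : |(n : ℤ) * g' - m₂ false * g'| ≤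
            ((m₂ false : ℤ) + m₂ true + (8 * D + 8 : ℕ)) * |g'| := by
          rw [← sub_mul, abs_mul]
          refine mul_le_mul_of_nonneg_right (abs_le.2 ?_) (abs_nonneg _)
          push_cast
          omega
        have h7 := h6.trans (by linarith : _ ≤ |(m₁ false : ℤ) * g| - ((8 * D + 8 : ℕ) : ℤ))
        have g7 := abs_le.1 (hp₁' (!b))
        have g8 := abs_le.1 (hp₂' (!b))
        have g9 := abs_le.1 (hYi (!b))
        clear h5 h6
        generalize (m₁ false : ℤ) * g = Z₁ at *
        generalize (m₂ false : ℤ) * g' = Z₂ at *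
        generalize (n : ℤ) * g' = Z₃ at *
        push_cast at h7
        rcases abs_cases Z₁ with h | h <;> rcases abs_cases (Z₃ - Z₂) with h' | h' <;> omega
      · have := hule (!b)
        have := abs_add_le (co (!b) (stPos A t sh F k τ)) (co (!b) u)
        have := hYi (!b)
        rw [co_add]
        push_cast at *
        omega
  · intro k τ hk
    by_cases hk' : k < j
    · rcases hconfj k τ (Or.inl hk') with h | ⟨h, -⟩
      · exact ⟨_, h.1.trans (by push_cast; omega)⟩
      · exact ⟨_, h.1.trans (by push_cast; omega)⟩
    · obtain ⟨rfl, hτ⟩ : k = j ∧ τ ≤ max L₁ L₂ := by omega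
      refine ⟨b, ((hC₀ k le_rfl b).2.2 τ).trans (by push_cast; omega)⟩
  · intro k τ q hk hq
    by_cases hk' : k < j ∨ k = j ∧ τ < stT A sh F j
    · obtain ⟨c, h1, h2⟩ : ∃ c, Confined A t sh F D c k τ := by
        rcases hconfj k τ hk' with h | ⟨h, -⟩
        exacts [⟨_, h⟩, ⟨_, h⟩]
      have h2 := h2 q hq
      refine ⟨c, ?_⟩
      rw [co_sub]
      exact (abs_sub _ _).trans (by push_cast; omega)
    · obtain ⟨rfl, hτ, hτ'⟩ : k = j ∧ stT A sh F j ≤ τ ∧ τ ≤ max L₁ L₂ := by omega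
      rw [M.stTok_eq hl hτ] at hq
      cases hq
      refine ⟨b, ?_⟩
      have := (hC₀ k le_rfl b).2.2 τ
      have := hYj b
      rw [co_sub]
      exact (abs_sub _ _).trans (by push_cast; omega)

end Confined

end BHS

namespace BHS

/-! ### All trips lie in two lines. -/

section Aligned

variable {S : Type*} {A : Automaton S} {t R : ℕ} {sh : Contact S → Shape}
  {F : Contact S → Option (Contact S)}

/-- In stage `i`, the agent is displaced in a direction parallel to an axis, for the first time. -/
def FirstAlong (A : Automaton S) (sh : Contact S → Shape) (F : Contact S → Option (Contact S))
    (b : Bool) (i : ℕ) : Prop :=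
  co b (stW A sh F i) = 0 ∧ ∀ i' < i, co b (stW A sh F i') ≠ 0

theorem FirstAlong.unique {b : Bool} {i i' : ℕ} (h : FirstAlong A sh F b i)
    (h' : FirstAlong A sh F b i') : i = i' := by
  rcases lt_trichotomy i i' with hlt | heq | hlt
  · exact absurd h.1 (h'.2 i hlt)
  · exact heq
  · exact absurd h'.1 (h.2 i' hlt)

/-- The trip of stage `k` is parallel to an axis, and in the same line as the first trip parallel to
this axis. -/
def Aligned (A : Automaton S) (t : ℕ) (sh : Contact S → Shape)
    (F : Contact S → Option (Contact S)) (k : ℕ) (b : Bool) (i : ℕ) : Prop :=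
  i ≤ k ∧ co b (stW A sh F k) = 0 ∧ FirstAlong A sh F b i ∧
    ∀ τ ≥ stT A sh F k, co b (stPos A t sh F k τ) = co b (stY A sh F i)

theorem Model.eq_of_co_stW (M : Model A t sh R F) {k : ℕ} (hl : (sh (stage A sh F k).1).leg)
    {b b' : Bool} (h : co b (stW A sh F k) = 0) (h' : co b' (stW A sh F k) = 0) : b = b' := by
  by_contra hne
  refine (M.spec _).ne_zero hl (co_ext fun c => ?_)
  rw [co_zero]
  cases b <;> cases b' <;> cases c <;> first | assumption | exact absurd rfl hne

theorem Model.exists_bound_aligned (M : Model A t sh R F) (j : ℕ) : ∃ C : ℕ, ∀ k < j,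
    (sh (stage A sh F k).1).leg → (∀ τ < stT A sh F k, ∀ c, Confined A t sh F C c k τ) ∧
      ∀ b i, Aligned A t sh F k b i → (sh (stage A sh F i).1).leg →
        ∀ τ, Confined A t sh F C b k τ := by
  obtain ⟨C, hC⟩ := M.exists_bound j
  refine ⟨C, fun k hk hl => ⟨fun τ hτ c => (hC k hk.le c).1 τ (by omega),
    fun b i hb hi τ => ?_⟩⟩
  by_cases hτ : τ < stT A sh F k
  · exact (hC k hk.le b).1 τ (by omega)
  · have hτ := not_lt.1 hτ
    refine ⟨?_, fun q hq => ?_⟩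
    · rw [hb.2.2.2 τ hτ]
      exact (hC i (hb.1.trans hk.le) b).2.1 hi
    · rw [M.stTok_eq hl hτ] at hq
      cases hq
      exact (hC k hk.le b).2.1 hl

/-- By periodicity the determinants form a bounded set of integers; by hypothesis it is closed under
differences. A nonzero element would have all its multiples in the set. -/
theorem Model.det_eq_zero (M : Model A t sh R F) {k : ℕ} (hl : (sh (stage A sh F k).1).leg)
    (h : ∀ τ₁ ≥ stT A sh F k, ∀ τ₂ ≥ stT A sh F k, ∃ τ ≥ stT A sh F k,
      det (stW A sh F k) (stPos A t sh F k τ - stY A sh F k) =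
        det (stW A sh F k) (stPos A t sh F k τ₁ - stPos A t sh F k τ₂)) {τ : ℕ}
    (hτ : stT A sh F k ≤ τ) :
    det (stW A sh F k) (stPos A t sh F k τ - stY A sh F k) = 0 := by
  set f : ℕ → ℤ := fun τ => det (stW A sh F k) (stPos A t sh F k τ - stY A sh F k) with hf
  have h' : ∀ τ₁ ≥ stT A sh F k, ∀ τ₂ ≥ stT A sh F k, ∃ τ ≥ stT A sh F k,
      f τ = f τ₁ - f τ₂ := by
    intro τ₁ h₁ τ₂ h₂
    obtain ⟨τ, h1, h2⟩ := h τ₁ h₁ τ₂ h₂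
    refine ⟨τ, h1, ?_⟩
    simp only [hf]
    rw [h2]
    simp only [det_sub]
    ring
  obtain ⟨K, hK⟩ : ∃ K : ℕ, ∀ τ ≥ stT A sh F k, |f τ| ≤ K := by
    obtain ⟨K, hK⟩ := ((Finset.range (stT A sh F k + stP A sh F k)).image
      fun τ => (f τ).natAbs).finite_toSet.bddAbove
    refine ⟨K, fun τ hτ => ?_⟩
    obtain ⟨τ', n, h1, h2, rfl⟩ := (M.spec (stage A sh F k).1).exists_reduce τ hτ
    have h3 : f (τ' + n * (sh (stage A sh F k).1).P) = f τ' := by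
      have := M.stPos_add_mul hl n (τ := τ') h1
      rw [stP] at this
      simp only [hf, det_sub, this, det_add, det_nsmul_self]
      ring
    rw [h3, ← Int.natCast_natAbs]
    have h4 : (f τ').natAbs ≤ K := hK (by
      rw [Finset.mem_coe]
      exact Finset.mem_image.2 ⟨τ', Finset.mem_range.2 h2, rfl⟩)
    exact_mod_cast h4
  by_contra hne
  have hmul : ∀ n : ℕ, ∃ τ' ≥ stT A sh F k, f τ' = n * f τ := by
    intro n
    induction n with
    | zero =>
      obtain ⟨τ', h1, h2⟩ := h' τ hτ τ hτ
      exact ⟨τ', h1, by rw [h2]; simp⟩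
    | succ n ih =>
      obtain ⟨τ₁, h1, h2⟩ := ih
      obtain ⟨τ₂, h3, h4⟩ := h' τ hτ τ hτ
      obtain ⟨τ₃, h5, h6⟩ := h' τ₂ h3 τ hτ
      obtain ⟨τ₄, h7, h8⟩ := h' τ₁ h1 τ₃ h5
      refine ⟨τ₄, h7, ?_⟩
      rw [h8, h6, h4, h2]
      push_cast
      ring
  obtain ⟨τ', h1, h2⟩ := hmul (K + 1)
  have h3 := hK τ' h1
  rw [h2, abs_mul, Nat.abs_cast] at h3
  have h4 : 1 ≤ |f τ| := Int.one_le_abs hne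
  push_cast at h3
  nlinarith

/-- All moves of the trip are parallel to `w`. A unit step is parallel to an axis, so if both
coordinates of `w` were nonzero, the agent could not move at all, contrary to `w ≠ 0`. -/
theorem Model.exists_co_eq (M : Model A t sh R F) {k : ℕ} (hl : (sh (stage A sh F k).1).leg)
    (h : ∀ τ ≥ stT A sh F k, det (stW A sh F k) (stPos A t sh F k τ - stY A sh F k) = 0) :
    ∃ b, co b (stW A sh F k) = 0 ∧
      ∀ τ ≥ stT A sh F k, co b (stPos A t sh F k τ) = co b (stY A sh F k) := by
  have hw : stW A sh F k ≠ 0 := (M.spec _).ne_zero hl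
  obtain ⟨b, hb⟩ : ∃ b, co b (stW A sh F k) = 0 := by
    by_contra hc
    push Not at hc
    have h0 := hc false
    have h1 := hc true
    have hstep : ∀ τ ≥ stT A sh F k, stPos A t sh F k (τ + 1) = stPos A t sh F k τ := by
      intro τ hτ
      have e1 : det (stW A sh F k) (stPos A t sh F k (τ + 1) - stPos A t sh F k τ) = 0 := by
        have g1 := h τ hτ
        have g2 := h (τ + 1) (by omega)
        rw [det_sub] at g1 g2 ⊢
        linarith
      have e2 : stPos A t sh F k (τ + 1) - stPos A t sh F k τ =
          (plane A t (stage A sh F k).1 (τ + 1)).pos - (plane A t (stage A sh F k).1 τ).pos := by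
        rw [stPos, stPos]; abel
      rw [e2, plane_succ] at e1
      rw [stPos, stPos, plane_succ]
      rcases Lite.step_pos A t Dir.nextZ (plane A t (stage A sh F k).1 τ) with g | ⟨d, g⟩
      · rw [g]
      · rw [g] at e1
        exfalso
        cases d <;> simp [det, co, Dir.nextZ] at e1 <;> first | exact h0 e1 | exact h1 e1
    have hconst : ∀ n, stPos A t sh F k (stT A sh F k + n) = stPos A t sh F k (stT A sh F k) := by
      intro n
      induction n with
      | zero => rfl
      | succ n ih => rw [← add_assoc, hstep _ (by omega), ih]
    have g1 := M.stPos_add_mul hl 1 (le_refl (stT A sh F k))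
    rw [hconst, one_nsmul] at g1
    exact hw (left_eq_add.1 g1)
  refine ⟨b, hb, fun τ hτ => ?_⟩
  have h2 := h τ hτ
  rw [det] at h2
  have hne : co (!b) (stW A sh F k) ≠ 0 := fun h' => by
    have := M.eq_of_co_stW hl hb h'
    cases b <;> simp at this
  cases b
  · rw [hb, zero_mul, zero_sub, neg_eq_zero] at h2
    have := (mul_eq_zero.1 h2).resolve_left hne
    rw [co_sub] at this
    omega
  · rw [hb, zero_mul, sub_zero] at h2
    have := (mul_eq_zero.1 h2).resolve_left hne
    rw [co_sub] at this
    omega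

/-- Strong induction: the alignment of the earlier trips provides the confinement needed for the
next one. If an earlier trip is parallel to the same axis, `Model.co_eq` applies with the first such
trip; otherwise the direction is new, and `Model.det_mem` shows that the trip is in the line of its
own token. -/
theorem Model.exists_aligned (M : Model A t sh R F) (ht : t ≤ 1) (hs : Solves A 3 t) {k : ℕ}
    (hr : Reached A sh F k) (hl : (sh (stage A sh F k).1).leg) :
    ∃ b i, Aligned A t sh F k b i := by
  classical
  induction k using Nat.strong_induction_on with
  | _ k ih =>
    have hleg : ∀ k' < k, (sh (stage A sh F k').1).leg := fun k' h => M.isLeg_of_reached (hr k' h)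
    obtain ⟨C, hC⟩ := M.exists_bound_aligned k
    have hbef : ∀ k' < k, ∃ b i, Aligned A t sh F k' b i ∧
        ∀ τ, Confined A t sh F C b k' τ := by
      intro k' hk'
      obtain ⟨b, i, h⟩ := ih k' hk' (hr.mono hk'.le) (hleg k' hk')
      exact ⟨b, i, h, (hC k' hk' (hleg k' hk')).2 b i h (hleg i (h.1.trans_lt hk'))⟩
    by_cases hpar : ∃ b, co b (stW A sh F k) = 0 ∧ ∃ i < k, co b (stW A sh F i) = 0
    · obtain ⟨b, hb, hex⟩ := hpar
      obtain ⟨hik, hib⟩ := Nat.find_spec hex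
      set i := Nat.find hex with hi
      have hfirst : FirstAlong A sh F b i :=
        ⟨hib, fun i' hi' h0 => Nat.find_min hex hi' ⟨hi'.trans hik, h0⟩⟩
      have hsame : ∀ k' < k, ∀ i', Aligned A t sh F k' b i' → i' = i := fun k' _ i' h =>
        h.2.2.1.unique hfirst
      refine ⟨b, i, hik.le, hb, hfirst, fun τ hτ => ?_⟩
      refine M.co_eq ht hs hik hr hl hib hb ?_ (C := C) ?_ ?_ hτ
      · obtain ⟨b', i', h, -⟩ := hbef i hik
        obtain rfl := M.eq_of_co_stW (hleg i hik) hib h.2.1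
        obtain rfl := hsame i hik i' h
        exact h.2.2.2
      · intro k' hk' τ
        obtain ⟨b', i', h, h'⟩ := hbef k' (hk'.trans hik)
        have hne : b' ≠ b := by
          rintro rfl
          exact hfirst.2 k' hk' h.2.1
        rw [← Bool.eq_not.2 hne]
        exact h' τ
      · intro k' hk' τ
        obtain ⟨b', i', h, h'⟩ := hbef k' hk'
        by_cases hne : b' = b
        · subst hne
          by_cases hτ : τ < stT A sh F k'
          · exact Or.inl ((hC k' hk' (hleg k' hk')).1 τ hτ _)
          · obtain rfl := hsame k' hk' i' h
            exact Or.inr ⟨h' τ, h.2.2.2 τ (not_lt.1 hτ)⟩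
        · rw [← Bool.eq_not.2 hne]
          exact Or.inl (h' τ)
    · push Not at hpar
      have hzero : ∀ τ ≥ stT A sh F k,
          det (stW A sh F k) (stPos A t sh F k τ - stY A sh F k) = 0 := fun τ hτ => by
        refine M.det_eq_zero hl (fun τ₁ h₁ τ₂ h₂ => M.det_mem ht hs hr hl (C := C) ?_ h₁ h₂) hτ
        intro k' hk' τ
        obtain ⟨b, i, h, h'⟩ := hbef k' hk'
        exact ⟨b, fun h0 => hpar b h0 k' hk' h.2.1, h' τ⟩
      obtain ⟨b, hb, h⟩ := M.exists_co_eq hl hzero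
      exact ⟨b, k, le_rfl, hb, ⟨hb, hpar b hb⟩, h⟩

/-- All trips are in the same two lines. -/
theorem Model.exists_lines (M : Model A t sh R F) (ht : t ≤ 1) (hs : Solves A 3 t) :
    ∃ r : Bool → ℤ, ∀ k, Reached A sh F k → (sh (stage A sh F k).1).leg →
      ∃ b, ∀ τ ≥ stT A sh F k, co b (stPos A t sh F k τ) = r b := by
  have hr : ∀ b, ∃ r, ∀ i, FirstAlong A sh F b i → co b (stY A sh F i) = r := by
    intro b
    by_cases h : ∃ i, FirstAlong A sh F b i
    · obtain ⟨i, hi⟩ := h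
      exact ⟨_, fun i' hi' => by rw [hi'.unique hi]⟩
    · exact ⟨0, fun i hi => absurd ⟨i, hi⟩ h⟩
  choose r hr using hr
  refine ⟨r, fun k hk hl => ?_⟩
  obtain ⟨b, i, h⟩ := M.exists_aligned ht hs hk hl
  exact ⟨b, fun τ hτ => by rw [h.2.2.2 τ hτ, hr b i h.2.2.1]⟩

end Aligned

end BHS

namespace BHS

/-! ### Few nodes are visited, and three agents can stay apart forever. -/

section Conclusion

variable {S : Type*} {A : Automaton S} {t R : ℕ} {sh : Contact S → Shape}
  {F : Contact S → Option (Contact S)}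

theorem proj_add_mul_nsmul (N k : ℕ) (z w : ℤ × ℤ) : proj N (z + (k * N) • w) = proj N z := by
  refine (proj_eq_iff N _ _).2 fun b => ⟨k * co b w, ?_⟩
  rw [co_add, co_nsmul]
  push_cast
  ring

/-- On a torus, an agent that has settled down repeats its moves. -/
theorem Model.exists_lt_proj_eq (M : Model A t sh R F) {N i : ℕ} (hN : 0 < N)
    (hl : ¬ (sh (stage A sh F i).1).leg) (τ : ℕ) :
    ∃ τ' < stT A sh F i + N * stP A sh F i,
      proj N (stPos A t sh F i τ) = proj N (stPos A t sh F i τ') := by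
  have hP : 0 < N * stP A sh F i := Nat.mul_pos hN (M.spec _).pos
  by_cases hτ : τ < stT A sh F i
  · exact ⟨τ, by omega, rfl⟩
  · refine ⟨stT A sh F i + (τ - stT A sh F i) % (N * stP A sh F i), ?_, ?_⟩
    · have := Nat.mod_lt (τ - stT A sh F i) hP
      omega
    · have h1 := Nat.mod_add_div (τ - stT A sh F i) (N * stP A sh F i)
      set τ' := stT A sh F i + (τ - stT A sh F i) % (N * stP A sh F i) with hτ'
      set q := (τ - stT A sh F i) / (N * stP A sh F i) with hq
      have h2 : τ = τ' + (q * N) * stP A sh F i := by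
        have : N * stP A sh F i * q = (q * N) * stP A sh F i := by ring
        omega
      have h3 := (M.spec (stage A sh F i).1).map_mul hl (q * N) τ' (by
        rw [hτ', stT]; exact Nat.le_add_right _ _)
      rw [h2, stPos, stP, h3]
      change proj N (_ + _ + _) = _
      rw [add_right_comm, proj_add_mul_nsmul]
      rfl

/-- On a trip, one coordinate is constant and therefore within `2 * R` of that of the token, as it
was when the trip began; outside of trips both coordinates are. -/
theorem Model.near_sub_tok (M : Model A t sh R F) {r : Bool → ℤ} {k : ℕ}
    (h : (sh (stage A sh F k).1).leg →
      ∃ b, ∀ τ ≥ stT A sh F k, co b (stPos A t sh F k τ) = r b) {τ : ℕ} {q : ℤ × ℤ}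
    (hq : stTok A t sh F k τ = some q) : Near (2 * R) (stPos A t sh F k τ - q) := by
  by_cases hτ : (sh (stage A sh F k).1).leg ∧ stT A sh F k ≤ τ
  · obtain ⟨b, hb⟩ := h hτ.1
    rw [M.stTok_eq hτ.1 hτ.2] at hq
    cases hq
    have h1 := M.bdd.pos (stage A sh F k).1 (stT A sh F k) (by rw [stT]; omega) b
    have h2 := M.bdd.y M.spec (stage A sh F k).1 hτ.1 b
    refine ⟨b, ?_⟩
    have h3 : co b (stPos A t sh F k τ - stY A sh F k) =
        co b (plane A t (stage A sh F k).1 (stT A sh F k)).pos -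
          co b (sh (stage A sh F k).1).y := by
      rw [co_sub, hb τ hτ.2, ← hb _ le_rfl, stPos, stY, co_add, co_add]
      ring
    rw [h3]
    exact (abs_sub _ _).trans (by push_cast; omega)
  · obtain ⟨q', h1, rfl⟩ := Option.map_eq_some_iff.1 hq
    refine ⟨true, ?_⟩
    have := M.bdd.tok_lt M.spec (stage A sh F k).1 τ (fun hl => by
      rw [stT] at hτ
      by_contra hc
      exact hτ ⟨hl, by omega⟩) q' h1 true
    rw [stPos, co_sub, co_add, co_add, add_sub_add_right_eq_sub]
    exact this.trans (by push_cast; omega)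

/-- Before it sets out on a trip, the agent is within `R` of the token left on the previous trip,
which in turn is within `2 * R` of the line of that trip. -/
theorem Model.near_stPos (M : Model A t sh R F) {r : Bool → ℤ} {B : ℕ} (hB : ∀ b, |r b| ≤ B)
    (h : ∀ k, Reached A sh F k → (sh (stage A sh F k).1).leg →
      ∃ b, ∀ τ ≥ stT A sh F k, co b (stPos A t sh F k τ) = r b) {k : ℕ}
    (hk : Reached A sh F k) (hl : (sh (stage A sh F k).1).leg) (τ : ℕ) :
    Near (B + 3 * R) (stPos A t sh F k τ) := by
  by_cases hτ : stT A sh F k ≤ τ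
  · obtain ⟨b, hb⟩ := h k hk hl
    exact ⟨b, by rw [hb τ hτ]; exact (hB b).trans (by push_cast; omega)⟩
  · have h1 := M.bdd.pos (stage A sh F k).1 τ (by rw [stT] at hτ; omega)
    cases k with
    | zero =>
      refine ⟨true, ?_⟩
      rw [stPos, co_add, show (stage A sh F 0).2 = 0 from rfl, co_zero, add_zero]
      exact (h1 true).trans (by push_cast; omega)
    | succ k =>
      have hl' := M.isLeg_of_reached (hk k k.lt_succ_self)
      obtain ⟨b, hb⟩ := h k (hk.mono k.le_succ) hl'
      have h2 := M.bdd.pos (stage A sh F k).1 (stT A sh F k) (by rw [stT]; omega) b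
      have h3 := M.bdd.y M.spec (stage A sh F k).1 hl' b
      have h4 := hb _ le_rfl
      have h5 := hB b
      have h6 := h1 b
      rw [← h4, stPos, co_add] at h5
      refine ⟨b, ?_⟩
      rw [stPos, co_add,
        show (stage A sh F (k + 1)).2 = (stage A sh F k).2 + (sh (stage A sh F k).1).y from rfl,
        co_add]
      rw [abs_le] at *
      push_cast
      omega

/-- Trips stay in a cross of bounded width, and an agent that settles down repeats its moves on the
torus after `N` periods. So linearly many nodes in `N` are visited, and `exists_apart` contradicts
`false_of_forall_apart`. -/
theorem two_le_of_solves [Finite S] (A : Automaton S) (t : ℕ) (hs : Solves A 3 t) : 2 ≤ t := by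
  classical
  by_contra htt
  have ht : t ≤ 1 := by omega
  obtain ⟨sh, R, F, M⟩ := exists_model A t
  obtain ⟨r, hr⟩ := M.exists_lines ht hs
  -- Only trips are followed by another stage, so at most one stage is not a trip; `e = 0` is a
  -- dummy value if there is none.
  obtain ⟨e, he⟩ : ∃ e, ∀ k, Reached A sh F k → ¬ (sh (stage A sh F k).1).leg → k = e := by
    by_cases hex : ∃ e, Reached A sh F e ∧ ¬ (sh (stage A sh F e).1).leg
    · obtain ⟨e, h1, h2⟩ := hex
      refine ⟨e, fun k hk hl => ?_⟩
      rcases lt_trichotomy k e with h | h | h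
      · exact absurd (M.isLeg_of_reached (h1 k h)) hl
      · exact h
      · exact absurd (M.isLeg_of_reached (hk e h)) h2
    · exact ⟨0, fun k hk hl => absurd ⟨k, hk, hl⟩ hex⟩
  set B := (r false).natAbs + (r true).natAbs with hB
  have hrB : ∀ b, |r b| ≤ B := fun b => by
    rw [hB]
    push_cast
    cases b <;> simp
  set K := 2 * (2 * (B + 3 * R) + 1) + stT A sh F e + stP A sh F e with hK
  obtain ⟨N, hNge, hnext⟩ := M.large (6 * (2 * (2 * R) + 1) + 3 +
    Nat.card (Fin 3 × Option Dir) * K + 1)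
  have hN : Fits A t R F N := ⟨by omega, hnext⟩
  have hne : NeZero N := ⟨by omega⟩
  set U : Finset (Node N N) := cross (B + 3 * R) N ∪
    (Finset.range (stT A sh F e + N * stP A sh F e)).image
      fun τ => proj N (stPos A t sh F e τ) with hU
  have hUcard : U.card ≤ K * N := by
    have h1 := card_cross_le (B + 3 * R) N
    have h2 := Finset.card_image_le (s := Finset.range (stT A sh F e + N * stP A sh F e))
      (f := fun τ => proj N (stPos A t sh F e τ))
    rw [Finset.card_range] at h2
    have h3 : stT A sh F e ≤ stT A sh F e * N := Nat.le_mul_of_pos_right _ (NeZero.pos N)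
    calc U.card ≤ _ := Finset.card_union_le _ _
      _ ≤ 2 * (2 * (B + 3 * R) + 1) * N + (stT A sh F e * N + N * stP A sh F e) := by omega
      _ = K * N := by rw [hK]; ring
  have hsmall : Small U := by
    unfold Small
    refine (Nat.mul_le_mul_left _ hUcard).trans_lt ?_
    rw [← mul_assoc]
    exact Nat.mul_lt_mul_of_pos_right (by omega) (NeZero.pos N)
  obtain ⟨b, start, h⟩ := exists_apart (A := A) (t := t) (B := 2 * R) (by omega) U hsmall
  refine false_of_forall_apart ht (fun T => h T fun τ₀ _ => ?_) (hs N N (by omega) (by omega))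
  obtain ⟨k, hk, τ, rfl, hτ⟩ := exists_stage hN τ₀ (A := A) (sh := sh)
  obtain ⟨h1, h2⟩ := M.run_stage hN hk hτ
  rw [h1, h2]
  refine ⟨?_, fun q hq => ?_⟩
  · by_cases hl : (sh (stage A sh F k).1).leg
    · exact Finset.mem_union_left _ (M.near_stPos hrB hr hk hl τ).mem_cross
    · obtain rfl := he k hk hl
      obtain ⟨τ', h3, h4⟩ := M.exists_lt_proj_eq (NeZero.pos N) hl τ
      rw [h4]
      exact Finset.mem_union_right _ (Finset.mem_image.2 ⟨τ', Finset.mem_range.2 h3, rfl⟩)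
  · obtain ⟨q', h3, rfl⟩ := Option.map_eq_some_iff.1 hq
    exact ⟨_, M.near_sub_tok (hr k hk) h3, by rw [← proj_add, add_sub_cancel]⟩

end Conclusion

end BHS

theorem mainTheorem2 :
    (∀ (S : Type*) (A : BHS.Automaton S) (k t n m : ℕ), 3 ≤ n → 3 ≤ m →
      BHS.SolvesOn A k t n m → 3 ≤ k) ∧
    (∀ (S : Type*) [Finite S] (A : BHS.Automaton S) (t : ℕ),
      BHS.Solves A 3 t → 2 ≤ t) := by
  exact ⟨fun _ A k t n m hn hm h => BHS.three_le_of_solvesOn A k t n m hn hm h,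
    fun _ _ A t h => BHS.two_le_of_solves A t h⟩
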